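/- **Setting.** $M,N$ are natural numbers, each equal to $1$ or an odd prime, possibly equal. For odd $n$ and $(n,d)=1$ write $\chi_d(n)=\tilde\chi_n(d)=\left(\frac dn\right)$ (Jacobi symbol); $\chi_d$ is a Dirichlet character modulo $4d$ (for $d\ge1$) and $\tilde\chi_n$ one modulo $n$. Put $L^{(P)}(s,\chi)=L(s,\chi)\prod_{p\mid P}(1-\chi(p)p^{-s})$. Write every positive integer $d$ as $d=d_0d_1^2$ with $d_0$ squarefree. For a Dirichlet character $\chi$ let $$P^{(\chi)}_{d_0,d_1}(s)=\prod_{p^\alpha\Vert d_1}\Big[\sum_{n=0}^{\alpha}\chi(p^{2n})p^{n-2ns}-\sum_{n=0}^{\alpha-1}(\chi_{d_0}\chi)(p^{2n+1})p^{n-(2n+1)s}\Big],$$ and for Dirichlet characters $\chi,\chi'$ let $$Z(s,w;\chi,\chi')=\sum_{d\ge1,\ (d,2MN)=1}\frac{L^{(2MN)}(s,\chi_{d_0}\chi)\,\chi'(d)\,P^{(\chi)}_{d_0,d_1}(s)}{d^w}\qquad(\Re s>1,\ \Re w>1).$$ Let $$R_1^{(2)}=\{\Re w\le0,\ \Re s+\Re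 w>\tfrac32\}\cup\{0<\Re w\le1,\ \tfrac12\Re w+\Re s>\tfrac32\}\cup\{\Re s>1,\ \Re w>1\}.$$ For a Dirichlet character $\chi^\star$ and $P\ge 1$ put $F_1^{(\chi^\star)}(w)=1$, $G_1^{(\chi^\star)}(w)=0$, and for $P>1$ $$F_P^{(\chi^\star)}(w)=\frac{\chi^\star(P^2)P-P^2}{\chi^\star(P^2)P^{2w}-P^2},\qquad G_P^{(\chi^\star)}(w)=\frac{\chi^\star(P)(P^{2-w}-P^{1+w})}{\chi^\star(P^2)P^{2w}-P^2}.$$ For $n\mid MN$ let $A_n^{(\chi^\star)}$ be given by $$A_1=F_MF_N,\quad A_M=F_NG_M,\quad A_N=F_MG_N,\quad A_{MN}=G_MG_N$$ (all with superscript $(\chi^\star)$; if some of the indices $1,M,N,MN$ coincide, the first formula in this order applies, and if $n$ is none of them, $A_n=0$). **Theorem.** Let $\chi$ and $\chi'$ be primitive Dirichlet characters modulo squarefree $k$ and $j$ respectively, where $j,k\mid MN$, $\chi'^2=1$ (so $\chi'$ is quadratic, or trivial when $j=1$), and, if $M=N$, $j=k=M=N$. Let $\psi,\psi'$ be Dirichlet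 characters modulo $8$. There exist functions $a_n^{(\chi',\psi')}(w;\psi^\star)$, for $n\mid MN$ and $\psi^\star$ a Dirichlet character modulo $8$ (not depending on $\chi$, $k$, $\psi$ or $s$), which are meromorphic on $\mathbb C$, holomorphic except for possible poles at the positive integers and countably many poles on the line $\Re w=1$, and which satisfy, for every $\delta>0$, $$|a_n^{(\chi',\psi')}(w;\psi^\star)|\le C(\delta)\,(16\pi)^{|\Re w|}(1+|w|)^{1/2-\Re w}$$ for all $w$ at distance at least $\delta$ from all poles of $a_n^{(\chi',\psi')}(\cdot\,;\psi^\star)$, where $C(\delta)$ depends only on $\delta$ (not on $M,N,j,k$, the characters or $n$), such that the following holds. The functions $Z(\cdot,\cdot;\chi\psi,\chi'\psi')$ and $Z(\cdot,\cdot;\chi\tilde\chi_n\psi\psi^\star,\chi'\psi')$ continue holomorphically from $\{\Re s,\Re w>1\}$, where their series converge absolutely, to $R_1^{(2)}$ minus the line $\{w=1\}$, and $$Z(s,w;\chi\psi,\chi'\psi')=j^{1/2-w}\sum_{n\mid MN}A_n^{(\chi')}(w)\sum_{\psi^\star\in\widehat{(\mathbb Z/8\mathbb Z)^*}}a_n^{(\chi',\psi')}(w;\psi^\star)\,Z\big(s+w-\tfrac12,\,1-w;\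 \chi\tilde\chi_n\psi\psi^\star,\ \chi'\psi'\big)$$ for all $(s,w)\in R_1^{(2)}$ such that neither $(s,w)$ nor $(s+w-\frac12,1-w)$ lies on the polar line where the second variable equals $1$ (i.e. $w\ne1$, $w\ne0$) and $w$ is not a pole of any of the functions $A_n^{(\chi')}$, $a_n^{(\chi',\psi')}(\cdot\,;\psi^\star)$. -/

import Mathlib

noncomputable section

namespace DoubleDirichlet

/-- The squarefree part `d₀` in the decomposition `d = d₀ d₁²`. -/
def sqfreePart (d : ℕ) : ℕ := ∏ p ∈ d.primeFactors, p ^ (d.factorization p % 2)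

/-- The part `d₁` in the decomposition `d = d₀ d₁²` with `d₀` squarefree. -/
def sqPart (d : ℕ) : ℕ := ∏ p ∈ d.primeFactors, p ^ (d.factorization p / 2)

theorem sqfreePart_mul_sqPart_sq {d : ℕ} (hd : d ≠ 0) :
    sqfreePart d * sqPart d ^ 2 = d := by
  conv_rhs => rw [← Nat.prod_factorization_pow_eq_self hd]
  rw [sqfreePart, sqPart, ← Finset.prod_pow, ← Finset.prod_mul_distrib, Finsupp.prod]
  refine Finset.prod_congr (by simp) fun p _ => ?_
  rw [← pow_mul, ← pow_add]
  congr 1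
  omega

theorem squarefree_sqfreePart (d : ℕ) : Squarefree (sqfreePart d) := by
  rw [sqfreePart]
  refine Finset.squarefree_prod_of_pairwise_isCoprime ?_ ?_
  · intro p hp q hq hpq
    have h1 := Nat.prime_of_mem_primeFactors hp
    have h2 := Nat.prime_of_mem_primeFactors hq
    exact Nat.coprime_iff_isRelPrime.1 (Nat.Coprime.pow _ _ ((Nat.coprime_primes h1 h2).2 hpq))
  · intro p hp
    have hpp := Nat.prime_of_mem_primeFactors hp
    rcases Nat.mod_two_eq_zero_or_one (d.factorization p) with h | h
    · simp [h]
    · simpa [h] using hpp.prime.squarefree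

open Classical in
/-- The character `χ_d(n) = (d / n)` (Jacobi symbol) modulo `4 d`. -/
def chi (d : ℕ) : DirichletCharacter ℂ (4 * d) where
  toFun x := if IsUnit x then ((jacobiSym (d : ℤ) x.val : ℤ) : ℂ) else 0
  map_one' := by
    rw [if_pos isUnit_one]
    rcases Nat.eq_zero_or_pos d with rfl | hd
    · have h : (1 : ZMod (4 * 0)).val = 1 := rfl
      rw [h]; simp
    · have : Fact (1 < 4 * d) := ⟨by omega⟩
      rw [ZMod.val_one]; simp
  map_mul' x y := by
    have hodd : ∀ z : ZMod (4 * d), IsUnit z → Odd z.val := by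
      rintro z ⟨u, rfl⟩
      have h := ZMod.val_coe_unit_coprime u
      have h2 : Nat.Coprime (u : ZMod (4 * d)).val 2 :=
        Nat.Coprime.coprime_dvd_right ⟨2 * d, by ring⟩ h
      exact (Nat.coprime_two_right).1 h2
    by_cases hx : IsUnit x
    · by_cases hy : IsUnit y
      · have ox := hodd x hx
        have oy := hodd y hy
        rw [if_pos hx, if_pos hy, if_pos (hx.mul hy), ZMod.val_mul]
        have h := jacobiSym.mod_right (d : ℤ) (ox.mul oy)
        rw [Int.natAbs_natCast] at h
        rw [← h, jacobiSym.mul_right' _ ox.pos.ne' oy.pos.ne', Int.cast_mul]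
      · rw [if_neg hy, if_neg (fun h => hy (isUnit_of_mul_isUnit_right h)), mul_zero]
    · rw [if_neg hx, if_neg (fun h => hx (isUnit_of_mul_isUnit_left h)), zero_mul]
  map_nonunit' x hx := if_neg hx

open Classical in
/-- The character `χ̃_n(d) = (d / n)` (Jacobi symbol) modulo `n`. -/
def chiTilde (n : ℕ) : DirichletCharacter ℂ n where
  toFun x := if IsUnit x then ((jacobiSym (x.val : ℤ) n : ℤ) : ℂ) else 0
  map_one' := by
    rw [if_pos isUnit_one, ZMod.val_one_eq_one_mod]
    push_cast
    rw [← jacobiSym.mod_left]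
    simp
  map_mul' x y := by
    by_cases hx : IsUnit x
    · by_cases hy : IsUnit y
      · rw [if_pos hx, if_pos hy, if_pos (hx.mul hy), ZMod.val_mul]
        push_cast
        rw [← jacobiSym.mod_left, jacobiSym.mul_left, Int.cast_mul]
      · rw [if_neg hy, if_neg (fun h => hy (isUnit_of_mul_isUnit_right h)), mul_zero]
    · rw [if_neg hx, if_neg (fun h => hx (isUnit_of_mul_isUnit_left h)), zero_mul]
  map_nonunit' x hx := if_neg hx

/-- The Dirichlet `L`-function `L(s, χ)`, continued analytically. (The value for characters of
level `0`, which never occur below, is a dummy.) -/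
def dirichletL {q : ℕ} (χ : DirichletCharacter ℂ q) (s : ℂ) : ℂ :=
  if h : q = 0 then 0 else haveI : NeZero q := ⟨h⟩; DirichletCharacter.LFunction χ s

/-- `L^{(P)}(s, χ) = L(s, χ) ∏_{p ∣ P} (1 - χ(p) p^{-s})`. -/
def LRemoved (P : ℕ) {q : ℕ} (χ : DirichletCharacter ℂ q) (s : ℂ) : ℂ :=
  dirichletL χ s * ∏ p ∈ P.primeFactors, (1 - χ (p : ZMod q) * (p : ℂ) ^ (-s))

/-- The correction polynomial `P_{d₀,d₁}^{(χ)}(s)`, the product over `p^α ∥ d₁` of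
`∑_{n=0}^{α} χ(p^{2n}) p^{n-2ns} - ∑_{n=0}^{α-1} (χ_{d₀} χ)(p^{2n+1}) p^{n-(2n+1)s}`. -/
def corrP {q : ℕ} (χ : DirichletCharacter ℂ q) (d₀ d₁ : ℕ) (s : ℂ) : ℂ :=
  ∏ p ∈ d₁.primeFactors,
    (∑ n ∈ Finset.range (d₁.factorization p + 1),
        χ ((p ^ (2 * n) : ℕ) : ZMod q) * (p : ℂ) ^ ((n : ℂ) - 2 * n * s)
      - ∑ n ∈ Finset.range (d₁.factorization p),
        ((chi d₀).mul χ) ((p ^ (2 * n + 1) : ℕ) : ZMod ((4 * d₀).lcm q)) *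
          (p : ℂ) ^ ((n : ℂ) - (2 * n + 1) * s))

/-- The term of index `d` of the double Dirichlet series; it vanishes unless `(d, 2MN) = 1`. -/
def zTerm (M N : ℕ) {q q' : ℕ} (χ : DirichletCharacter ℂ q) (χ' : DirichletCharacter ℂ q')
    (s w : ℂ) (d : ℕ) : ℂ :=
  if Nat.Coprime d (2 * M * N) then
    LRemoved (2 * M * N) ((chi (sqfreePart d)).mul χ) s * χ' (d : ZMod q') *
      corrP χ (sqfreePart d) (sqPart d) s / (d : ℂ) ^ w
  else 0

/-- The region `R₁^{(2)}` of pairs `(s, w)`. -/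
def R12 : Set (ℂ × ℂ) :=
  {x | x.2.re ≤ 0 ∧ x.1.re + x.2.re > 3 / 2} ∪
  {x | 0 < x.2.re ∧ x.2.re ≤ 1 ∧ x.2.re / 2 + x.1.re > 3 / 2} ∪
  {x | x.1.re > 1 ∧ x.2.re > 1}

/-- `f` is the holomorphic continuation of the double Dirichlet series from
`{Re s > 1, Re w > 1}`, where the series converges, to `R₁^{(2)}` minus the line `w = 1`.
As this set is open and connected, `f` is determined there. -/
structure IsContinuation (M N : ℕ) {q q' : ℕ} (χ : DirichletCharacter ℂ q)
    (χ' : DirichletCharacter ℂ q') (f : ℂ × ℂ → ℂ) : Prop where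
  holomorphic : DifferentiableOn ℂ f (R12 \ {x | x.2 = 1})
  hasSum : ∀ s w : ℂ, 1 < s.re → 1 < w.re → HasSum (zTerm M N χ χ' s w) (f (s, w))

/-- The double Dirichlet series `Z(s, w; χ, χ')`, as a function of `(s, w)`, continued
to `R₁^{(2)}` minus the line `w = 1`. -/
def Z (M N : ℕ) {q q' : ℕ} (χ : DirichletCharacter ℂ q) (χ' : DirichletCharacter ℂ q') :
    ℂ × ℂ → ℂ :=
  Classical.epsilon (IsContinuation M N χ χ')

/-- `F_P^{(χ)}(w)`. -/
def coeffF {q : ℕ} (χ : DirichletCharacter ℂ q) (P : ℕ) (w : ℂ) : ℂ :=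
  if P = 1 then 1 else
    (χ ((P ^ 2 : ℕ) : ZMod q) * (P : ℂ) - (P : ℂ) ^ 2) /
      (χ ((P ^ 2 : ℕ) : ZMod q) * (P : ℂ) ^ (2 * w) - (P : ℂ) ^ 2)

/-- `G_P^{(χ)}(w)`. -/
def coeffG {q : ℕ} (χ : DirichletCharacter ℂ q) (P : ℕ) (w : ℂ) : ℂ :=
  if P = 1 then 0 else
    χ (P : ZMod q) * ((P : ℂ) ^ (2 - w) - (P : ℂ) ^ (1 + w)) /
      (χ ((P ^ 2 : ℕ) : ZMod q) * (P : ℂ) ^ (2 * w) - (P : ℂ) ^ 2)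

/-- `A_n^{(χ)}(w)` for `n ∣ MN`. When some of the indices `1, M, N, MN` coincide, the first
applicable line counts; the product of a later line with the same index is then zero
in all cases that occur (`M` or `N` equal to `1`, or `χ(M) = χ(N) = 0`). -/
def coeffA (M N : ℕ) {q : ℕ} (χ : DirichletCharacter ℂ q) (n : ℕ) (w : ℂ) : ℂ :=
  if n = 1 then coeffF χ M w * coeffF χ N w
  else if n = M then coeffF χ N w * coeffG χ M w
  else if n = N then coeffF χ M w * coeffG χ N w
  else if n = M * N then coeffG χ M w * coeffG χ N w
  else 0

end DoubleDirichlet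

end

/-! Write χ and χ' for the full first and second characters. Expanding the L-values and the
correction polynomials turns Z(s,w) into an absolutely convergent sum over triples (g,e,m) prime to
2MN, where d = g²e, of g·χ(g)²g^{-2s}·χ'(g)²g^{-2w}·χ'(e)e^{-w}·(e/m)·χ(m)m^{-s} (`prod_localPoly`,
`zTerm_eq_sum`). In this form s and w play parallel roles. Summing over e first (`hasSum_zTerm`) and
grouping n = g²m gives Z = Σ χ(n)n^{-s}c_n(w). Here c_n (`rowCoeff`) is the L-function of e ↦
(e/n₀)χ'(e) with the Euler factors at 2MN removed, times a correction polynomial in w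
(`StarData.rowCoeff_eq`).

A primitive quadratic character of squarefree level is a Jacobi symbol, and every character modulo 8
is induced by a real one of root number 1. The L-functions above therefore belong to real characters
of root number 1 (`SelfDual`), by Gauss' determination of the sign of the quadratic Gauss sum and by
reciprocity. Their functional equation and the symmetry of the correction polynomials give c_n(w) =
n^{1/2-w}·E_n(w)·c_n(1-w) (`StarData.rowCoeff_reflect`). The factor E_n consists of powers of j and
c, a quotient of gamma factors and finitely many quotients of Euler factors. It depends on n only
through (-1/n), (2/n) and (p/n) for p dividing MN. Expanding E_n in these symbols and applying
reciprocity writes it as a combination of the values χ̃_ν(n)ψ*(n), and n^{1/2-w} moves s to s+w-1/2.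
Summing over n gives the functional equation.

The continuation comes from the same rows. Three lines interpolation bounds the L-functions by their
conductor to a power just above `convexityExponent`, uniformly in the character, and R₁^{(2)} is
exactly the region where n^{-s} beats this bound (`mem_R12_iff`). The growth of the coefficients
follows from two-sided Stirling bounds for the gamma quotients. As the bound is claimed at distance
δ from the actual poles only, all candidate poles must be shown to be genuine
(`not_analyticAt_coeffNF`). The functional equation is proved at w off two lines (`genericSet`) and
extended by continuity. -/

namespace DoubleDirichlet

open Complex Filter Topology

/-! ### The sign of the quadratic Gauss sum -/

/-- As `Im τ → ∞` the two-variable theta function at a fixed real point tends to `1`. -/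
theorem tendsto_jacobiTheta₂_one {α : Type*} {l : Filter α} [l.IsCountablyGenerated]
    (x : ℝ) {f : α → ℂ}
    (hf : Tendsto (fun t => (f t).im) l atTop) :
    Tendsto (fun t => jacobiTheta₂ x (f t)) l (𝓝 1) := by
  have h1 : (1 : ℂ) = ∑' n : ℤ, if n = 0 then 1 else 0 := by simp
  rw [h1]
  simp only [jacobiTheta₂]
  refine tendsto_tsum_of_dominated_convergence
    (bound := fun n : ℤ => Real.exp (-Real.pi * (1 * n ^ 2 - 2 * 0 * |n|))) ?_ ?_ ?_
  · simpa using summable_pow_mul_jacobiTheta₂_term_bound 0 one_pos 0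
  · intro n
    rcases eq_or_ne n 0 with rfl | hn
    · simp [jacobiTheta₂_term, tendsto_const_nhds]
    · rw [if_neg hn, tendsto_zero_iff_norm_tendsto_zero]
      simp only [norm_jacobiTheta₂_term, ofReal_im, mul_zero, sub_zero]
      refine Real.tendsto_exp_atBot.comp ?_
      have : 0 < Real.pi * (n : ℝ) ^ 2 := by positivity
      simpa [neg_mul] using (hf.const_mul_atTop this)
  · filter_upwards [hf.eventually_ge_atTop 1] with t ht n
    exact norm_jacobiTheta₂_term_le one_pos (by simp) ht n

/-- Splitting a theta series near a rational point into residue classes. -/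
theorem jacobiTheta₂_zero_eq_sum (q : ℕ) [NeZero q] (β : ℂ) (φ : Fin q → ℂ)
    (hφ : ∀ (k : ℤ) (r : Fin q), cexp (Real.pi * I * ((k * q + (r : ℕ) : ℤ) : ℂ) ^ 2 * β) = φ r)
    (hβ : β.im = 0) {z : ℂ} (hz : 0 < z.re) :
    jacobiTheta₂ 0 (β + I * z) =
      (∑ r : Fin q, φ r * jacobiTheta₂ (((r : ℕ) / q : ℝ)) (I / (q ^ 2 * z))) /
        (q ^ 2 * z) ^ (1 / 2 : ℂ) := by
  have hq : (q : ℂ) ≠ 0 := NeZero.ne _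
  have hz0 : z ≠ 0 := by rintro rfl; simp at hz
  have him : 0 < (β + I * z).im := by simp [hβ, hz]
  have him2 : 0 < (I * (q ^ 2 * z)).im := by
    have hq' : (0 : ℝ) < (q : ℝ) ^ 2 := by have := NeZero.pos q; positivity
    have : ((q : ℂ) ^ 2 * z).re = (q : ℝ) ^ 2 * z.re := by
      rw [← re_ofReal_mul]; push_cast; rfl
    simp only [mul_im, I_re, I_im, zero_mul, one_mul, zero_add, this]
    positivity
  have hs := hasSum_jacobiTheta₂_term 0 him
  rw [← (Int.divModEquiv q).symm.hasSum_iff] at hs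
  have hs2 := (Equiv.prodComm (Fin q) ℤ).hasSum_iff.mpr hs
  have hfib : ∀ r : Fin q, HasSum (fun k : ℤ =>
      ((fun n => jacobiTheta₂_term n 0 (β + I * z)) ∘ (Int.divModEquiv q).symm) (k, r))
      (φ r * (jacobiTheta₂ (((r : ℕ) / q : ℝ)) (I / (q ^ 2 * z)) / (q ^ 2 * z) ^ (1 / 2 : ℂ))) := by
    intro r
    -- The residue class of r modulo q sums to a theta value with parameter I q² z, and the theta
    -- functional equation inverts it to I/(q² z).
    have h := hasSum_jacobiTheta₂_term (I * ((r : ℕ) * q * z)) him2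
    have h3 : jacobiTheta₂ (((r : ℕ) / q : ℝ)) (I / (q ^ 2 * z)) / (q ^ 2 * z) ^ (1 / 2 : ℂ)
        = cexp (-Real.pi * (r : ℕ) ^ 2 * z) *
          jacobiTheta₂ (I * ((r : ℕ) * q * z)) (I * (q ^ 2 * z)) := by
      rw [jacobiTheta₂_functional_equation (I * ((r : ℕ) * q * z))]
      have e1 : -I * (I * (q ^ 2 * z)) = q ^ 2 * z := by linear_combination (-(q ^ 2 * z)) * I_mul_I
      have e2 : I * ((r : ℕ) * q * z) / (I * (q ^ 2 * z)) = ((r : ℕ) / q : ℝ) := by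
        push_cast; field_simp
      have e3 : -1 / (I * (q ^ 2 * z)) = I / (q ^ 2 * z) := by
        field_simp; simp
      have e4 : -Real.pi * I * (I * ((r : ℕ) * q * z)) ^ 2 / (I * (q ^ 2 * z))
          = Real.pi * (r : ℕ) ^ 2 * z := by
        field_simp; simp
      rw [e1, e2, e3, e4]
      have : cexp (-Real.pi * (r : ℕ) ^ 2 * z) * cexp (Real.pi * (r : ℕ) ^ 2 * z) = 1 := by
        rw [← Complex.exp_add, ← Complex.exp_zero]; congr 1; ring
      linear_combination (-(1 / (q ^ 2 * z) ^ (1 / 2 : ℂ)) *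
        jacobiTheta₂ (((r : ℕ) / q : ℝ)) (I / (q ^ 2 * z))) * this
    rw [h3]
    refine ((h.mul_left _).mul_left _).congr_fun ?_
    intro k
    simp only [Function.comp, Int.divModEquiv_symm_apply]
    rw [← hφ k r, jacobiTheta₂_term, jacobiTheta₂_term, ← Complex.exp_add, ← Complex.exp_add]
    congr 1
    push_cast
    linear_combination (Real.pi * (r : ℕ) ^ 2 * z) * I_mul_I
  have hs3 := hs2.prod_fiberwise (fun r => hfib r)
  have h4 := (hasSum_fintype _).unique hs3
  rw [← h4, Finset.sum_div]
  exact Finset.sum_congr rfl fun r _ => by ring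

/-- After inversion, every residue class contributes a theta value tending to 1. Thus the normalised
theta function near a rational point remembers only the finite exponential sum there. Comparing two
such points related by τ ↦ -1/τ gives Gauss' formula. -/
theorem tendsto_jacobiTheta₂_rational (q : ℕ) [NeZero q] (β : ℂ) (φ : Fin q → ℂ)
    (hφ : ∀ (k : ℤ) (r : Fin q), cexp (Real.pi * I * ((k * q + (r : ℕ) : ℤ) : ℂ) ^ 2 * β) = φ r)
    (hβ : β.im = 0) {α : Type*} {l : Filter α} [l.IsCountablyGenerated] {z : α → ℂ}
    (hz : ∀ᶠ t in l, 0 < (z t).re)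
    (hz' : Tendsto (fun t => (I / (q ^ 2 * z t)).im) l atTop) :
    Tendsto (fun t => (q ^ 2 * z t) ^ (1 / 2 : ℂ) * jacobiTheta₂ 0 (β + I * z t)) l
      (𝓝 (∑ r, φ r)) := by
  have h : Tendsto (fun t => ∑ r : Fin q, φ r * jacobiTheta₂ (((r : ℕ) / q : ℝ))
      (I / (q ^ 2 * z t))) l (𝓝 (∑ r, φ r * 1)) :=
    tendsto_finsetSum _ fun r _ => (tendsto_jacobiTheta₂_one _ hz').const_mul _
  simp only [mul_one] at h
  refine h.congr' ?_
  filter_upwards [hz] with t ht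
  rw [jacobiTheta₂_zero_eq_sum q β φ hφ hβ ht, mul_div_cancel₀]
  have hz0 : z t ≠ 0 := by intro h; simp [h] at ht
  have hq : (q : ℂ) ≠ 0 := NeZero.ne _
  rw [Ne, cpow_eq_zero_iff]
  simp [hz0, hq]

/-- Gauss' evaluation of the quadratic Gauss sum of odd modulus. -/
theorem sum_exp_sq_eq (p : ℕ) (hp : Odd p) :
    ∑ r : Fin p, cexp (2 * Real.pi * I * (r : ℕ) ^ 2 / p) =
      (Real.sqrt p : ℂ) * (1 + cexp (-(Real.pi * I * p / 2))) / (1 - I) := by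
  have hp0 : 0 < p := hp.pos
  have : NeZero p := ⟨hp0.ne'⟩
  have hpC : (p : ℂ) ≠ 0 := NeZero.ne _
  have hpR : (0 : ℝ) < p := by exact_mod_cast hp0
  let l : Filter ℝ := 𝓝[>] 0
  -- Chosen so that 2/p + I z(y) = -1/τ for τ = -p/2 + I y. The sum modulo p at 2/p is thereby
  -- compared with the two-term sum modulo 2 at -p/2.
  let z : ℝ → ℂ := fun y => 1 / (p ^ 2 / (4 * y) - I * p / 2)
  have hden : ∀ y : ℝ, 0 < y → (p ^ 2 / (4 * y) - I * p / 2 : ℂ).re = (p : ℝ) ^ 2 / (4 * y) ∧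
      (p ^ 2 / (4 * y) - I * p / 2 : ℂ).im = -p / 2 := by
    intro y hy
    have : (p ^ 2 / (4 * y) - I * p / 2 : ℂ)
      = (((p : ℝ) ^ 2 / (4 * y) : ℝ) : ℂ) + ((-p / 2 : ℝ) : ℂ) * I := by push_cast; ring
    rw [this]; constructor
    · rw [add_re, ofReal_re, mul_I_re, ofReal_im]; ring
    · rw [add_im, ofReal_im, mul_I_im, ofReal_re]; ring
  have hden0 : ∀ y : ℝ, 0 < y → (p ^ 2 / (4 * y) - I * p / 2 : ℂ) ≠ 0 := by
    intro y hy h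
    have h2 := (hden y hy).1
    rw [h, zero_re] at h2
    have : 0 < (p : ℝ) ^ 2 / (4 * y) := by positivity
    linarith
  have hpos : ∀ᶠ y in l, (0 : ℝ) < y := self_mem_nhdsWithin
  have hinv : Tendsto (fun y : ℝ => y⁻¹) l atTop := tendsto_inv_nhdsGT_zero
  have T1 := tendsto_jacobiTheta₂_rational p (2 / p)
    (fun r => cexp (2 * Real.pi * I * (r : ℕ) ^ 2 / p)) (l := l) (z := z) (by
      intro k r
      rw [Complex.exp_eq_exp_iff_exists_int]
      refine ⟨k ^ 2 * p + 2 * k * (r : ℕ), ?_⟩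
      push_cast
      field_simp
      ring) (by
      have : (2 / p : ℂ) = ((2 / p : ℝ) : ℂ) := by push_cast; rfl
      rw [this, ofReal_im]) (by
      filter_upwards [hpos] with y hy
      simp only [z, one_div, inv_re]
      rw [(hden y hy).1]
      have := normSq_pos.mpr (hden0 y hy)
      positivity) (by
      have h : ∀ᶠ y in l, (1 / 4) * y⁻¹ = (I / (p ^ 2 * z y)).im := by
        filter_upwards [hpos] with y hy
        have hyC : (y : ℂ) ≠ 0 := by exact_mod_cast hy.ne'
        have : I / (p ^ 2 * z y) = ((1 / (2 * p) : ℝ) : ℂ) + ((1 / 4 * y⁻¹ : ℝ) : ℂ) * I := by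
          simp only [z]
          have := hden0 y hy
          push_cast
          rw [one_div, div_mul_eq_div_div, div_inv_eq_mul]
          field_simp
          ring_nf
          simp only [I_sq]
          ring
        rw [this, add_im, ofReal_im, mul_I_im, ofReal_re, zero_add]
      exact (hinv.const_mul_atTop (by norm_num)).congr' h)
  have T2 := tendsto_jacobiTheta₂_rational 2 (-p / 2)
    (fun r => if r = 0 then 1 else cexp (-(Real.pi * I * p / 2))) (l := l)
    (z := fun y : ℝ => (y : ℂ)) (by
      intro k r
      rcases (show r = 0 ∨ r = 1 by omega) with rfl | rfl
      · rw [if_pos rfl, Complex.exp_eq_one_iff]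
        refine ⟨-(k ^ 2 * p), ?_⟩
        push_cast
        simp
        ring
      · rw [if_neg (by simp), Complex.exp_eq_exp_iff_exists_int]
        refine ⟨-((k ^ 2 + k) * p), ?_⟩
        push_cast
        simp
        ring) (by
      have : (-p / 2 : ℂ) = ((-p / 2 : ℝ) : ℂ) := by push_cast; rfl
      rw [this, ofReal_im]) (by simpa using hpos) (by
      have h : ∀ᶠ y : ℝ in l, (1 / 4) * y⁻¹ = (I / (((2 : ℕ) : ℂ) ^ 2 * (y : ℂ))).im := by
        filter_upwards [hpos] with y hy
        have hyC : (y : ℂ) ≠ 0 := by exact_mod_cast hy.ne'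
        have : I / (((2 : ℕ) : ℂ) ^ 2 * (y : ℂ)) = ((1 / 4 * y⁻¹ : ℝ) : ℂ) * I := by
          push_cast; field_simp; norm_num
        rw [this, mul_I_im, ofReal_re]
      exact (hinv.const_mul_atTop (by norm_num)).congr' h)
  rw [Fin.sum_univ_two] at T2
  simp only [if_true, Fin.isValue, one_ne_zero, if_false] at T2
  -- the two paths correspond under `τ ↦ -1/τ`
  let X : ℝ → ℂ := fun y => p / (p - 2 * I * y)
  have hX0 : ∀ y : ℝ, (p - 2 * I * y : ℂ) ≠ 0 := by
    intro y h
    have := congrArg re h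
    simp at this
    exact hp0.ne' this
  have key : ∀ᶠ y in l, X y ^ (1 / 2 : ℂ) / (-2 * I / (p - 2 * I * y)) ^ (1 / 2 : ℂ) *
      ((((2 : ℕ) : ℂ) ^ 2 * (y : ℂ)) ^ (1 / 2 : ℂ) * jacobiTheta₂ 0 (-p / 2 + I * y)) =
      (p ^ 2 * z y) ^ (1 / 2 : ℂ) * jacobiTheta₂ 0 (2 / p + I * z y) := by
    filter_upwards [hpos] with y hy
    have hyC : (y : ℂ) ≠ 0 := by exact_mod_cast hy.ne'
    have e0 : z y = 4 * y / (p * (p - 2 * I * y)) := by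
      simp only [z]
      have := hden0 y hy
      have := hX0 y
      rw [div_eq_div_iff (hden0 y hy) (mul_ne_zero hpC this)]
      field_simp
      ring
    have e1 : (p ^ 2 * z y : ℂ) = ((4 * y : ℝ) : ℂ) * X y := by
      simp only [X]
      rw [e0]
      push_cast
      have := hX0 y
      field_simp
    have hXy : X y ≠ 0 := div_ne_zero hpC (hX0 y)
    have e2 : (2 / p + I * z y : ℂ) = 2 / (p - 2 * I * y) := by
      rw [e0]
      have := hX0 y
      field_simp
      ring
    have e3 : (((2 : ℕ) : ℂ) ^ 2 * (y : ℂ)) = ((4 * y : ℝ) : ℂ) := by push_cast; ring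
    have h4y : (0 : ℝ) < 4 * y := by positivity
    have e4 : (((4 * y : ℝ) : ℂ) * X y) ^ (1 / 2 : ℂ)
        = ((4 * y : ℝ) : ℂ) ^ (1 / 2 : ℂ) * X y ^ (1 / 2 : ℂ) := by
      have h4C : ((4 * y : ℝ) : ℂ) ≠ 0 := by exact_mod_cast h4y.ne'
      rw [cpow_def_of_ne_zero (mul_ne_zero h4C hXy), log_ofReal_mul h4y hXy,
        cpow_def_of_ne_zero h4C, cpow_def_of_ne_zero hXy, ← Complex.exp_add, ofReal_log h4y.le,
        add_mul]
    rw [e1, e2, e3, e4, jacobiTheta₂_functional_equation 0 (2 / (p - 2 * I * y))]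
    have e5 : -I * (2 / (p - 2 * I * y)) = -2 * I / (p - 2 * I * y) := by ring
    have e6 : -1 / (2 / (p - 2 * I * y)) = (-p / 2 + I * y : ℂ) := by
      have := hX0 y
      field_simp
      ring
    rw [e5, e6]
    simp
    ring
  have hXlim : Tendsto X l (𝓝 1) := by
    have : ContinuousAt X 0 := by
      refine ContinuousAt.div continuousAt_const (by fun_prop) (hX0 0)
    have h : Tendsto X (𝓝 0) (𝓝 (X 0)) := this
    have h0 : X 0 = 1 := by simp [X, hpC]
    rw [h0] at h
    exact h.mono_left nhdsWithin_le_nhds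
  have hYlim : Tendsto (fun y : ℝ => (-2 * I / (p - 2 * I * y) : ℂ)) l (𝓝 (-2 * I / p)) := by
    have : ContinuousAt (fun y : ℝ => (-2 * I / (p - 2 * I * y) : ℂ)) 0 := by
      refine ContinuousAt.div continuousAt_const (by fun_prop) (hX0 0)
    have h : Tendsto (fun y : ℝ => (-2 * I / (p - 2 * I * y) : ℂ)) (𝓝 0) _ := this
    simp only [ofReal_zero, mul_zero, sub_zero] at h
    exact h.mono_left nhdsWithin_le_nhds
  have hsl : (-2 * I / p : ℂ) ∈ slitPlane := by
    right
    have : (-2 * I / p : ℂ) = ((-2 / p : ℝ) : ℂ) * I := by push_cast; ring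
    rw [this, mul_I_im, ofReal_re]
    have : (0 : ℝ) < 2 / p := by positivity
    rw [neg_div]; linarith
  -- The principal branch selects the root with positive real part; this is what decides the sign of
  -- the Gauss sum.
  have hroot : (-2 * I / p : ℂ) ^ (1 / 2 : ℂ) = (1 - I) / (Real.sqrt p : ℂ) := by
    have hs : (Real.sqrt p : ℂ) ^ 2 = p := by
      rw [← ofReal_pow, Real.sq_sqrt hpR.le]; simp
    have hs0 : (Real.sqrt p : ℂ) ≠ 0 := by
      intro h; rw [h] at hs; simp at hs; exact hpC hs.symm
    have e : (-2 * I / p : ℂ) = ((1 - I) / (Real.sqrt p : ℂ)) ^ 2 := by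
      rw [div_pow, hs]; congr 1; linear_combination (-1 : ℂ) * I_sq
    rw [e, one_div, sq_cpow_two_inv]
    have : ((1 - I) / (Real.sqrt p : ℂ)).re = 1 / Real.sqrt p := by
      rw [div_ofReal_re]; simp
    rw [this]; positivity
  have T3 := (((hXlim.cpow (tendsto_const_nhds (x := (1 / 2 : ℂ))) (by simp)).div
    (hYlim.cpow (tendsto_const_nhds (x := (1 / 2 : ℂ))) hsl) (by
      rw [hroot]
      refine div_ne_zero ?_ ?_
      · intro h; simpa using congrArg re h
      · exact_mod_cast (Real.sqrt_pos.mpr hpR).ne')).mul T2).congr' key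
  rw [tendsto_nhds_unique T1 T3, hroot, one_cpow, one_div_div]
  ring

end DoubleDirichlet

/-! ### Root numbers of Jacobi symbol characters. -/

namespace DoubleDirichlet

open Complex Filter Topology ZMod DirichletCharacter
open scoped NumberTheorySymbols

/-! ### Products of Dirichlet characters of different levels -/

/-- Stated for a common multiple N with the same coprimality condition so as to serve both the least
common multiple (`mul`) and the product of the levels (`prodChar`). -/
theorem changeLevel_mul_changeLevel_apply {m n N : ℕ} (hm : m ∣ N) (hn : n ∣ N)
    (χ : DirichletCharacter ℂ m) (ψ : DirichletCharacter ℂ n) (a : ℤ)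
    (h : IsCoprime a m → IsCoprime a n → IsCoprime a N) :
    (changeLevel hm χ * changeLevel hn ψ) (a : ZMod N) = χ a * ψ a := by
  rw [MulChar.mul_apply]
  by_cases ha : IsCoprime a N
  · rw [changeLevel_eq_cast_of_dvd' _ hm ha, changeLevel_eq_cast_of_dvd' _ hn ha]
  · rw [(apply_eq_zero_iff _ a).mpr ha, zero_mul]
    rcases not_and_or.mp (fun h2 : IsCoprime a m ∧ IsCoprime a n => ha (h h2.1 h2.2)) with h2 | h2
    · rw [(apply_eq_zero_iff χ a).mpr h2, zero_mul]
    · rw [(apply_eq_zero_iff ψ a).mpr h2, mul_zero]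

theorem mul_apply_intCast {m n : ℕ} (χ : DirichletCharacter ℂ m) (ψ : DirichletCharacter ℂ n)
    (a : ℤ) : (χ.mul ψ) (a : ZMod (m.lcm n)) = χ a * ψ a := by
  refine changeLevel_mul_changeLevel_apply _ _ χ ψ a fun h1 h2 => ?_
  refine IsCoprime.of_isCoprime_of_dvd_right (h1.mul_right h2) ?_
  exact_mod_cast Nat.lcm_dvd_mul m n

theorem mul_apply_natCast {m n : ℕ} (χ : DirichletCharacter ℂ m) (ψ : DirichletCharacter ℂ n)
    (a : ℕ) : (χ.mul ψ) (a : ZMod (m.lcm n)) = χ a * ψ a := by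
  exact_mod_cast mul_apply_intCast χ ψ a

/-- The product of two Dirichlet characters, at the product of the levels. -/
noncomputable def prodChar {m n : ℕ} (χ : DirichletCharacter ℂ m) (ψ : DirichletCharacter ℂ n) :
    DirichletCharacter ℂ (m * n) :=
  changeLevel (dvd_mul_right m n) χ * changeLevel (dvd_mul_left n m) ψ

theorem prodChar_intCast {m n : ℕ} (χ : DirichletCharacter ℂ m) (ψ : DirichletCharacter ℂ n)
    (a : ℤ) : prodChar χ ψ (a : ZMod (m * n)) = χ a * ψ a := by
  refine changeLevel_mul_changeLevel_apply _ _ χ ψ a fun h1 h2 => ?_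
  push_cast
  exact h1.mul_right h2

theorem prodChar_natCast {m n : ℕ} (χ : DirichletCharacter ℂ m) (ψ : DirichletCharacter ℂ n)
    (a : ℕ) : prodChar χ ψ (a : ZMod (m * n)) = χ a * ψ a := by
  exact_mod_cast prodChar_intCast χ ψ a

theorem dirichletCharacter_ext {n : ℕ} {χ ψ : DirichletCharacter ℂ n}
    (h : ∀ a : ℤ, χ (a : ZMod n) = ψ (a : ZMod n)) : χ = ψ := by
  refine MulChar.ext' fun x => ?_
  obtain ⟨a, rfl⟩ := ZMod.intCast_surjective x
  exact h a

theorem chiTilde_intCast {n : ℕ} (hn : n ≠ 0) (a : ℤ) :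
    chiTilde n (a : ZMod n) = (J(a | n) : ℤ) := by
  have : NeZero n := ⟨hn⟩
  have h1 : J(((a : ZMod n).val : ℤ) | n) = J(a | n) := by
    rw [ZMod.val_intCast, ← jacobiSym.mod_left]
  by_cases hu : IsUnit (a : ZMod n)
  · rw [← h1]
    exact if_pos hu
  · rw [MulChar.map_nonunit _ hu, (jacobiSym.eq_zero_iff_not_coprime).mpr, Int.cast_zero]
    rw [Ne, ← Int.isCoprime_iff_gcd_eq_one]
    rwa [ZMod.coe_int_isUnit_iff_isCoprime, isCoprime_comm] at hu

theorem chiTilde_natCast {n : ℕ} (hn : n ≠ 0) (a : ℕ) :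
    chiTilde n (a : ZMod n) = (J(a | n) : ℤ) := by
  exact_mod_cast chiTilde_intCast hn a

theorem chiTilde_mul {m n : ℕ} (hm : m ≠ 0) (hn : n ≠ 0) :
    chiTilde (m * n) = prodChar (chiTilde m) (chiTilde n) := by
  refine dirichletCharacter_ext fun a => ?_
  rw [prodChar_intCast, chiTilde_intCast hm, chiTilde_intCast hn,
    chiTilde_intCast (mul_ne_zero hm hn), jacobiSym.mul_right' a hm hn, Int.cast_mul]

/-! ### Self-dual characters -/

/-- A character whose discrete Fourier transform is the expected multiple of itself, that is,
a real character of root number `1`. -/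
def SelfDual {N : ℕ} [NeZero N] (χ : DirichletCharacter ℂ N) : Prop :=
  ∀ k, 𝓕 χ k = (if χ (-1) = 1 then 1 else -I) * (Real.sqrt N : ℂ) * χ k

theorem stdAddChar_natCast_mul {m n : ℕ} [NeZero m] [NeZero n] (a : ℤ) :
    stdAddChar ((n * a : ℤ) : ZMod (m * n)) = stdAddChar (a : ZMod m) := by
  rw [stdAddChar_coe, stdAddChar_coe]
  congr 1
  have : (n : ℂ) ≠ 0 := NeZero.ne _
  have : (m : ℂ) ≠ 0 := NeZero.ne _
  push_cast
  field_simp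

/-- The parametrisation na + mb is the one that splits the additive character: e((na+mb)/mn) =
e(a/m) e(b/n). -/
theorem crt_bijective {m n : ℕ} [NeZero m] [NeZero n] (h : m.Coprime n) :
    Function.Bijective (fun x : ZMod m × ZMod n =>
      ((n * x.1.val + m * x.2.val : ℕ) : ZMod (m * n))) := by
  rw [Fintype.bijective_iff_injective_and_card]
  refine ⟨?_, by simp [ZMod.card]⟩
  rintro ⟨a, b⟩ ⟨a', b'⟩ hab
  simp only [ZMod.natCast_eq_natCast_iff] at hab
  have h1 := hab.of_mul_right n
  have h2 := hab.of_mul_left m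
  have h3 : n * a.val ≡ n * a'.val [MOD m] := by
    have := h1
    unfold Nat.ModEq at this ⊢
    simpa [Nat.add_mod] using this
  have h4 : m * b.val ≡ m * b'.val [MOD n] := by
    have := h2
    unfold Nat.ModEq at this ⊢
    simpa [Nat.add_mod] using this
  have h5 := Nat.ModEq.cancel_left_of_coprime h h3
  have h6 := Nat.ModEq.cancel_left_of_coprime h.symm h4
  rw [← ZMod.natCast_eq_natCast_iff] at h5 h6
  simp only [ZMod.natCast_val, ZMod.cast_id] at h5 h6
  rw [h5, h6]

/-- The factor χ(n)ψ(m) arises because χ(na+mb) = χ(n)χ(a) and ψ(na+mb) = ψ(m)ψ(b). -/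
theorem dft_prodChar {m n : ℕ} [NeZero m] [NeZero n] (h : m.Coprime n)
    (χ : DirichletCharacter ℂ m) (ψ : DirichletCharacter ℂ n) (k : ℤ) :
    𝓕 (prodChar χ ψ) (k : ZMod (m * n)) = χ n * ψ m * (𝓕 χ (k : ZMod m) * 𝓕 ψ (k : ZMod n)) := by
  simp only [dft_apply, smul_eq_mul]
  rw [← (Equiv.ofBijective _ (crt_bijective h)).sum_comp, Finset.sum_mul_sum, Finset.mul_sum,
    Fintype.sum_prod_type]
  refine Finset.sum_congr rfl fun a _ => ?_
  rw [Finset.mul_sum]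
  refine Finset.sum_congr rfl fun b _ => ?_
  simp only [Equiv.ofBijective_apply]
  rw [prodChar_natCast]
  have e1 : χ ((n * a.val + m * b.val : ℕ) : ZMod m) = χ n * χ a := by
    rw [← map_mul]; congr 1; simp
  have e2 : ψ ((n * a.val + m * b.val : ℕ) : ZMod n) = ψ m * ψ b := by
    rw [← map_mul]; congr 1; simp
  have e3 : (-(((n * a.val + m * b.val : ℕ) : ZMod (m * n)) * (k : ZMod (m * n))))
      = ((n * (-(a.val * k)) : ℤ) : ZMod (m * n)) + ((m * (-(b.val * k)) : ℤ) : ZMod (m * n)) := by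
    push_cast; ring
  have e4 : stdAddChar ((m * (-(b.val * k)) : ℤ) : ZMod (m * n))
      = stdAddChar ((-(b.val * k) : ℤ) : ZMod n) := by
    rw [stdAddChar_coe, stdAddChar_coe]
    congr 1
    have : (n : ℂ) ≠ 0 := NeZero.ne _
    have : (m : ℂ) ≠ 0 := NeZero.ne _
    push_cast
    field_simp
  rw [e1, e2, e3, AddChar.map_add_eq_mul, stdAddChar_natCast_mul, e4]
  push_cast
  simp only [ZMod.natCast_val, ZMod.cast_id]
  ring

theorem apply_neg_one_eq {N : ℕ} (χ : DirichletCharacter ℂ N) : χ (-1) = 1 ∨ χ (-1) = -1 :=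
  χ.even_or_odd

/-- Two odd characters contribute (-i)² = -1, while their product is even. The hypothesis on
χ(n)ψ(m), which is quadratic reciprocity in the applications, supplies exactly the compensating
sign. -/
theorem SelfDual.prodChar {m n : ℕ} [NeZero m] [NeZero n] (h : m.Coprime n)
    {χ : DirichletCharacter ℂ m} {ψ : DirichletCharacter ℂ n} (hχ : SelfDual χ) (hψ : SelfDual ψ)
    (hχψ : χ n * ψ m = if χ (-1) = -1 ∧ ψ (-1) = -1 then -1 else 1) :
    SelfDual (prodChar χ ψ) := by
  intro k
  obtain ⟨k, rfl⟩ := ZMod.intCast_surjective k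
  rw [dft_prodChar h, hχ, hψ, hχψ, prodChar_intCast]
  have e1 : DoubleDirichlet.prodChar χ ψ (-1) = χ (-1) * ψ (-1) := by
    have := prodChar_intCast χ ψ (-1)
    push_cast at this
    exact this
  have e2 : (Real.sqrt ((m * n : ℕ) : ℝ) : ℂ) = Real.sqrt m * Real.sqrt n := by
    push_cast
    rw [Real.sqrt_mul (by positivity)]
    push_cast; rfl
  have h3 : (-1 : ℂ) ≠ 1 := by norm_num
  rw [e1, e2]
  rcases apply_neg_one_eq χ with h1 | h1 <;> rcases apply_neg_one_eq ψ with h2 | h2 <;>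
    simp only [h1, h2, h3, h3.symm, and_self, and_false, false_and, if_true, if_false, mul_one,
      one_mul, mul_neg, neg_mul, neg_neg]
  · ring
  · ring
  · ring
  · linear_combination (-(Real.sqrt m : ℂ) * Real.sqrt n * χ k * ψ k) * I_mul_I

/-- The Gauss sum equals the sum of e(x²/p), because 1 + (a/p) counts the square roots of a;
`sum_exp_sq_eq` then evaluates it. Frequency 0 is orthogonality, and the other frequencies are unit
shifts of the Gauss sum. -/
theorem selfDual_chiTilde_prime (p : ℕ) [Fact p.Prime] (hp : p ≠ 2) :
    SelfDual (chiTilde p) := by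
  have hpp : p.Prime := Fact.out
  have hodd : Odd p := hpp.odd_of_ne_two hp
  have hval : ∀ x : ZMod p, chiTilde p x = (quadraticChar (ZMod p) x : ℤ) := by
    intro x
    obtain ⟨a, rfl⟩ := ZMod.intCast_surjective x
    rw [chiTilde_intCast hpp.ne_zero, ← jacobiSym.legendreSym.to_jacobiSym]
    rfl
  have hne : chiTilde p ≠ 1 := by
    intro h
    have h2 : ringChar (ZMod p) ≠ 2 := by rwa [ZMod.ringChar_zmod_n]
    obtain ⟨a, ha⟩ := quadraticChar_exists_neg_one' h2
    have h3 := hval a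
    rw [h, MulChar.one_apply_coe, ha] at h3
    norm_num at h3
  have hg : ∑ x : ZMod p, stdAddChar x * chiTilde p x =
      (Real.sqrt p : ℂ) * (if p % 4 = 1 then 1 else I) := by
    have h1 : ∑ x : ZMod p, stdAddChar (x ^ 2) =
        ∑ a : ZMod p, stdAddChar a * (1 + chiTilde p a) := by
      rw [← Finset.sum_fiberwise (g := fun x : ZMod p => x ^ 2)]
      refine Finset.sum_congr rfl fun a _ => ?_
      rw [Finset.sum_congr rfl (g := fun _ => (stdAddChar a : ℂ)) (by
        intro x hx; rw [(Finset.mem_filter.mp hx).2])]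
      rw [Finset.sum_const, nsmul_eq_mul, mul_comm, hval]
      congr 1
      have := quadraticChar_card_sqrts (F := ZMod p) (by rwa [ZMod.ringChar_zmod_n]) a
      have h2 : (Finset.univ.filter fun x : ZMod p => x ^ 2 = a)
        = {x : ZMod p | x ^ 2 = a}.toFinset := by ext; simp
      rw [h2]
      have h3 := congrArg (Int.cast : ℤ → ℂ) this
      push_cast at h3
      rw [h3, add_comm]
    have h2 : ∑ a : ZMod p, (stdAddChar a : ℂ) = 0 :=
      
      AddChar.sum_eq_zero_of_ne_one (by
        have := ZMod.isPrimitive_stdAddChar p (one_ne_zero)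
        rwa [AddChar.mulShift_one] at this)
    simp only [mul_add, mul_one, Finset.sum_add_distrib, h2, zero_add] at h1
    rw [← h1]
    have h3 : ∑ x : ZMod p, (stdAddChar (x ^ 2) : ℂ) =
        ∑ r : Fin p, cexp (2 * Real.pi * I * (r : ℕ) ^ 2 / p) := by
      rw [← (ZMod.finEquiv p).toEquiv.sum_comp]
      refine Finset.sum_congr rfl fun r _ => ?_
      have h4 : (ZMod.finEquiv p) r = ((r : ℕ) : ZMod p) := by
        obtain ⟨n, rfl⟩ : ∃ n, p = n + 1 := ⟨p - 1, by have := hpp.pos; omega⟩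
        exact (Fin.cast_val_eq_self r).symm
      have h5 := stdAddChar_coe (N := p) ((r : ℕ) ^ 2)
      push_cast at h5
      rw [← h5, ← h4]
      rfl
    rw [h3, sum_exp_sq_eq p hodd, mul_div_assoc]
    congr 1
    have hI : (1 - I : ℂ) ≠ 0 := by intro h; simpa using congrArg re h
    have hI2 : cexp (Real.pi / 2 * I) = I := by rw [Complex.exp_pi_div_two_mul_I]
    rw [div_eq_iff hI]
    have h5 : p % 4 = 1 ∨ p % 4 = 3 := by
      rcases hodd with ⟨k, hk⟩; omega
    rcases h5 with h5 | h5
    · have : cexp (-(Real.pi * I * p / 2)) = cexp (-(Real.pi / 2 * I)) := by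
        rw [Complex.exp_eq_exp_iff_exists_int]
        obtain ⟨q, hq⟩ : ∃ q, p = 4 * q + 1 := ⟨p / 4, by omega⟩
        refine ⟨-(q : ℤ), ?_⟩
        rw [hq]
        push_cast
        ring
      rw [this, Complex.exp_neg, hI2, if_pos h5, inv_I]
      ring
    · have : cexp (-(Real.pi * I * p / 2)) = cexp (Real.pi / 2 * I) := by
        rw [Complex.exp_eq_exp_iff_exists_int]
        obtain ⟨q, hq⟩ : ∃ q, p = 4 * q + 3 := ⟨p / 4, by omega⟩
        refine ⟨-((q : ℤ) + 1), ?_⟩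
        rw [hq]
        push_cast
        ring
      rw [this, hI2, if_neg (by omega)]
      linear_combination I_mul_I
  have hsign : chiTilde p (-1) = if p % 4 = 1 then 1 else -1 := by
    have h1 := chiTilde_intCast hpp.ne_zero (-1)
    push_cast at h1
    rw [h1, jacobiSym.at_neg_one hodd]
    have h5 : p % 4 = 1 ∨ p % 4 = 3 := by
      rcases hodd with ⟨k, hk⟩; omega
    rcases h5 with h5 | h5
    · rw [ZMod.χ₄_nat_one_mod_four h5, if_pos h5]; simp
    · rw [ZMod.χ₄_nat_three_mod_four h5, if_neg (by omega)]; simp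
  intro k
  by_cases hk : k = 0
  · subst hk
    rw [dft_apply_zero, MulChar.map_zero, mul_zero]
    exact MulChar.sum_eq_zero_of_ne_one hne
  · have hu : IsUnit (-k) := by simpa using hk
    obtain ⟨u, hu⟩ := hu
    rw [fourierTransform_eq_gaussSum_mulShift, ← hu]
    have h1 := gaussSum_mulShift (chiTilde p) (stdAddChar (N := p)) u
    have h2 : gaussSum (chiTilde p) (stdAddChar (N := p)) =
        (Real.sqrt p : ℂ) * (if p % 4 = 1 then 1 else I) := by
      rw [← hg]
      exact Finset.sum_congr rfl fun x _ => mul_comm _ _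
    have h3 : chiTilde p (u : ZMod p) ^ 2 = 1 := by
      rw [hval]
      have : (u : ZMod p) ≠ 0 := u.ne_zero
      exact_mod_cast quadraticChar_sq_one this
    have h4 : chiTilde p k = chiTilde p (-1) * chiTilde p (u : ZMod p) := by
      rw [← map_mul, hu]; congr 1; ring
    have h5 : gaussSum (chiTilde p) ((stdAddChar (N := p)).mulShift (u : ZMod p))
        = chiTilde p (u : ZMod p) * gaussSum (chiTilde p) (stdAddChar (N := p)) := by
      linear_combination (-gaussSum (chiTilde p) ((stdAddChar (N := p)).mulShift (u : ZMod p))) * h3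
        + chiTilde p (u : ZMod p) * h1
    rw [h5, h2, h4, hsign]
    split_ifs with h6 h7 h7
    · ring
    · exact absurd rfl h7
    · norm_num at h7
    · ring

theorem chiTilde_neg_one {m : ℕ} (hm : Odd m) :
    chiTilde m (-1) = if m % 4 = 1 then 1 else -1 := by
  have h1 := chiTilde_intCast hm.pos.ne' (-1)
  push_cast at h1
  rw [h1, jacobiSym.at_neg_one hm]
  have h5 : m % 4 = 1 ∨ m % 4 = 3 := by
    rcases hm with ⟨k, hk⟩; omega
  rcases h5 with h5 | h5
  · rw [ZMod.χ₄_nat_one_mod_four h5, if_pos h5]; simp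
  · rw [ZMod.χ₄_nat_three_mod_four h5, if_neg (by omega)]; simp

theorem selfDual_one : SelfDual (1 : DirichletCharacter ℂ 1) := by
  intro k
  have h1 : ∀ x : ZMod 1, x = 0 := fun x => Subsingleton.elim _ _
  have h2 : (1 : DirichletCharacter ℂ 1) (0 : ZMod 1) = 1 := by
    rw [← h1 1, map_one]
  simp [dft_apply, h1, h2]

theorem jacobiSym_sq_eq_one {a : ℤ} {b : ℕ} (h : IsCoprime a b) : J(a | b) * J(a | b) = 1 := by
  have := jacobiSym.sq_one (Int.isCoprime_iff_gcd_eq_one.mp h)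
  rwa [sq] at this

theorem jacobiSym_mul_comm {m n : ℕ} (hm : Odd m) (hn : Odd n) (h : m.Coprime n) :
    J(n | m) * J(m | n) = if m % 4 = 3 ∧ n % 4 = 3 then -1 else 1 := by
  have h2 := jacobiSym_sq_eq_one (a := n) (b := m) (Nat.isCoprime_iff_coprime.mpr h.symm)
  rw [← jacobiSym.quadratic_reciprocity_if (Nat.odd_iff.mp hm) (Nat.odd_iff.mp hn)]
  split_ifs
  · rw [mul_neg, h2]
  · exact h2

/-- Multiplicative induction: squarefreeness makes the two factors coprime, and reciprocity in the
form `jacobiSym_mul_comm` is the sign condition of `SelfDual.prodChar`. -/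
theorem selfDual_chiTilde (m : ℕ) (hodd : Odd m) (hsq : Squarefree m) [NeZero m] :
    SelfDual (chiTilde m) := by
  revert hodd hsq
  rename_i hm
  revert hm
  induction m using Nat.recOnMul with
  | zero => intro _ h; simp at h
  | one =>
    intro _ _ _
    rw [level_one (chiTilde 1)]
    exact selfDual_one
  | prime p hp =>
    intro _ h _
    have : Fact p.Prime := ⟨hp⟩
    exact selfDual_chiTilde_prime p (by rintro rfl; exact absurd h (by decide))
  | mul a b iha ihb =>
    intro _ h hsq
    have hab := Nat.odd_mul.mp h
    have hcop := Nat.coprime_of_squarefree_mul hsq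
    have : NeZero a := ⟨hab.1.pos.ne'⟩
    have : NeZero b := ⟨hab.2.pos.ne'⟩
    rw [chiTilde_mul (NeZero.ne a) (NeZero.ne b)]
    refine SelfDual.prodChar hcop (iha hab.1 hsq.of_mul_left) (ihb hab.2 hsq.of_mul_right) ?_
    rw [chiTilde_natCast (NeZero.ne a), chiTilde_natCast (NeZero.ne b), ← Int.cast_mul,
      jacobiSym_mul_comm hab.1 hab.2 hcop, chiTilde_neg_one hab.1, chiTilde_neg_one hab.2]
    have h1 : a % 4 = 1 ∨ a % 4 = 3 := by rcases hab.1 with ⟨k, hk⟩; omega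
    have h2 : b % 4 = 1 ∨ b % 4 = 3 := by rcases hab.2 with ⟨k, hk⟩; omega
    have h3 : (1 : ℂ) ≠ -1 := by norm_num
    rcases h1 with h1 | h1 <;> rcases h2 with h2 | h2 <;> simp [h1, h2, h3]

end DoubleDirichlet

namespace DoubleDirichlet

open Complex Filter Topology ZMod DirichletCharacter
open scoped NumberTheorySymbols

/-! ### The real characters modulo `8` -/

theorem stdAddChar_eq_pow {N : ℕ} [NeZero N] (x : ZMod N) :
    stdAddChar x = (stdAddChar (1 : ZMod N) : ℂ) ^ x.val := by
  rw [← AddChar.map_nsmul_eq_pow]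
  congr 1
  simp

theorem stdAddChar_eight_one :
    (stdAddChar (1 : ZMod 8) : ℂ) = (Real.sqrt 2 : ℂ) / 2 * (1 + I) := by
  have h := stdAddChar_coe (N := 8) 1
  push_cast at h
  rw [h]
  have : (2 * Real.pi * I * 1 / 8 : ℂ) = ((Real.pi / 4 : ℝ) : ℂ) * I := by push_cast; ring
  rw [this, exp_mul_I, ← ofReal_cos, ← ofReal_sin, Real.cos_pi_div_four, Real.sin_pi_div_four]
  push_cast
  ring

theorem stdAddChar_four_one : (stdAddChar (1 : ZMod 4) : ℂ) = I := by
  have h := stdAddChar_coe (N := 4) 1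
  push_cast at h
  rw [h]
  have : (2 * Real.pi * I * 1 / 4 : ℂ) = Real.pi / 2 * I := by ring
  rw [this, exp_pi_div_two_mul_I]

/-- The complex Dirichlet character attached to an integer valued one. -/
noncomputable def complexChar {N : ℕ} (κ : MulChar (ZMod N) ℤ) : DirichletCharacter ℂ N :=
  κ.ringHomComp (Int.castRingHom ℂ)

theorem complexChar_apply {N : ℕ} (κ : MulChar (ZMod N) ℤ) (x : ZMod N) :
    complexChar κ x = (κ x : ℂ) := rfl

theorem sqrt_two_sq : (Real.sqrt 2 : ℂ) ^ 2 = 2 := by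
  rw [← ofReal_pow, Real.sq_sqrt (by norm_num)]; norm_num

theorem sqrt_eight : (Real.sqrt ((8 : ℕ) : ℝ) : ℂ) = 2 * Real.sqrt 2 := by
  have : Real.sqrt ((8 : ℕ) : ℝ) = 2 * Real.sqrt 2 := by
    rw [show ((8 : ℕ) : ℝ) = 2 ^ 2 * 2 by norm_num, Real.sqrt_mul (by norm_num),
      Real.sqrt_sq (by norm_num)]
  rw [this]; push_cast; rfl

theorem sum_zmod_four (f : ZMod 4 → ℂ) : ∑ j, f j = f 0 + f 1 + f 2 + f 3 :=
  Fin.sum_univ_four f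

theorem sum_zmod_eight (f : ZMod 8 → ℂ) :
    ∑ j, f j = f 0 + f 1 + f 2 + f 3 + f 4 + f 5 + f 6 + f 7 :=
  Fin.sum_univ_eight f

theorem selfDual_chi_four : SelfDual (complexChar χ₄) := by
  have h1 : χ₄ (-1) = -1 := by decide
  have h4 : (Real.sqrt ((4 : ℕ) : ℝ) : ℂ) = 2 := by
    have : Real.sqrt ((4 : ℕ) : ℝ) = 2 := by
      rw [show ((4 : ℕ) : ℝ) = 2 ^ 2 by norm_num, Real.sqrt_sq (by norm_num)]
    rw [this]; norm_num
  have h3 : I ^ 3 = -I := by rw [pow_succ, I_sq]; ring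
  have hI : (-1 : ℂ) ≠ 1 := by norm_num
  intro k
  simp only [dft_apply, smul_eq_mul, complexChar_apply, h1, h4]
  rw [show ∑ j : ZMod 4, stdAddChar (-(j * k)) * (χ₄ j : ℂ)
    = stdAddChar (-k) - stdAddChar (-(3 * k)) by
      rw [sum_zmod_four]
      rw [show χ₄ 0 = 0 by decide, show χ₄ 1 = 1 by decide,
        show χ₄ 2 = 0 by decide, show χ₄ 3 = -1 by decide]
      push_cast
      simp only [mul_zero, one_mul, mul_one, zero_add, add_zero, mul_neg, ← sub_eq_add_neg]]
  rw [stdAddChar_eq_pow, stdAddChar_eq_pow (-(3 * k)), stdAddChar_four_one]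
  have hk : k = 0 ∨ k = 1 ∨ k = 2 ∨ k = 3 := by revert k; decide
  rcases hk with rfl | rfl | rfl | rfl
  · simp
  · rw [show (-1 : ZMod 4).val = 3 by decide, show (-(3 * 1) : ZMod 4).val = 1 by decide,
      show χ₄ 1 = 1 by decide, h3]
    push_cast
    rw [if_neg hI]
    ring
  · rw [show (-2 : ZMod 4).val = 2 by decide, show (-(3 * 2) : ZMod 4).val = 2 by decide,
      show χ₄ 2 = 0 by decide]
    simp
  · rw [show (-3 : ZMod 4).val = 1 by decide, show (-(3 * 3) : ZMod 4).val = 3 by decide,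
      show χ₄ 3 = -1 by decide, h3]
    push_cast
    rw [if_neg hI]
    ring

/-- The two sign patterns are those of `χ₈` (even) and `χ₈'` (odd). The transform is computed
frequency by frequency with ζ = e(1/8), using ζ + ζ⁻¹ = √2 (`r1`) and ζ - ζ⁻¹ = i√2 (`r2`). -/
theorem selfDual_of_mod_eight (κ : MulChar (ZMod 8) ℤ) (a b : ℤ) (ha : κ 3 = a) (hb : κ 5 = b)
    (hab : (a = -1 ∧ b = -1) ∨ (a = 1 ∧ b = -1)) : SelfDual (complexChar κ) := by
  have hnon : ∀ x : ZMod 8, ¬ IsUnit x → κ x = 0 := fun x hx => κ.map_nonunit hx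
  have k0 : κ 0 = 0 := hnon 0 (by decide)
  have k2 : κ 2 = 0 := hnon 2 (by decide)
  have k4 : κ 4 = 0 := hnon 4 (by decide)
  have k6 : κ 6 = 0 := hnon 6 (by decide)
  have k7 : κ 7 = a * b := by rw [← ha, ← hb, ← map_mul]; rfl
  have k1 : κ 1 = 1 := map_one κ
  have hn1 : κ (-1) = a * b := k7
  have z2 : ((Real.sqrt 2 : ℂ) / 2 * (1 + I)) ^ 2 = I := by
    linear_combination (1 + I) ^ 2 / 4 * sqrt_two_sq + (1 / 2) * I_sq
  set ζ := (Real.sqrt 2 : ℂ) / 2 * (1 + I) with hζ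
  have z3 : ζ ^ 3 = I * ζ := by rw [pow_succ, z2]
  have z4 : ζ ^ 4 = -1 := by rw [show 4 = 2 * 2 by rfl, pow_mul, z2, I_sq]
  have z5 : ζ ^ 5 = -ζ := by rw [pow_succ, z4]; ring
  have z6 : ζ ^ 6 = -I := by rw [show 6 = 4 + 2 by rfl, pow_add, z4, z2]; ring
  have z7 : ζ ^ 7 = -I * ζ := by rw [pow_succ, z6]
  have r1 : ζ - I * ζ = Real.sqrt 2 := by
    rw [hζ]; linear_combination (-(Real.sqrt 2 : ℂ) / 2) * I_sq
  have r2 : ζ + I * ζ = I * Real.sqrt 2 := by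
    rw [hζ]; linear_combination ((Real.sqrt 2 : ℂ) / 2) * I_sq
  have hI : (-1 : ℂ) ≠ 1 := by norm_num
  intro k
  simp only [dft_apply, smul_eq_mul, complexChar_apply, hn1, sqrt_eight]
  rw [show ∑ j : ZMod 8, stdAddChar (-(j * k)) * (κ j : ℂ)
    = stdAddChar (-k) + stdAddChar (-(3 * k)) * a + stdAddChar (-(5 * k)) * b
      + stdAddChar (-(7 * k)) * (a * b) by
      rw [sum_zmod_eight]
      rw [k0, k1, k2, ha, k4, hb, k6, k7]
      push_cast
      simp only [mul_zero, one_mul, mul_one, zero_add, add_zero]]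
  rw [stdAddChar_eq_pow, stdAddChar_eq_pow (-(3 * k)), stdAddChar_eq_pow (-(5 * k)),
    stdAddChar_eq_pow (-(7 * k)), stdAddChar_eight_one, ← hζ]
  have hk : k = 0 ∨ k = 1 ∨ k = 2 ∨ k = 3 ∨ k = 4 ∨ k = 5 ∨ k = 6 ∨ k = 7 := by revert k; decide
  rcases hk with rfl | rfl | rfl | rfl | rfl | rfl | rfl | rfl
  · rw [k0]
    simp only [mul_zero, neg_zero, ZMod.val_zero, pow_zero]
    rcases hab with ⟨rfl, rfl⟩ | ⟨rfl, rfl⟩ <;> push_cast <;> ring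
  · rw [show (-1 : ZMod 8).val = 7 by decide, show (-(3 * 1) : ZMod 8).val = 5 by decide,
      show (-(5 * 1) : ZMod 8).val = 3 by decide, show (-(7 * 1) : ZMod 8).val = 1 by decide,
      k1, z3, z5, z7, pow_one]
    rcases hab with ⟨rfl, rfl⟩ | ⟨rfl, rfl⟩
    · norm_num; linear_combination 2 * r1
    · norm_num [hI]; linear_combination -2 * r2
  · rw [show (-2 : ZMod 8).val = 6 by decide, show (-(3 * 2) : ZMod 8).val = 2 by decide,
      show (-(5 * 2) : ZMod 8).val = 6 by decide, show (-(7 * 2) : ZMod 8).val = 2 by decide, k2]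
    rcases hab with ⟨rfl, rfl⟩ | ⟨rfl, rfl⟩ <;> push_cast <;> ring
  · rw [show (-3 : ZMod 8).val = 5 by decide, show (-(3 * 3) : ZMod 8).val = 7 by decide,
      show (-(5 * 3) : ZMod 8).val = 1 by decide, show (-(7 * 3) : ZMod 8).val = 3 by decide,
      ha, z3, z5, z7, pow_one]
    rcases hab with ⟨rfl, rfl⟩ | ⟨rfl, rfl⟩
    · norm_num; linear_combination -2 * r1
    · norm_num [hI]; linear_combination -2 * r2
  · rw [show (-4 : ZMod 8).val = 4 by decide, show (-(3 * 4) : ZMod 8).val = 4 by decide,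
      show (-(5 * 4) : ZMod 8).val = 4 by decide, show (-(7 * 4) : ZMod 8).val = 4 by decide, k4]
    rcases hab with ⟨rfl, rfl⟩ | ⟨rfl, rfl⟩ <;> push_cast <;> ring
  · rw [show (-5 : ZMod 8).val = 3 by decide, show (-(3 * 5) : ZMod 8).val = 1 by decide,
      show (-(5 * 5) : ZMod 8).val = 7 by decide, show (-(7 * 5) : ZMod 8).val = 5 by decide,
      hb, z3, z5, z7, pow_one]
    rcases hab with ⟨rfl, rfl⟩ | ⟨rfl, rfl⟩
    · norm_num; linear_combination -2 * r1
    · norm_num [hI]; linear_combination 2 * r2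
  · rw [show (-6 : ZMod 8).val = 2 by decide, show (-(3 * 6) : ZMod 8).val = 6 by decide,
      show (-(5 * 6) : ZMod 8).val = 2 by decide, show (-(7 * 6) : ZMod 8).val = 6 by decide, k6]
    rcases hab with ⟨rfl, rfl⟩ | ⟨rfl, rfl⟩ <;> push_cast <;> ring
  · rw [show (-7 : ZMod 8).val = 1 by decide, show (-(3 * 7) : ZMod 8).val = 3 by decide,
      show (-(5 * 7) : ZMod 8).val = 5 by decide, show (-(7 * 7) : ZMod 8).val = 7 by decide,
      k7, z3, z5, z7, pow_one]
    rcases hab with ⟨rfl, rfl⟩ | ⟨rfl, rfl⟩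
    · norm_num; linear_combination 2 * r1
    · norm_num [hI]; linear_combination 2 * r2

theorem odd_intCast_zmod_eight {a : ℤ} (ha : _root_.Odd a) :
    ∃ r : ℤ, (r = 1 ∨ r = 3 ∨ r = 5 ∨ r = 7) ∧ (a : ZMod 8) = r ∧ (a : ZMod 4) = r := by
  refine ⟨a % 8, ?_, ?_, ?_⟩
  · rcases ha with ⟨k, rfl⟩; omega
  · rw [ZMod.intCast_eq_intCast_iff]
    exact (Int.mod_modEq a 8).symm
  · rw [ZMod.intCast_eq_intCast_iff]
    exact ((Int.mod_modEq a 8).of_mul_left 2).symm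

/-- Every character modulo `8` is induced by a self-dual one of level `c ∣ 8`. -/
theorem exists_selfDual_mod_eight (ψ : DirichletCharacter ℂ 8) :
    ∃ (c : ℕ) (_ : NeZero c) (ψs : DirichletCharacter ℂ c), c ∣ 8 ∧ (c = 1 ∨ 2 ∣ c) ∧
      SelfDual ψs ∧ (∀ a : ℤ, _root_.Odd a → ψs a = ψ a) ∧
      ∀ m : ℕ, _root_.Odd m →
        ((J(c | m) : ℤ) : ℂ) * ψs m = if m % 4 = 3 ∧ ψs (-1) = -1 then -1 else 1 := by
  have h3 : ψ 3 = 1 ∨ ψ 3 = -1 := by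
    rw [← sq_eq_one_iff, ← map_pow]; exact map_one ψ
  have h5 : ψ 5 = 1 ∨ ψ 5 = -1 := by
    rw [← sq_eq_one_iff, ← map_pow]; exact map_one ψ
  have h7 : ψ 7 = ψ 3 * ψ 5 := by rw [← map_mul]; rfl
  have h1 : ψ 1 = 1 := map_one ψ
  have hm4 : ∀ m : ℕ, _root_.Odd m → ((χ₄ m : ℤ) : ℂ) = if m % 4 = 3 then -1 else 1 := by
    intro m hm
    have h5 : m % 4 = 1 ∨ m % 4 = 3 := by rcases hm with ⟨k, hk⟩; omega
    rcases h5 with h5 | h5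
    · rw [ZMod.χ₄_nat_one_mod_four h5, if_neg (by omega)]; simp
    · rw [ZMod.χ₄_nat_three_mod_four h5, if_pos h5]; simp
  have hI : (1 : ℂ) ≠ -1 := by norm_num
  have hJ4 : ∀ m : ℕ, _root_.Odd m → J(((4 : ℕ) : ℤ) | m) = 1 := by
    intro m hm
    have : (((4 : ℕ) : ℤ)) = 2 * 2 := by norm_num
    rw [this, jacobiSym.mul_left]
    refine jacobiSym_sq_eq_one ?_
    exact_mod_cast Nat.isCoprime_iff_coprime.mpr (Nat.coprime_two_left.mpr hm)
  have hJ8 : ∀ m : ℕ, _root_.Odd m → J(((8 : ℕ) : ℤ) | m) = χ₈ m := by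
    intro m hm
    have : (((8 : ℕ) : ℤ)) = ((4 : ℕ) : ℤ) * 2 := by norm_num
    rw [this, jacobiSym.mul_left, hJ4 m hm, one_mul, jacobiSym.at_two hm]
  -- The signs at 3 and 5 determine ψ. In this order the inducing characters are the trivial one,
  -- `χ₈'`, `χ₄` and `χ₈`, of levels 1, 8, 4, 8.
  rcases h3 with h3 | h3 <;> rcases h5 with h5 | h5
  · refine ⟨1, inferInstance, 1, by norm_num, Or.inl rfl, selfDual_one, ?_, ?_⟩
    · intro a ha
      obtain ⟨r, hr, h8, -⟩ := odd_intCast_zmod_eight ha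
      rw [h8, Subsingleton.elim (a : ZMod 1) 1, map_one]
      rcases hr with rfl | rfl | rfl | rfl <;> push_cast
      · exact h1.symm
      · exact h3.symm
      · exact h5.symm
      · rw [h7, h3, h5, one_mul]
    · intro m _
      rw [Subsingleton.elim (m : ZMod 1) 1, Subsingleton.elim (-1 : ZMod 1) 1, map_one,
        if_neg (fun h => hI h.2)]
      simp
  · refine ⟨8, inferInstance, complexChar χ₈', by norm_num, Or.inr (by norm_num),
      selfDual_of_mod_eight χ₈' 1 (-1) (by decide) (by decide) (by simp), ?_, ?_⟩
    · intro a ha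
      obtain ⟨r, hr, h8, -⟩ := odd_intCast_zmod_eight ha
      rw [h8, complexChar_apply]
      rcases hr with rfl | rfl | rfl | rfl <;> push_cast
      · rw [h1, show χ₈' 1 = 1 by decide]; simp
      · rw [h3, show χ₈' 3 = 1 by decide]; simp
      · rw [h5, show χ₈' 5 = -1 by decide]; simp
      · rw [h7, h3, h5, show χ₈' 7 = -1 by decide]; simp
    · intro m hm
      rw [complexChar_apply, complexChar_apply, show χ₈' (-1) = -1 by decide, hJ8 m hm,
        ← Int.cast_mul]
      have : χ₈ m * χ₈' m = χ₄ m := by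
        rw [← jacobiSym.at_two hm, ← jacobiSym.at_neg_two hm, ← jacobiSym.at_neg_one hm,
          ← neg_one_mul (2 : ℤ), jacobiSym.mul_left, mul_comm, mul_assoc, jacobiSym_sq_eq_one,
          mul_one]
        exact_mod_cast Nat.isCoprime_iff_coprime.mpr (Nat.coprime_two_left.mpr hm)
      rw [this, hm4 m hm]
      simp
  · refine ⟨4, inferInstance, complexChar χ₄, by norm_num, Or.inr (by norm_num),
      selfDual_chi_four, ?_, ?_⟩
    · intro a ha
      obtain ⟨r, hr, h8, h4⟩ := odd_intCast_zmod_eight ha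
      rw [h8, h4, complexChar_apply]
      rcases hr with rfl | rfl | rfl | rfl <;> push_cast
      · rw [h1, show χ₄ 1 = 1 by decide]; simp
      · rw [h3, show χ₄ 3 = -1 by decide]; simp
      · rw [h5, show χ₄ 5 = 1 by decide]; simp
      · rw [h7, h3, h5, show χ₄ 7 = -1 by decide]; simp
    · intro m hm
      rw [complexChar_apply, complexChar_apply, show χ₄ (-1) = -1 by decide, hJ4 m hm, hm4 m hm]
      simp
  · refine ⟨8, inferInstance, complexChar χ₈, by norm_num, Or.inr (by norm_num),
      selfDual_of_mod_eight χ₈ (-1) (-1) (by decide) (by decide) (by simp), ?_, ?_⟩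
    · intro a ha
      obtain ⟨r, hr, h8, -⟩ := odd_intCast_zmod_eight ha
      rw [h8, complexChar_apply]
      rcases hr with rfl | rfl | rfl | rfl <;> push_cast
      · rw [h1, show χ₈ 1 = 1 by decide]; simp
      · rw [h3, show χ₈ 3 = -1 by decide]; simp
      · rw [h5, show χ₈ 5 = -1 by decide]; simp
      · rw [h7, h3, h5, show χ₈ 7 = 1 by decide]; simp
    · intro m hm
      rw [complexChar_apply, complexChar_apply, show χ₈ (-1) = 1 by decide, hJ8 m hm,
        ← Int.cast_mul, ← jacobiSym.at_two hm, jacobiSym_sq_eq_one, if_neg]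
      · simp
      · push_cast; exact fun h => hI h.2
      · exact_mod_cast Nat.isCoprime_iff_coprime.mpr (Nat.coprime_two_left.mpr hm)

/-! ### Primitive quadratic characters of odd squarefree level -/

theorem exists_prodChar {m n : ℕ} [NeZero m] [NeZero n] (h : m.Coprime n)
    (χ : DirichletCharacter ℂ (m * n)) :
    ∃ (χ₁ : DirichletCharacter ℂ m) (χ₂ : DirichletCharacter ℂ n), χ = prodChar χ₁ χ₂ := by
  let e : (ZMod (m * n))ˣ ≃* (ZMod m)ˣ × (ZMod n)ˣ :=
    (Units.mapEquiv (ZMod.chineseRemainder h).toMulEquiv).trans MulEquiv.prodUnits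
  refine ⟨MulChar.ofUnitHom ((χ.toUnitHom.comp e.symm.toMonoidHom).comp (MonoidHom.inl _ _)),
    MulChar.ofUnitHom ((χ.toUnitHom.comp e.symm.toMonoidHom).comp (MonoidHom.inr _ _)), ?_⟩
  refine MulChar.ext fun u => ?_
  have h1 : ZMod.unitsMap (dvd_mul_right m n) u = (e u).1 := by
    ext
    rw [ZMod.unitsMap_val]
    exact (Prod.fst_zmod_cast (u : ZMod (m * n))).symm
  have h2 : ZMod.unitsMap (dvd_mul_left n m) u = (e u).2 := by
    ext
    rw [ZMod.unitsMap_val]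
    exact (Prod.snd_zmod_cast (u : ZMod (m * n))).symm
  have key : ∀ {N : ℕ} (f : (ZMod N)ˣ →* ℂˣ), MulChar.toUnitHom (MulChar.ofUnitHom f) = f :=
    fun f => by ext; simp
  rw [prodChar, MulChar.mul_apply, changeLevel_def, changeLevel_def, MulChar.ofUnitHom_coe,
    MulChar.ofUnitHom_coe, key, key]
  simp only [MonoidHom.comp_apply]
  rw [h1, h2, ← Units.val_mul, ← map_mul, MulEquiv.coe_toMonoidHom, ← map_mul,
    MonoidHom.inl_apply, MonoidHom.inr_apply, Prod.mk_mul_mk, one_mul, mul_one, Prod.mk.eta,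
    MulEquiv.symm_apply_apply, MulChar.coe_toUnitHom]

theorem prodChar_coprime_pair {m n : ℕ} [NeZero m] [NeZero n] (h : m.Coprime n)
    (χ : DirichletCharacter ℂ m) (ψ : DirichletCharacter ℂ n) (hsq : prodChar χ ψ ^ 2 = 1) :
    χ ^ 2 = 1 ∧ ψ ^ 2 = 1 := by
  have key : ∀ a b : ℤ, IsCoprime a m → IsCoprime b n → (χ a * ψ b) ^ 2 = 1 := by
    intro a b ha hb
    obtain ⟨x, hx⟩ := (ZMod.intCast_surjective (n := m * n))
      ((ZMod.chineseRemainder h).symm ((a : ZMod m), (b : ZMod n)))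
    have hx2 : ((x : ZMod m), (x : ZMod n)) = ((a : ZMod m), (b : ZMod n)) := by
      rw [← (ZMod.chineseRemainder h).apply_symm_apply ((a : ZMod m), (b : ZMod n)), ← hx,
        map_intCast]
      rfl
    rw [Prod.mk.injEq] at hx2
    have h3 : IsUnit (x : ZMod (m * n)) := by
      rw [ZMod.coe_int_isUnit_iff_isCoprime, isCoprime_comm]
      push_cast
      refine IsCoprime.mul_right ?_ ?_
      · rw [isCoprime_comm, ← ZMod.coe_int_isUnit_iff_isCoprime, hx2.1,
          ZMod.coe_int_isUnit_iff_isCoprime, isCoprime_comm]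
        exact ha
      · rw [isCoprime_comm, ← ZMod.coe_int_isUnit_iff_isCoprime, hx2.2,
          ZMod.coe_int_isUnit_iff_isCoprime, isCoprime_comm]
        exact hb
    obtain ⟨u, hu⟩ := h3
    have h4 := MulChar.pow_apply_coe (prodChar χ ψ) 2 u
    rw [hsq, MulChar.one_apply_coe, hu, prodChar_intCast, hx2.1, hx2.2] at h4
    exact h4.symm
  have unit_int : ∀ {N : ℕ} (u : (ZMod N)ˣ), ∃ a : ℤ, (a : ZMod N) = u ∧ IsCoprime a N := by
    intro N u
    obtain ⟨a, ha⟩ := ZMod.intCast_surjective (u : ZMod N)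
    refine ⟨a, ha, ?_⟩
    rw [isCoprime_comm, ← ZMod.coe_int_isUnit_iff_isCoprime, ha]
    exact u.isUnit
  constructor
  · refine MulChar.ext fun u => ?_
    obtain ⟨a, ha, hc⟩ := unit_int u
    have := key a 1 hc isCoprime_one_left
    rw [MulChar.pow_apply_coe, MulChar.one_apply_coe, ← ha]
    simpa using this
  · refine MulChar.ext fun u => ?_
    obtain ⟨a, ha, hc⟩ := unit_int u
    have := key 1 a isCoprime_one_left hc
    rw [MulChar.pow_apply_coe, MulChar.one_apply_coe, ← ha]
    simpa using this

/-- The conductor of a product divides the product of the conductors; if it is all of mn, neither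
conductor can be a proper divisor of its level. -/
theorem isPrimitive_of_prodChar {m n : ℕ} [NeZero m] [NeZero n]
    (χ : DirichletCharacter ℂ m) (ψ : DirichletCharacter ℂ n) (h : (prodChar χ ψ).IsPrimitive) :
    χ.IsPrimitive ∧ ψ.IsPrimitive := by
  have h1 := conductor_mul_dvd_lcm_conductor (changeLevel (dvd_mul_right m n) χ)
    (changeLevel (dvd_mul_left n m) ψ)
  rw [conductor_changeLevel, conductor_changeLevel] at h1
  have h2 : m * n ∣ χ.conductor * ψ.conductor := by
    have h3 : (prodChar χ ψ).conductor = m * n := h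
    rw [← h3]
    exact h1.trans (Nat.lcm_dvd_mul _ _)
  obtain ⟨a, ha⟩ := χ.conductor_dvd_level
  obtain ⟨b, hb⟩ := ψ.conductor_dvd_level
  have hc : 0 < χ.conductor := Nat.pos_of_ne_zero χ.conductor_ne_zero
  have hd : 0 < ψ.conductor := Nat.pos_of_ne_zero ψ.conductor_ne_zero
  have h4 := Nat.le_of_dvd (Nat.mul_pos hc hd) h2
  have h5 : χ.conductor * ψ.conductor * (a * b) ≤ χ.conductor * ψ.conductor * 1 := by
    calc _ = (χ.conductor * a) * (ψ.conductor * b) := by ring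
      _ = m * n := by rw [← ha, ← hb]
      _ ≤ _ := by rw [mul_one]; exact h4
  have h6 := Nat.le_of_mul_le_mul_left h5 (Nat.mul_pos hc hd)
  have ha0 : a ≠ 0 := by rintro rfl; exact NeZero.ne m (by rw [ha, mul_zero])
  have hb0 : b ≠ 0 := by rintro rfl; exact NeZero.ne n (by rw [hb, mul_zero])
  have ha1 : a = 1 := by nlinarith [Nat.pos_of_ne_zero ha0, Nat.pos_of_ne_zero hb0]
  have hb1 : b = 1 := by nlinarith [Nat.pos_of_ne_zero ha0, Nat.pos_of_ne_zero hb0]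
  rw [ha1, mul_one] at ha
  rw [hb1, mul_one] at hb
  exact ⟨ha.symm, hb.symm⟩

/-- A character of order 2 is trivial on squares. Some u₀ has value -1 and is thus a non-square, and
multiplying by u₀ sends every non-square unit to a square, which forces the value -1 there. -/
theorem eq_chiTilde_of_prime {p : ℕ} [Fact p.Prime] (χ : DirichletCharacter ℂ p) (hχ : χ ≠ 1)
    (hsq : χ ^ 2 = 1) : χ = chiTilde p := by
  have hpp : p.Prime := Fact.out
  have hval : ∀ u : (ZMod p)ˣ, χ u = 1 ∨ χ u = -1 := by
    intro u
    rw [← sq_eq_one_iff, ← MulChar.pow_apply_coe, hsq, MulChar.one_apply_coe]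
  have hsquare : ∀ u : (ZMod p)ˣ, IsSquare (u : ZMod p) → χ u = 1 := by
    rintro u ⟨v, hv⟩
    have hv0 : v ≠ 0 := by rintro rfl; exact u.ne_zero (by rw [hv, mul_zero])
    have := hval (Units.mk0 v hv0)
    rw [Units.val_mk0] at this
    rw [hv, map_mul]
    rcases this with h | h <;> rw [h] <;> norm_num
  obtain ⟨u₀, hu₀⟩ : ∃ u₀ : (ZMod p)ˣ, χ u₀ = -1 := by
    by_contra hcon
    push Not at hcon
    exact hχ (MulChar.ext fun u => by
      rw [MulChar.one_apply_coe]; exact (hval u).resolve_right (hcon u))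
  have hu0 : quadraticChar (ZMod p) (u₀ : ZMod p) = -1 := by
    rw [quadraticChar_neg_one_iff_not_isSquare]
    intro h
    have := hsquare u₀ h
    rw [hu₀] at this
    norm_num at this
  refine MulChar.ext fun u => ?_
  have h1 : chiTilde p (u : ZMod p) = (quadraticChar (ZMod p) (u : ZMod p) : ℤ) := by
    obtain ⟨a, ha⟩ := ZMod.intCast_surjective (u : ZMod p)
    rw [← ha, chiTilde_intCast hpp.ne_zero, ← jacobiSym.legendreSym.to_jacobiSym]
    rfl
  rw [h1]
  rcases quadraticChar_dichotomy u.ne_zero with h | h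
  · rw [h, hsquare u ((quadraticChar_one_iff_isSquare u.ne_zero).mp h)]; simp
  · have h2 : quadraticChar (ZMod p) ((u * u₀ : (ZMod p)ˣ) : ZMod p) = 1 := by
      rw [Units.val_mul, map_mul, h, hu0]; norm_num
    have h3 := hsquare _ ((quadraticChar_one_iff_isSquare (u * u₀).ne_zero).mp h2)
    rw [Units.val_mul, map_mul, hu₀] at h3
    rw [h]
    push_cast
    linear_combination -h3

/-- A primitive quadratic character of squarefree level is a Jacobi symbol. -/
theorem eq_chiTilde_of_isPrimitive {j : ℕ} (hj : Squarefree j) (χ : DirichletCharacter ℂ j)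
    (hχ : χ.IsPrimitive) (hsq : χ ^ 2 = 1) : χ = chiTilde j := by
  induction j using Nat.recOnMul with
  | zero => exact absurd hj not_squarefree_zero
  | one => rw [level_one χ, level_one (chiTilde 1)]
  | prime p hp =>
    have : Fact p.Prime := ⟨hp⟩
    refine eq_chiTilde_of_prime χ ?_ hsq
    rintro rfl
    have : (1 : DirichletCharacter ℂ p).conductor = p := hχ
    rw [conductor_one] at this
    exact hp.one_lt.ne this
  | mul a b iha ihb =>
    have h0 : a * b ≠ 0 := hj.ne_zero
    have : NeZero a := ⟨left_ne_zero_of_mul h0⟩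
    have : NeZero b := ⟨right_ne_zero_of_mul h0⟩
    have hcop := Nat.coprime_of_squarefree_mul hj
    obtain ⟨χ₁, χ₂, rfl⟩ := exists_prodChar hcop χ
    obtain ⟨p1, p2⟩ := isPrimitive_of_prodChar χ₁ χ₂ hχ
    obtain ⟨q1, q2⟩ := prodChar_coprime_pair hcop χ₁ χ₂ hsq
    rw [iha hj.of_mul_left χ₁ p1 q1, ihb hj.of_mul_right χ₂ p2 q2,
      chiTilde_mul (NeZero.ne a) (NeZero.ne b)]

end DoubleDirichlet

/-! ### Functional equations and convexity bounds for L-functions. -/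

namespace DoubleDirichlet

open Complex Filter Topology DirichletCharacter MeasureTheory Set HurwitzZeta
open scoped ZMod

/-! ### Functional equation of the `L`-functions of self-dual characters -/

/-- The gamma quotient in the functional equation of an even character. -/
noncomputable def gammaEven (w : ℂ) : ℂ := Gammaℝ (1 - w) * (Gammaℝ w)⁻¹

/-- The gamma quotient in the functional equation of an odd character. -/
noncomputable def gammaOdd (w : ℂ) : ℂ := Gammaℝ (2 - w) * (Gammaℝ (w + 1))⁻¹

open Classical in
/-- The gamma quotient belonging to a character with `χ (-1) = t`. -/
noncomputable def gammaSgn (t : ℂ) (w : ℂ) : ℂ := if t = 1 then gammaEven w else gammaOdd w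

theorem Gammaℝ_ne_zero_of_im_ne_zero {w : ℂ} (hw : w.im ≠ 0) : Gammaℝ w ≠ 0 := by
  rw [Ne, Gammaℝ_eq_zero_iff]
  rintro ⟨n, rfl⟩
  simp at hw

variable {N : ℕ} [NeZero N]

theorem SelfDual.dft_eq {χ : DirichletCharacter ℂ N} (h : SelfDual χ) :
    𝓕 (χ : ZMod N → ℂ) = fun k => ((if χ (-1) = 1 then 1 else -I) * (Real.sqrt N : ℂ)) * χ k :=
  funext h

theorem natCast_cpow_mul_sqrt (w : ℂ) :
    (N : ℂ) ^ (-w) * (Real.sqrt N : ℂ) = (N : ℂ) ^ (1 / 2 - w) := by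
  have hN : (N : ℂ) ≠ 0 := NeZero.ne _
  rw [show (1 / 2 - w : ℂ) = -w + 1 / 2 by ring, cpow_add _ _ hN, Real.sqrt_eq_rpow,
    ofReal_cpow (by positivity)]
  push_cast
  rfl

/-- The general functional equation passes to the discrete Fourier transform of χ, which
self-duality replaces by a multiple of χ. The points 0 and 1 need to be excluded only for the zeta
function, N = 1. -/
theorem SelfDual.completedLFunction_eq {χ : DirichletCharacter ℂ N} (h : SelfDual χ) {w : ℂ}
    (hw0 : w ≠ 0 ∨ N ≠ 1) (hw1 : w ≠ 1 ∨ N ≠ 1) :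
    DirichletCharacter.completedLFunction χ w =
      (N : ℂ) ^ (1 / 2 - w) * DirichletCharacter.completedLFunction χ (1 - w) := by
  have hsum : N ≠ 1 → ∑ j, χ j = 0 := by
    intro hN
    rw [← ZMod.dft_apply_zero, h, map_zero' χ hN, mul_zero]
  simp only [DirichletCharacter.completedLFunction]
  rw [← natCast_cpow_mul_sqrt]
  rcases χ.even_or_odd with he | ho
  · have h1 := ZMod.completedLFunction_one_sub_even he.to_fun (1 - w)
      (hw1.imp (fun h => sub_ne_zero.mpr h.symm) hsum)
      (hw0.imp (fun h => by simpa using h) (fun hN => map_zero' χ hN))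
    rw [sub_sub_cancel, h.dft_eq, ZMod.completedLFunction_const_mul,
      if_pos (show χ (-1) = 1 from he)] at h1
    rw [h1, show (1 - w - 1 : ℂ) = -w by ring]
    ring
  · have h1 := ZMod.completedLFunction_one_sub_odd ho.to_fun (1 - w)
    have h2 : χ (-1) ≠ 1 := by rw [ho]; norm_num
    rw [sub_sub_cancel, h.dft_eq, ZMod.completedLFunction_const_mul, if_neg h2] at h1
    rw [h1, show (1 - w - 1 : ℂ) = -w by ring]
    linear_combination (-(N : ℂ) ^ (-w) * Real.sqrt N * ZMod.completedLFunction χ (1 - w)) * I_mul_I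

theorem SelfDual.LFunction_eq {χ : DirichletCharacter ℂ N} (h : SelfDual χ) {w : ℂ}
    (hw : w.im ≠ 0) :
    LFunction χ w = (N : ℂ) ^ (1 / 2 - w) * gammaSgn (χ (-1)) w * LFunction χ (1 - w) := by
  have hw0 : w ≠ 0 := by rintro rfl; simp at hw
  have hw1 : w ≠ 1 := by rintro rfl; simp at hw
  have h1w : 1 - w ≠ 0 := sub_ne_zero.mpr hw1.symm
  have h2 := h.completedLFunction_eq (Or.inl hw0) (Or.inl hw1)
  have h1im : (1 - w).im ≠ 0 := by simpa using hw
  have h2im : (2 - w).im ≠ 0 := by simpa using hw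
  rcases χ.even_or_odd with he | ho
  · rw [LFunction_eq_completed_div_gammaFactor χ w (Or.inl hw0),
      LFunction_eq_completed_div_gammaFactor χ (1 - w) (Or.inl h1w), he.gammaFactor_def,
      he.gammaFactor_def, gammaSgn, if_pos (show χ (-1) = 1 from he), h2, gammaEven]
    have := Gammaℝ_ne_zero_of_im_ne_zero hw
    have := Gammaℝ_ne_zero_of_im_ne_zero h1im
    field_simp
  · have h3 : χ (-1) ≠ 1 := by rw [ho]; norm_num
    rw [LFunction_eq_completed_div_gammaFactor χ w (Or.inl hw0),
      LFunction_eq_completed_div_gammaFactor χ (1 - w) (Or.inl h1w), ho.gammaFactor_def,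
      ho.gammaFactor_def, gammaSgn, if_neg h3, h2, gammaOdd,
      show (1 - w + 1 : ℂ) = 2 - w by ring]
    have := Gammaℝ_ne_zero_of_im_ne_zero (w := w + 1) (by simpa using hw)
    have := Gammaℝ_ne_zero_of_im_ne_zero h2im
    field_simp

/-! ### Boundedness in vertical strips -/

/-- In the strip, |t^{s-1}| is at most the sum of its values at the two edges. This yields the
boundedness of completed L-functions that the three lines theorem requires. -/
theorem norm_mellin_le {f : ℝ → ℂ} (hf : ∀ s : ℂ, MellinConvergent f s) (a b : ℝ) :
    ∃ C, ∀ s : ℂ, a ≤ s.re → s.re ≤ b → ‖mellin f s‖ ≤ C := by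
  refine ⟨∫ t in Ioi (0 : ℝ), (‖(t : ℂ) ^ ((a : ℂ) - 1) • f t‖ + ‖(t : ℂ) ^ ((b : ℂ) - 1) • f t‖),
    fun s ha hb => ?_⟩
  refine (norm_integral_le_integral_norm _).trans ?_
  refine setIntegral_mono_on (hf s).norm ((hf a).norm.add (hf b).norm) measurableSet_Ioi ?_
  intro t ht
  have ht' : (0 : ℝ) < t := ht
  simp only [norm_smul, norm_cpow_eq_rpow_re_of_pos ht', sub_re, one_re, ofReal_re]
  rw [← add_mul]
  refine mul_le_mul_of_nonneg_right ?_ (norm_nonneg _)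
  rcases le_total 1 t with h1 | h1
  · exact (Real.rpow_le_rpow_of_exponent_le h1 (by linarith)).trans
      (le_add_of_nonneg_left (by positivity))
  · exact (Real.rpow_le_rpow_of_exponent_ge ht' h1 (by linarith)).trans
      (le_add_of_nonneg_right (by positivity))

theorem norm_Λ₀_le (P : WeakFEPair ℂ) (a b : ℝ) :
    ∃ C, ∀ s : ℂ, a ≤ s.re → s.re ≤ b → ‖P.Λ₀ s‖ ≤ C := by
  have hP := P.isStrongFEPair_toStrongFEPair
  refine norm_mellin_le (f := P.f_modif) (fun s => ?_) a b
  obtain ⟨t, ht⟩ := exists_gt s.re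
  obtain ⟨u, hu⟩ := exists_lt s.re
  exact mellinConvergent_of_isBigO_rpow P.toStrongFEPair.hf_int (hP.hf_top _) ht (hP.hf_zero _) hu

theorem norm_completedLFunction₀_le (Φ : ZMod N → ℂ) (a b : ℝ) :
    ∃ C, ∀ s : ℂ, a ≤ s.re → s.re ≤ b → ‖ZMod.completedLFunction₀ Φ s‖ ≤ C := by
  have h1 : ∀ j : ZMod N, ∃ C, ∀ s : ℂ, a ≤ s.re → s.re ≤ b →
      ‖completedHurwitzZetaEven₀ (ZMod.toAddCircle j) s‖ ≤ C := by
    intro j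
    obtain ⟨C, hC⟩ := norm_Λ₀_le (hurwitzEvenFEPair (ZMod.toAddCircle j)) (a / 2) (b / 2)
    refine ⟨C / 2, fun s ha hb => ?_⟩
    rw [completedHurwitzZetaEven₀, norm_div, Complex.norm_two]
    refine div_le_div_of_nonneg_right (hC _ ?_ ?_) (by norm_num) <;> simp <;> linarith
  have h2 : ∀ j : ZMod N, ∃ C, ∀ s : ℂ, a ≤ s.re → s.re ≤ b →
      ‖completedHurwitzZetaOdd (ZMod.toAddCircle j) s‖ ≤ C := by
    intro j
    obtain ⟨C, hC⟩ := norm_Λ₀_le (hurwitzOddFEPair (ZMod.toAddCircle j)) ((a + 1) / 2) ((b + 1) / 2)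
    refine ⟨C / 2, fun s ha hb => ?_⟩
    have hS := isStrong_hurwitzOddFEPair (ZMod.toAddCircle j)
    rw [completedHurwitzZetaOdd, norm_div, Complex.norm_two, WeakFEPair.Λ, hS.hf₀, hS.hg₀,
      smul_zero, smul_zero, sub_zero, sub_zero]
    refine div_le_div_of_nonneg_right (hC _ ?_ ?_) (by norm_num) <;> simp <;> linarith
  choose C1 hC1 using h1
  choose C2 hC2 using h2
  have hN : (0 : ℝ) < N := by have := NeZero.pos N; positivity
  refine ⟨((N : ℝ) ^ (-a) * ∑ j, ‖Φ j‖ * C1 j) + (N : ℝ) ^ (-a) * ∑ j, ‖Φ j‖ * C2 j,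
    fun s ha hb => ?_⟩
  have hNs : ‖(N : ℂ) ^ (-s)‖ ≤ (N : ℝ) ^ (-a) := by
    rw [← ofReal_natCast, norm_cpow_eq_rpow_re_of_pos hN]
    refine Real.rpow_le_rpow_of_exponent_le ?_ (by simpa using ha)
    exact_mod_cast NeZero.pos N
  have key : ∀ (F : ZMod N → ℂ) (C : ZMod N → ℝ), (∀ j, ‖F j‖ ≤ C j) →
      ‖(N : ℂ) ^ (-s) * ∑ j, Φ j * F j‖ ≤ (N : ℝ) ^ (-a) * ∑ j, ‖Φ j‖ * C j := by
    intro F C hF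
    rw [norm_mul]
    refine mul_le_mul hNs ?_ (norm_nonneg _) (by positivity)
    refine (norm_sum_le _ _).trans (Finset.sum_le_sum fun j _ => ?_)
    rw [norm_mul]
    exact mul_le_mul_of_nonneg_left (hF j) (norm_nonneg _)
  exact (norm_add_le _ _).trans (add_le_add (key _ _ fun j => hC1 j s ha hb)
    (key _ _ fun j => hC2 j s ha hb))

theorem norm_Gamma_le {s : ℂ} (hs : 0 < s.re) : ‖Complex.Gamma s‖ ≤ Real.Gamma s.re := by
  rw [Complex.Gamma_eq_integral hs, Real.Gamma_eq_integral hs, GammaIntegral]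
  refine (norm_integral_le_integral_norm _).trans (le_of_eq ?_)
  refine setIntegral_congr_fun measurableSet_Ioi fun x hx => ?_
  have hx' : (0 : ℝ) < x := hx
  simp only [norm_mul, norm_cpow_eq_rpow_re_of_pos hx', sub_re, one_re, norm_real, Real.norm_eq_abs]
  rw [abs_of_pos (Real.exp_pos _)]

theorem norm_Gammaℝ_le {s : ℂ} (hs : 0 < s.re) :
    ‖Gammaℝ s‖ ≤ Real.pi ^ (-s.re / 2) * Real.Gamma (s.re / 2) := by
  rw [Gammaℝ_def, norm_mul, norm_cpow_eq_rpow_re_of_pos Real.pi_pos]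
  have h1 : (-s / 2 : ℂ).re = -s.re / 2 := by simp
  have h2 : (s / 2 : ℂ).re = s.re / 2 := by simp
  rw [h1]
  refine mul_le_mul_of_nonneg_left ?_ (by positivity)
  rw [← h2]
  exact norm_Gamma_le (by rw [h2]; positivity)

theorem norm_LFunction_le (χ : DirichletCharacter ℂ N) {s : ℂ} (hs : 1 < s.re) :
    ‖LFunction χ s‖ ≤ ∑' n : ℕ, 1 / (n : ℝ) ^ s.re := by
  rw [LFunction_eq_LSeries χ hs, LSeries]
  have hsum := Real.summable_one_div_nat_rpow.mpr hs
  refine tsum_of_norm_bounded hsum.hasSum fun n => ?_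
  rw [LSeries.norm_term_eq]
  split_ifs with hn
  · positivity
  · exact div_le_div_of_nonneg_right (norm_le_one χ _) (by positivity)

/-! ### The convexity bound -/

/-- The exponent in the convexity bound. -/
noncomputable def convexityExponent (u : ℝ) : ℝ := max (max 0 ((1 - u) / 2)) (1 / 2 - u)

/-- Three lines on -A ≤ Re s ≤ 1 + A: the Dirichlet series bounds the right edge, and the functional
equation carries this to the left edge with a factor N^{1/2+A}. The constant depends on A alone. For
N = 1 the completed function has poles, so that case is excluded. -/
theorem norm_completedLFunction_le (A : ℝ) (hA : 0 < A) :
    ∃ K, 0 < K ∧ ∀ (N : ℕ) [NeZero N] (χ : DirichletCharacter ℂ N), SelfDual χ → N ≠ 1 →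
      ∀ s : ℂ, -A ≤ s.re → s.re ≤ 1 + A →
        ‖DirichletCharacter.completedLFunction χ s‖ ≤ K * (N : ℝ) ^ ((1 + A - s.re) / 2) := by
  set Z : ℝ := ∑' n : ℕ, 1 / (n : ℝ) ^ (1 + A) with hZ
  have hZ0 : 0 ≤ Z := tsum_nonneg fun n => by positivity
  set G0 : ℝ := Real.pi ^ (-(1 + A) / 2) * Real.Gamma ((1 + A) / 2) with hG0
  set G1 : ℝ := Real.pi ^ (-(1 + A + 1) / 2) * Real.Gamma ((1 + A + 1) / 2) with hG1
  have hG0p : 0 < G0 := mul_pos (by positivity) (Real.Gamma_pos_of_pos (by positivity))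
  have hG1p : 0 < G1 := mul_pos (by positivity) (Real.Gamma_pos_of_pos (by positivity))
  refine ⟨(G0 + G1) * (Z + 1), by positivity, ?_⟩
  intro N _ χ hχ hN s hs1 hs2
  set K := (G0 + G1) * (Z + 1) with hK
  have hKp : 0 < K := by positivity
  have hNp : (0 : ℝ) < N := by have := NeZero.pos N; positivity
  have hright : ∀ w : ℂ, w.re = 1 + A → ‖DirichletCharacter.completedLFunction χ w‖ ≤ K := by
    intro w hw
    have hw0 : w ≠ 0 := by rintro rfl; simp at hw; linarith
    have h1 := LFunction_eq_completed_div_gammaFactor χ w (Or.inl hw0)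
    have hL : ‖LFunction χ w‖ ≤ Z + 1 := by
      have := norm_LFunction_le χ (s := w) (by linarith)
      rw [hw] at this
      linarith
    have hg : ‖gammaFactor χ w‖ ≤ G0 + G1 ∧ gammaFactor χ w ≠ 0 := by
      rcases χ.even_or_odd with he | ho
      · rw [he.gammaFactor_def]
        refine ⟨?_, Gammaℝ_ne_zero_of_re_pos (by linarith)⟩
        have := norm_Gammaℝ_le (s := w) (by linarith)
        rw [hw] at this
        linarith
      · rw [ho.gammaFactor_def]
        have hre : (w + 1).re = 1 + A + 1 := by simp [hw]
        refine ⟨?_, Gammaℝ_ne_zero_of_re_pos (by linarith)⟩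
        have := norm_Gammaℝ_le (s := w + 1) (by linarith)
        rw [hre] at this
        linarith
    rw [eq_div_iff hg.2] at h1
    rw [← h1, norm_mul, mul_comm]
    exact mul_le_mul hg.1 hL (norm_nonneg _) (by positivity)
  have hleft : ∀ w : ℂ, w.re = -A →
      ‖DirichletCharacter.completedLFunction χ w‖ ≤ K * (N : ℝ) ^ (1 / 2 + A) := by
    intro w hw
    rw [hχ.completedLFunction_eq (Or.inr hN) (Or.inr hN), norm_mul, mul_comm]
    refine mul_le_mul (hright _ (by simp [hw])) ?_ (norm_nonneg _) hKp.le
    rw [← ofReal_natCast, norm_cpow_eq_rpow_re_of_pos hNp]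
    simp [hw]
  have hsum : ∑ j, χ j = 0 := by
    rw [← ZMod.dft_apply_zero, hχ, map_zero' χ hN, mul_zero]
  have hdiff : Differentiable ℂ (DirichletCharacter.completedLFunction χ) :=
    ZMod.differentiable_completedLFunction (map_zero' χ hN) hsum
  have hB : BddAbove ((norm ∘ DirichletCharacter.completedLFunction χ) ''
      HadamardThreeLines.verticalClosedStrip (-A) (1 + A)) := by
    obtain ⟨C, hC⟩ := norm_completedLFunction₀_le (χ : ZMod N → ℂ) (-A) (1 + A)
    refine ⟨C, ?_⟩
    rintro _ ⟨w, hw, rfl⟩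
    have := hC w hw.1 hw.2
    rw [Function.comp_apply, DirichletCharacter.completedLFunction, ZMod.completedLFunction_eq,
      hsum, map_zero' χ hN]
    simpa using this
  have h3 := HadamardThreeLines.norm_le_interp_of_mem_verticalClosedStrip' (l := -A) (u := 1 + A)
    (z := s) (by linarith) ⟨hs1, hs2⟩ hdiff.diffContOnCl hB (fun w hw => hleft w hw)
    (fun w hw => hright w hw)
  refine h3.trans (le_of_eq ?_)
  rw [Real.mul_rpow hKp.le (by positivity), mul_right_comm, ← Real.rpow_add hKp,
    sub_add_cancel, Real.rpow_one, ← Real.rpow_mul hNp.le]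
  congr 2
  have : (1 + A - -A : ℝ) ≠ 0 := by linarith
  field_simp
  ring

/-- Local uniform convexity bound for `L`-functions of self-dual characters. -/
theorem exists_convexity_bound {w₀ : ℂ} (hw₀ : w₀ ≠ 1) {e : ℝ}
    (he : convexityExponent w₀.re < e) :
    ∃ r, 0 < r ∧ ∃ C, ∀ (N : ℕ) [NeZero N] (χ : DirichletCharacter ℂ N), SelfDual χ →
      ∀ w : ℂ, ‖w - w₀‖ < r → ‖LFunction χ w‖ ≤ C * (N : ℝ) ^ e := by
  set η := e - convexityExponent w₀.re with hη
  have hη0 : 0 < η := sub_pos.mpr he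
  -- Solves (1 + A0 - Re w₀)/2 = `convexityExponent w₀.re`. The three terms of the maximum say
  -- precisely that Re w₀ lies in the strip -A0 ≤ Re ≤ 1 + A0 and that A0 ≥ 0.
  set A0 : ℝ := 2 * convexityExponent w₀.re + w₀.re - 1 with hA0
  have hA0' : 0 ≤ A0 ∧ -w₀.re ≤ A0 ∧ w₀.re - 1 ≤ A0 := by
    have h1 : (0 : ℝ) ≤ convexityExponent w₀.re := (le_max_left _ _).trans (le_max_left _ _)
    have h2 : (1 - w₀.re) / 2 ≤ convexityExponent w₀.re :=
      (le_max_right _ _).trans (le_max_left _ _)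
    have h3 : 1 / 2 - w₀.re ≤ convexityExponent w₀.re := le_max_right _ _
    refine ⟨?_, ?_, ?_⟩ <;> linarith
  obtain ⟨K, hK, hbound⟩ := norm_completedLFunction_le (A0 + η) (by linarith)
  -- local bounds for the reciprocal gamma factors and for the zeta function
  have hloc : ∀ f : ℂ → ℂ, ContinuousAt f w₀ → ∀ᶠ w in 𝓝 w₀, ‖f w‖ ≤ ‖f w₀‖ + 1 := by
    intro f hf
    have := hf.norm.eventually (gt_mem_nhds (lt_add_one ‖f w₀‖))
    filter_upwards [this] with w hw using hw.le
  have h1 := hloc (fun w => (Gammaℝ w)⁻¹) differentiable_Gammaℝ_inv.continuous.continuousAt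
  have h2 := hloc (fun w => (Gammaℝ (w + 1))⁻¹)
    (differentiable_Gammaℝ_inv.comp (differentiable_id.add_const 1)).continuous.continuousAt
  have h3 := hloc riemannZeta (differentiableAt_riemannZeta hw₀).continuousAt
  obtain ⟨r, hr, hball⟩ := Metric.eventually_nhds_iff.mp (h1.and (h2.and h3))
  set B := (‖(Gammaℝ w₀)⁻¹‖ + 1) + (‖(Gammaℝ (w₀ + 1))⁻¹‖ + 1) with hBdef
  refine ⟨min r η, lt_min hr hη0, (‖riemannZeta w₀‖ + 1) + B * K, ?_⟩
  intro N _ χ hχ w hw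
  obtain ⟨hb1, hb2, hb3⟩ := hball (show dist w w₀ < r from by
    rw [dist_eq_norm]; exact hw.trans_le (min_le_left _ _))
  -- Level 1 is the zeta function; the pole is avoided because w₀ ≠ 1, and local continuity
  -- suffices.
  by_cases hN : N = 1
  · subst hN
    rw [LFunction_modOne_eq, Nat.cast_one, Real.one_rpow, mul_one]
    have : 0 ≤ B * K := by positivity
    linarith
  · have hN1 : (1 : ℝ) ≤ N := by exact_mod_cast NeZero.one_le
    have hre : |w.re - w₀.re| < η := by
      have := abs_re_le_norm (w - w₀)
      rw [sub_re] at this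
      exact this.trans_lt (hw.trans_le (min_le_right _ _))
    rw [abs_lt] at hre
    have h4 := hbound N χ hχ hN w (by linarith) (by linarith)
    have h5 : (N : ℝ) ^ ((1 + (A0 + η) - w.re) / 2) ≤ (N : ℝ) ^ e :=
      Real.rpow_le_rpow_of_exponent_le hN1 (by linarith)
    have h6 : ‖(gammaFactor χ w)⁻¹‖ ≤ B := by
      have : 0 ≤ ‖(Gammaℝ w₀)⁻¹‖ := norm_nonneg _
      have : 0 ≤ ‖(Gammaℝ (w₀ + 1))⁻¹‖ := norm_nonneg _
      rcases χ.even_or_odd with he | ho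
      · rw [he.gammaFactor_def]; linarith
      · rw [ho.gammaFactor_def]; linarith
    rw [LFunction_eq_completed_div_gammaFactor χ w (Or.inr hN), div_eq_inv_mul, norm_mul]
    have h7 : 0 ≤ (‖riemannZeta w₀‖ + 1) * (N : ℝ) ^ e := by positivity
    calc _ ≤ B * (K * (N : ℝ) ^ e) := by
          refine mul_le_mul h6 (h4.trans ?_) (norm_nonneg _) (by positivity)
          exact mul_le_mul_of_nonneg_left h5 hK.le
      _ ≤ _ := by rw [add_mul, ← mul_assoc]; linarith

end DoubleDirichlet

/-! ### Upper Stirling bounds. -/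

namespace DoubleDirichlet

open Complex Filter Topology Set

/-! ### Two-sided bounds for the Gamma function in the right half-plane -/

theorem norm_sin_le_exp (z : ℂ) : ‖Complex.sin z‖ ≤ Real.exp |z.im| := by
  have h1 : ‖Complex.exp (-z * I)‖ ≤ Real.exp |z.im| := by
    rw [norm_exp]; simpa using le_abs_self z.im
  have h2 : ‖Complex.exp (z * I)‖ ≤ Real.exp |z.im| := by
    rw [norm_exp]; simpa using neg_le_abs z.im
  rw [Complex.sin, norm_div, norm_mul, norm_I, mul_one, Complex.norm_two]
  have := norm_sub_le (Complex.exp (-z * I)) (Complex.exp (z * I))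
  linarith

theorem norm_cos_le_exp (z : ℂ) : ‖Complex.cos z‖ ≤ Real.exp |z.im| := by
  have := norm_sin_le_exp (z + Real.pi / 2)
  rw [Complex.sin_add_pi_div_two] at this
  simpa using this

theorem exp_le_norm_sin {x : ℂ} (h1 : 1 / 2 ≤ x.re) (h2 : x.re ≤ 3 / 2) :
    Real.exp (Real.pi / 2 * |x.im|) ≤ 4 * ‖Complex.sin (Real.pi * x / 2)‖ := by
  have hpi := Real.pi_pos
  have hre : (Real.pi * x / 2 : ℂ).re = Real.pi / 2 * x.re := by simp; ring
  have him : (Real.pi * x / 2 : ℂ).im = Real.pi / 2 * x.im := by simp; ring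
  have h3 : (Complex.sin (Real.pi * x / 2)).re =
      Real.sin (Real.pi / 2 * x.re) * Real.cosh (Real.pi / 2 * x.im) := by
    rw [Complex.sin_eq, hre, him, ← ofReal_sin, ← ofReal_cos, ← ofReal_cosh, ← ofReal_sinh,
      ← ofReal_mul, ← ofReal_mul, add_re, ofReal_re, mul_I_re, ofReal_im, neg_zero, add_zero]
  have h4 : 1 / 2 ≤ Real.sin (Real.pi / 2 * x.re) := by
    rw [show Real.pi / 2 * x.re = Real.pi / 2 - Real.pi / 2 * (1 - x.re) by ring,
      Real.sin_pi_div_two_sub, ← Real.cos_abs, ← Real.cos_pi_div_three]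
    refine Real.cos_le_cos_of_nonneg_of_le_pi (abs_nonneg _) (by linarith) ?_
    rw [abs_le]
    constructor <;> nlinarith
  have h5 : Real.exp (Real.pi / 2 * |x.im|) ≤ 2 * Real.cosh (Real.pi / 2 * x.im) := by
    rw [← Real.cosh_abs, abs_mul, abs_of_pos (by positivity : 0 < Real.pi / 2), Real.cosh_eq]
    have := Real.exp_pos (-(Real.pi / 2 * |x.im|))
    linarith
  have h6 := (le_abs_self _).trans (abs_re_le_norm (Complex.sin (Real.pi * x / 2)))
  rw [h3] at h6
  have h7 : 0 < Real.cosh (Real.pi / 2 * x.im) := Real.cosh_pos _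
  nlinarith

/-- On the critical line conjugation is x ↦ 1 - x, so the squared modulus is Γ(x)Γ(1-x) sin(πx/2)
cos(πx/2), which the reflection formula evaluates to π/2. -/
theorem norm_Gamma_mul_sin_half {x : ℂ} (hx : x.re = 1 / 2) :
    ‖Complex.Gamma x * Complex.sin (Real.pi * x / 2)‖ ≤ 2 := by
  have hconj : (starRingEnd ℂ) x = 1 - x := by
    apply Complex.ext <;> simp [hx]; norm_num
  have h1 : (starRingEnd ℂ) (Complex.Gamma x * Complex.sin (Real.pi * x / 2)) =
      Complex.Gamma (1 - x) * Complex.cos (Real.pi * x / 2) := by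
    rw [map_mul, ← Complex.Gamma_conj, ← Complex.sin_conj, map_div₀, map_mul, conj_ofReal, hconj,
      map_ofNat, ← Complex.sin_pi_div_two_sub]
    congr 2
    ring
  have h2 : (Complex.Gamma x * Complex.sin (Real.pi * x / 2)) *
      (Complex.Gamma (1 - x) * Complex.cos (Real.pi * x / 2)) =
      Real.pi / Complex.sin (Real.pi * x) * (Complex.sin (Real.pi * x) / 2) := by
    rw [← Complex.Gamma_mul_Gamma_one_sub, show (Real.pi * x : ℂ) = 2 * (Real.pi * x / 2) by ring,
      Complex.sin_two_mul]
    ring_nf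
  have h3 : ‖Complex.Gamma x * Complex.sin (Real.pi * x / 2)‖ ^ 2 ≤ 2 := by
    rw [sq]
    nth_rw 2 [← Complex.norm_conj]
    rw [← norm_mul, h1, h2]
    by_cases h : Complex.sin (Real.pi * x) = 0
    · simp [h]
    · rw [div_mul_div_comm, mul_comm (Real.pi : ℂ), mul_div_mul_left _ _ h, norm_div, norm_real,
        Complex.norm_two, Real.norm_of_nonneg Real.pi_pos.le]
      linarith [Real.pi_le_four]
  nlinarith [norm_nonneg (Complex.Gamma x * Complex.sin (Real.pi * x / 2))]

theorem norm_Gamma_mul_sin_three_half {x : ℂ} (hx : x.re = 3 / 2) :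
    ‖Complex.Gamma x * Complex.sin (Real.pi * x / 2)‖ ≤ 2 * (1 / 2 + |x.im|) := by
  set y := x - 1 with hy
  have hyre : y.re = 1 / 2 := by simp [hy, hx]; norm_num
  have hy0 : y ≠ 0 := by rintro h; rw [h] at hyre; norm_num at hyre
  have hconj : (starRingEnd ℂ) y = 1 - y := by
    apply Complex.ext <;> simp [hyre]; norm_num
  have h1 : ‖Complex.sin (Real.pi * x / 2)‖ = ‖Complex.sin (Real.pi * y / 2)‖ := by
    rw [← Complex.norm_conj (Complex.sin (Real.pi * y / 2)), ← Complex.sin_conj, map_div₀, map_mul,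
      conj_ofReal, hconj, map_ofNat, ← Complex.sin_pi_sub]
    congr 2
    rw [hy]; ring
  have h2 : ‖y‖ ≤ 1 / 2 + |x.im| := by
    have := Complex.norm_le_abs_re_add_abs_im y
    have him : y.im = x.im := by simp [hy]
    rwa [hyre, him, abs_of_pos (by norm_num)] at this
  have h3 := norm_Gamma_mul_sin_half hyre
  rw [show x = y + 1 by simp [hy], Complex.Gamma_add_one _ hy0, norm_mul, norm_mul,
    show (y + 1 : ℂ) = x by simp [hy], h1, mul_assoc, ← norm_mul, mul_comm]
  exact mul_le_mul h3 h2 (norm_nonneg _) (by norm_num)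

/-- Three lines applied to Γ(z) sin(πz/2) exp((z - i Im x)²). The sine compensates the exponential
decay of Γ. The Gaussian, centred at the height of x, makes the function bounded in the strip and
localises the right edge bound near that height. It only increases the modulus at z = x. -/
theorem norm_Gamma_le_base : ∃ K, 0 < K ∧ ∀ x : ℂ, 1 / 2 ≤ x.re → x.re ≤ 3 / 2 →
    ‖Complex.Gamma x‖ * Real.exp (Real.pi / 2 * |x.im|) ≤ K * (1 + ‖x‖) ^ (x.re - 1 / 2) := by
  refine ⟨4 * (1 + 2 * Real.exp 3 * 2), by positivity, fun x h1 h2 => ?_⟩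
  set f : ℂ → ℂ := fun z => Complex.Gamma z * Complex.sin (Real.pi * z / 2) *
    Complex.exp ((z - x.im * I) ^ 2) with hf
  have hexp : ∀ z : ℂ, ‖Complex.exp ((z - x.im * I) ^ 2)‖ =
      Real.exp (z.re ^ 2 - (z.im - x.im) ^ 2) := by
    intro z
    rw [norm_exp]
    congr 1
    simp [sq]
  have hGd : ∀ z : ℂ, 0 < z.re → DifferentiableAt ℂ f z := by
    intro z hz
    have : DifferentiableAt ℂ Complex.Gamma z := by
      refine Complex.differentiableAt_Gamma z fun m h => ?_
      rw [h] at hz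
      simp at hz
      linarith [(Nat.cast_nonneg m : (0 : ℝ) ≤ m)]
    fun_prop
  have hd : DiffContOnCl ℂ f (HadamardThreeLines.verticalStrip (1 / 2) (3 / 2)) := by
    refine DifferentiableOn.diffContOnCl fun z hz => (hGd z ?_).differentiableWithinAt
    rw [HadamardThreeLines.verticalStrip] at hz
    have : z ∈ re ⁻¹' (closure (Ioo (1 / 2 : ℝ) (3 / 2))) :=
      (continuous_re.closure_preimage_subset _) hz
    rw [closure_Ioo (by norm_num)] at this
    exact lt_of_lt_of_le (by norm_num) this.1
  have hGb : ∃ G, 0 ≤ G ∧ ∀ u ∈ Icc (1 / 2 : ℝ) (3 / 2), Real.Gamma u ≤ G := by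
    have hc : ContinuousOn Real.Gamma (Icc (1 / 2 : ℝ) (3 / 2)) := fun u hu =>
      (Real.differentiableAt_Gamma fun m h => by
        have := hu.1
        rw [h] at this
        linarith [(Nat.cast_nonneg m : (0 : ℝ) ≤ m)]).continuousAt.continuousWithinAt
    obtain ⟨G, hG⟩ := isCompact_Icc.exists_bound_of_continuousOn hc
    exact ⟨G, (norm_nonneg _).trans (hG (1 / 2) (by norm_num)),
      fun u hu => (le_abs_self _).trans (hG u hu)⟩
  have hB : BddAbove ((norm ∘ f) '' HadamardThreeLines.verticalClosedStrip (1 / 2) (3 / 2)) := by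
    obtain ⟨G, hG0, hG⟩ := hGb
    refine ⟨G * Real.exp (2 * |x.im| + 4), ?_⟩
    rintro _ ⟨z, hz, rfl⟩
    have hz1 : 1 / 2 ≤ z.re := hz.1
    have hz2 : z.re ≤ 3 / 2 := hz.2
    have e1 := (norm_Gamma_le (s := z) (by linarith)).trans (hG z.re hz)
    have e2 := norm_sin_le_exp (Real.pi * z / 2)
    have him : (Real.pi * z / 2 : ℂ).im = Real.pi / 2 * z.im := by simp; ring
    rw [him, abs_mul, abs_of_pos (by positivity)] at e2
    simp only [Function.comp_apply, hf, norm_mul, hexp]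
    rw [mul_assoc]
    refine mul_le_mul e1 ?_ (by positivity) hG0
    refine (mul_le_mul_of_nonneg_right e2 (Real.exp_pos _).le).trans ?_
    rw [← Real.exp_add]
    refine Real.exp_le_exp.mpr ?_
    have h4 : |z.im| ≤ |x.im| + |z.im - x.im| := by
      have := abs_add_le x.im (z.im - x.im)
      rwa [add_sub_cancel] at this
    rw [← sq_abs (z.im - x.im)]
    have h5 : Real.pi / 2 * |z.im| ≤ 2 * |z.im| :=
      mul_le_mul_of_nonneg_right (by linarith [Real.pi_le_four]) (abs_nonneg _)
    nlinarith [sq_nonneg (|z.im - x.im| - 1)]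
  have hl : ∀ z ∈ re ⁻¹' {(1 / 2 : ℝ)}, ‖f z‖ ≤ 2 * Real.exp 3 := by
    intro z hz
    have hz' : z.re = 1 / 2 := hz
    simp only [hf]
    rw [norm_mul, hexp]
    refine mul_le_mul (norm_Gamma_mul_sin_half hz') (Real.exp_le_exp.mpr ?_) (by positivity)
      (by norm_num)
    rw [hz']
    nlinarith [sq_nonneg (z.im - x.im)]
  have hr : ∀ z ∈ re ⁻¹' {(3 / 2 : ℝ)}, ‖f z‖ ≤ 2 * Real.exp 3 * (2 * (1 + ‖x‖)) := by
    intro z hz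
    have hz' : z.re = 3 / 2 := hz
    simp only [hf]
    rw [norm_mul, hexp, hz']
    have e1 := norm_Gamma_mul_sin_three_half hz'
    have h4 : |z.im| ≤ |x.im| + |z.im - x.im| := by
      have := abs_add_le x.im (z.im - x.im)
      rwa [add_sub_cancel] at this
    have h5 : |x.im| ≤ ‖x‖ := abs_im_le_norm x
    set d := |z.im - x.im| with hd
    have hd0 : 0 ≤ d := abs_nonneg _
    have h6 : Real.exp ((3 / 2) ^ 2 - (z.im - x.im) ^ 2) * (1 + d ^ 2) ≤ Real.exp 3 := by
      calc _ ≤ Real.exp ((3 / 2) ^ 2 - (z.im - x.im) ^ 2) * Real.exp (d ^ 2) := by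
            gcongr
            linarith [Real.add_one_le_exp (d ^ 2)]
        _ = Real.exp ((3 / 2) ^ 2) := by rw [← Real.exp_add, hd, sq_abs]; congr 1; ring
        _ ≤ _ := Real.exp_le_exp.mpr (by norm_num)
    have h7 : 1 / 2 + |z.im| ≤ (1 + d ^ 2) * (2 * (1 + ‖x‖)) := by
      nlinarith [norm_nonneg x, sq_nonneg (d - 1), mul_nonneg (sq_nonneg d) (norm_nonneg x)]
    calc _ ≤ 2 * ((1 + d ^ 2) * (2 * (1 + ‖x‖))) * Real.exp ((3 / 2) ^ 2 - (z.im - x.im) ^ 2) := by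
          refine mul_le_mul_of_nonneg_right (e1.trans ?_) (Real.exp_pos _).le
          linarith
      _ = 2 * (Real.exp ((3 / 2) ^ 2 - (z.im - x.im) ^ 2) * (1 + d ^ 2)) * (2 * (1 + ‖x‖)) := by
          ring
      _ ≤ _ := by gcongr
  have h3 := HadamardThreeLines.norm_le_interp_of_mem_verticalClosedStrip' (z := x)
    (by norm_num) ⟨h1, h2⟩ hd hB hl hr
  have hK : (0 : ℝ) < 2 * Real.exp 3 := by positivity
  have hfx : ‖Complex.Gamma x * Complex.sin (Real.pi * x / 2)‖ ≤ ‖f x‖ := by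
    simp only [hf]
    rw [norm_mul _ (Complex.exp _), hexp, sub_self]
    refine le_mul_of_one_le_right (norm_nonneg _) (Real.one_le_exp ?_)
    nlinarith [sq_nonneg x.re]
  have h8 : ‖f x‖ ≤ 2 * Real.exp 3 * 2 * (1 + ‖x‖) ^ (x.re - 1 / 2) := by
    refine h3.trans ?_
    norm_num only [div_one, sub_self]
    rw [Real.mul_rpow hK.le (by positivity), ← mul_assoc, ← Real.rpow_add hK,
      sub_add_cancel, Real.rpow_one, Real.mul_rpow (by norm_num) (by positivity), ← mul_assoc]
    gcongr
    calc (2 : ℝ) ^ (x.re - 1 / 2) ≤ 2 ^ (1 : ℝ) :=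
          Real.rpow_le_rpow_of_exponent_le (by norm_num) (by linarith)
      _ = 2 := Real.rpow_one _
  have h9 := exp_le_norm_sin h1 h2
  rw [norm_mul] at hfx
  have h10 : 0 ≤ (1 + ‖x‖) ^ (x.re - 1 / 2) := by positivity
  calc _ ≤ ‖Complex.Gamma x‖ * (4 * ‖Complex.sin (Real.pi * x / 2)‖) := by gcongr
    _ = 4 * (‖Complex.Gamma x‖ * ‖Complex.sin (Real.pi * x / 2)‖) := by ring
    _ ≤ 4 * (2 * Real.exp 3 * 2 * (1 + ‖x‖) ^ (x.re - 1 / 2)) := by linarith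
    _ ≤ _ := by nlinarith

/-- Unit steps with Γ(x) = (x-1)Γ(x-1); since |x-1| ≤ |x| for Re x ≥ 1/2, a step costs no constant
and the same K works throughout. -/
theorem norm_Gamma_mul_exp_le : ∃ K, 0 < K ∧ ∀ x : ℂ, 1 / 2 ≤ x.re →
    ‖Complex.Gamma x‖ * Real.exp (Real.pi / 2 * |x.im|) ≤ K * (1 + ‖x‖) ^ (x.re - 1 / 2) := by
  obtain ⟨K, hK, hb⟩ := norm_Gamma_le_base
  refine ⟨K, hK, ?_⟩
  have key : ∀ n : ℕ, ∀ x : ℂ, 1 / 2 ≤ x.re → x.re ≤ n + 3 / 2 →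
      ‖Complex.Gamma x‖ * Real.exp (Real.pi / 2 * |x.im|) ≤
        K * (1 + ‖x‖) ^ (x.re - 1 / 2) := by
    intro n
    induction n with
    | zero => intro x h1 h2; exact hb x h1 (by simpa using h2)
    | succ n ih =>
      intro x h1 h2
      by_cases h3 : x.re ≤ n + 3 / 2
      · exact ih x h1 h3
      · push_cast at h2
        have hn : (0 : ℝ) ≤ n := Nat.cast_nonneg n
        have h4 := ih (x - 1) (by simp; linarith) (by simp; linarith)
        have h5 : x - 1 ≠ 0 := fun h => by
          have := congrArg re h
          simp at this
          linarith
        have h6 : ‖x - 1‖ ≤ ‖x‖ := by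
          refine le_of_sq_le_sq ?_ (norm_nonneg _)
          rw [← normSq_eq_norm_sq, ← normSq_eq_norm_sq, normSq_apply, normSq_apply]
          simp
          nlinarith
        have him : (x - 1).im = x.im := by simp
        have hre : (x - 1).re = x.re - 1 := by simp
        rw [him, hre] at h4
        have h7 : Complex.Gamma x = (x - 1) * Complex.Gamma (x - 1) := by
          rw [← Complex.Gamma_add_one _ h5, sub_add_cancel]
        rw [h7, norm_mul, mul_assoc]
        calc _ ≤ (1 + ‖x‖) * (K * (1 + ‖x‖) ^ (x.re - 1 - 1 / 2)) := by
              refine mul_le_mul (by linarith) (h4.trans ?_) (by positivity) (by positivity)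
              gcongr
              linarith
          _ = K * (1 + ‖x‖) ^ (x.re - 1 / 2) := by
              rw [show x.re - 1 / 2 = 1 + (x.re - 1 - 1 / 2) by ring,
                Real.rpow_add (by positivity), Real.rpow_one]
              ring
  intro x hx
  obtain ⟨n, hn⟩ := exists_nat_ge x.re
  exact key n x hx (by linarith)

end DoubleDirichlet

/-! ### Lower Stirling bounds. -/

namespace DoubleDirichlet

open Complex Filter Topology Set

/-- The reflection formula Γ(x)Γ(2-x) sin(πx) = π(1-x) converts the upper bound at 2 - x into a
lower bound at x. For |Im x| ≤ 1 compactness and the continuity of 1/Γ suffice. -/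
theorem Gamma_lower_base : ∃ K, 0 < K ∧ ∀ x : ℂ, 1 / 2 ≤ x.re → x.re ≤ 3 / 2 →
    (1 + ‖x‖) ^ (x.re - 1 / 2) ≤ K * (‖Complex.Gamma x‖ * Real.exp (Real.pi / 2 * |x.im|)) := by
  obtain ⟨K, hK, hb⟩ := norm_Gamma_mul_exp_le
  have hc : IsCompact (Icc (1 / 2 : ℝ) (3 / 2) ×ℂ Icc (-1 : ℝ) 1) :=
    isCompact_Icc.reProdIm isCompact_Icc
  obtain ⟨G, hG⟩ := hc.exists_bound_of_continuousOn
    (Complex.differentiable_one_div_Gamma.continuous.continuousOn)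
  refine ⟨16 * K + 4 * |G|, by positivity, fun x h1 h2 => ?_⟩
  set E := Real.exp (Real.pi / 2 * |x.im|) with hE
  have hE1 : 1 ≤ E := Real.one_le_exp (by positivity)
  have hre : |x.re| ≤ 3 / 2 := by rw [abs_of_nonneg (by linarith)]; exact h2
  have hG0 : Complex.Gamma x ≠ 0 := Complex.Gamma_ne_zero_of_re_pos (by linarith)
  have hpos : 0 < ‖Complex.Gamma x‖ := norm_pos_iff.mpr hG0
  have hxn := Complex.norm_le_abs_re_add_abs_im x
  by_cases hv : |x.im| ≤ 1
  · have h3 := hG x (by rw [mem_reProdIm]; exact ⟨⟨h1, h2⟩, abs_le.mp hv⟩)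
    have h4 : ‖(Complex.Gamma x)⁻¹‖ ≤ |G| := h3.trans (le_abs_self _)
    rw [norm_inv, inv_le_iff_one_le_mul₀ hpos] at h4
    have h5 : (1 + ‖x‖) ^ (x.re - 1 / 2) ≤ 4 := by
      calc (1 + ‖x‖) ^ (x.re - 1 / 2) ≤ (1 + ‖x‖) ^ (1 : ℝ) :=
            Real.rpow_le_rpow_of_exponent_le (by linarith [norm_nonneg x]) (by linarith)
        _ ≤ 4 := by rw [Real.rpow_one]; linarith
    have h6 : ‖Complex.Gamma x‖ ≤ ‖Complex.Gamma x‖ * E := le_mul_of_one_le_right hpos.le hE1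
    have h7 : |G| * ‖Complex.Gamma x‖ ≤ |G| * (‖Complex.Gamma x‖ * E) :=
      mul_le_mul_of_nonneg_left h6 (abs_nonneg _)
    have h8 : 0 ≤ K * (‖Complex.Gamma x‖ * E) := by positivity
    nlinarith
  · push Not at hv
    have hx1 : 1 - x ≠ 0 := fun h => by
      have := congrArg im h
      simp at this
      rw [this] at hv
      simp at hv
      linarith
    have h3 : Complex.Gamma x * Complex.Gamma (2 - x) * Complex.sin (Real.pi * x) =
        (1 - x) * Real.pi := by
      have hsin : Complex.sin (Real.pi * x) ≠ 0 := by
        rw [Complex.sin_ne_zero_iff]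
        intro k hk
        have := congrArg im hk
        simp [Real.pi_ne_zero] at this
        rw [this] at hv
        simp at hv
        linarith
      rw [show (2 - x : ℂ) = (1 - x) + 1 by ring, Complex.Gamma_add_one _ hx1,
        mul_left_comm, Complex.Gamma_mul_Gamma_one_sub, mul_assoc, div_mul_cancel₀ _ hsin]
    have h4 := hb (2 - x) (by simp; linarith)
    have him : (2 - x).im = -x.im := by simp
    have hre2 : (2 - x).re = 2 - x.re := by simp
    rw [him, abs_neg, hre2, ← hE] at h4
    have h5 := norm_sin_le_exp (Real.pi * x)
    have him2 : (Real.pi * x : ℂ).im = Real.pi * x.im := by simp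
    have h6 : Real.exp |Real.pi * x.im| = E * E := by
      rw [hE, ← Real.exp_add, abs_mul, abs_of_pos Real.pi_pos]
      congr 1; ring
    rw [him2, h6] at h5
    have h7 := congrArg norm h3
    rw [norm_mul, norm_mul, norm_mul, norm_real, Real.norm_of_nonneg Real.pi_pos.le] at h7
    have h8 : |x.im| ≤ ‖1 - x‖ := by
      have := abs_im_le_norm (1 - x)
      simpa using this
    have h9 : 1 + ‖x‖ ≤ 4 * ‖1 - x‖ := by linarith
    have h10 : 1 + ‖2 - x‖ ≤ 4 * ‖1 - x‖ := by
      have : ‖(2 : ℂ) - x‖ ≤ ‖(1 : ℂ)‖ + ‖1 - x‖ := by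
        refine le_trans (le_of_eq ?_) (norm_add_le _ _)
        congr 1; ring
      rw [norm_one] at this
      linarith
    set T := ‖1 - x‖ with hT
    have hT0 : 0 < T := norm_pos_iff.mpr hx1
    have h11 : T ≤ ‖Complex.Gamma x‖ * E * (K * (1 + ‖2 - x‖) ^ (2 - x.re - 1 / 2)) := by
      calc T ≤ T * Real.pi := le_mul_of_one_le_right hT0.le (by linarith [Real.pi_gt_three])
        _ = ‖Complex.Gamma x‖ * ‖Complex.Gamma (2 - x)‖ * ‖Complex.sin (Real.pi * x)‖ := h7.symm
        _ ≤ ‖Complex.Gamma x‖ * ‖Complex.Gamma (2 - x)‖ * (E * E) := by gcongr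
        _ = ‖Complex.Gamma x‖ * E * (‖Complex.Gamma (2 - x)‖ * E) := by ring
        _ ≤ _ := by gcongr
    have h12 : (1 + ‖2 - x‖) ^ (2 - x.re - 1 / 2) ≤ (4 * T) ^ (2 - x.re - 1 / 2) :=
      Real.rpow_le_rpow (by positivity) h10 (by linarith)
    have h13 : (1 + ‖x‖) ^ (x.re - 1 / 2) ≤ (4 * T) ^ (x.re - 1 / 2) :=
      Real.rpow_le_rpow (by positivity) h9 (by linarith)
    have h14 : (4 * T) ^ (2 - x.re - 1 / 2) * (4 * T) ^ (x.re - 1 / 2) = 4 * T := by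
      rw [← Real.rpow_add (by positivity), show 2 - x.re - 1 / 2 + (x.re - 1 / 2) = 1 by ring,
        Real.rpow_one]
    set a := (4 * T) ^ (2 - x.re - 1 / 2)
    set b := (4 * T) ^ (x.re - 1 / 2)
    have ha : 0 < a := by positivity
    have h15 : T * b ≤ ‖Complex.Gamma x‖ * E * K * (4 * T) := by
      rw [← h14]
      have h16 : T ≤ ‖Complex.Gamma x‖ * E * K * a := by
        refine h11.trans ?_
        rw [← mul_assoc]
        gcongr
      have hb0 : 0 ≤ b := by positivity
      nlinarith
    have h17 : b ≤ 4 * K * (‖Complex.Gamma x‖ * E) := by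
      have := le_of_mul_le_mul_left (show T * b ≤ T * (4 * K * (‖Complex.Gamma x‖ * E)) by
        linarith) hT0
      exact this
    have h18 : 0 ≤ |G| * (‖Complex.Gamma x‖ * E) := by positivity
    have h19 : 0 ≤ K * (‖Complex.Gamma x‖ * E) := by positivity
    nlinarith

/-- Since the exponent is at most 1 + |y|, replacing 1 + |y| by 2 + |y| in the base costs at most a
factor e < 3. -/
theorem rpow_shift_le {y : ℂ} (h : 1 / 2 ≤ y.re) :
    (1 + ‖y + 1‖) ^ (y.re + 1 / 2) ≤ 3 * (2 + ‖y‖) * (1 + ‖y‖) ^ (y.re - 1 / 2) := by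
  have h1 : 1 + ‖y + 1‖ ≤ 2 + ‖y‖ := by
    have := norm_add_le y 1
    rw [norm_one] at this
    linarith
  have hy := norm_nonneg y
  have h2 : (2 + ‖y‖) ^ (y.re - 1 / 2) ≤ 3 * (1 + ‖y‖) ^ (y.re - 1 / 2) := by
    have h3 : 2 + ‖y‖ ≤ Real.exp (1 / (1 + ‖y‖)) * (1 + ‖y‖) := by
      have h4 := Real.add_one_le_exp (1 / (1 + ‖y‖))
      calc 2 + ‖y‖ = (1 / (1 + ‖y‖) + 1) * (1 + ‖y‖) := by field_simp; ring
        _ ≤ _ := by gcongr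
    calc _ ≤ (Real.exp (1 / (1 + ‖y‖)) * (1 + ‖y‖)) ^ (y.re - 1 / 2) :=
          Real.rpow_le_rpow (by positivity) h3 (by linarith)
      _ = Real.exp (1 / (1 + ‖y‖) * (y.re - 1 / 2)) * (1 + ‖y‖) ^ (y.re - 1 / 2) := by
          rw [Real.mul_rpow (Real.exp_pos _).le (by positivity), ← Real.exp_mul]
      _ ≤ _ := by
          gcongr
          calc _ ≤ Real.exp 1 := by
                refine Real.exp_le_exp.mpr ?_
                rw [one_div_mul_eq_div, div_le_one (by positivity)]
                have := re_le_norm y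
                linarith
            _ ≤ 3 := Real.exp_one_lt_three.le
  calc _ ≤ (2 + ‖y‖) ^ (y.re + 1 / 2) := Real.rpow_le_rpow (by positivity) h1 (by linarith)
    _ = (2 + ‖y‖) * (2 + ‖y‖) ^ (y.re - 1 / 2) := by
        rw [show y.re + 1 / 2 = 1 + (y.re - 1 / 2) by ring, Real.rpow_add (by positivity),
          Real.rpow_one]
    _ ≤ (2 + ‖y‖) * (3 * (1 + ‖y‖) ^ (y.re - 1 / 2)) := by gcongr
    _ = _ := by ring

/-- One step of the recursion loses 3(2+|y|)/|y|. This is at most 7 once |y| ≥ 3/2, whence the power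
of 7, and at most 15 for |y| ≥ 1/2, which happens once. Growth like 7^{Re x} is affordable because
7·2π < 16π. -/
theorem Gamma_lower_bound : ∃ K, 0 < K ∧ ∀ x : ℂ, 1 / 2 ≤ x.re →
    (1 + ‖x‖) ^ (x.re - 1 / 2) ≤
      K * 7 ^ x.re * (‖Complex.Gamma x‖ * Real.exp (Real.pi / 2 * |x.im|)) := by
  obtain ⟨K, hK, hb⟩ := Gamma_lower_base
  refine ⟨15 * K, by positivity, ?_⟩
  have step : ∀ y : ℂ, 1 / 2 ≤ y.re → ∀ A B : ℝ, 0 ≤ A → 3 * (2 + ‖y‖) ≤ B * ‖y‖ →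
      (1 + ‖y‖) ^ (y.re - 1 / 2) ≤
        A * (‖Complex.Gamma y‖ * Real.exp (Real.pi / 2 * |y.im|)) →
      (1 + ‖y + 1‖) ^ (y.re + 1 / 2) ≤
        B * A * (‖Complex.Gamma (y + 1)‖ * Real.exp (Real.pi / 2 * |y.im|)) := by
    intro y hy A B hA hB h
    have hy0 : y ≠ 0 := by rintro rfl; simp at hy; linarith
    rw [Complex.Gamma_add_one _ hy0, norm_mul]
    calc _ ≤ 3 * (2 + ‖y‖) * (1 + ‖y‖) ^ (y.re - 1 / 2) := rpow_shift_le hy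
      _ ≤ (B * ‖y‖) * (A * (‖Complex.Gamma y‖ * Real.exp (Real.pi / 2 * |y.im|))) := by
          refine mul_le_mul hB h (by positivity) (le_trans (by positivity) hB)
      _ = _ := by ring
  have key : ∀ n : ℕ, ∀ x : ℂ, 1 / 2 ≤ x.re → x.re ≤ n + 5 / 2 →
      (1 + ‖x‖) ^ (x.re - 1 / 2) ≤
      15 * K * 7 ^ x.re * (‖Complex.Gamma x‖ * Real.exp (Real.pi / 2 * |x.im|)) := by
    intro n
    induction n with
    | zero =>
      intro x h1 h2
      have h7 : (1 : ℝ) ≤ 7 ^ x.re := Real.one_le_rpow (by norm_num) (by linarith)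
      set W := ‖Complex.Gamma x‖ * Real.exp (Real.pi / 2 * |x.im|) with hW
      have hW0 : 0 ≤ W := by positivity
      have hWK : K * W ≤ K * W * 7 ^ x.re := le_mul_of_one_le_right (by positivity) h7
      by_cases h3 : x.re ≤ 3 / 2
      · have h4 := hb x h1 h3
        rw [← hW] at h4
        have : 0 ≤ K * W := by positivity
        linarith
      · push Not at h3
        have hr : (x - 1).re = x.re - 1 := by simp
        have hi : (x - 1).im = x.im := by simp
        have hn : 1 / 2 ≤ ‖x - 1‖ := by
          have := re_le_norm (x - 1)
          rw [hr] at this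
          linarith
        have h4 := step (x - 1) (by rw [hr]; linarith) K 15 hK.le (by linarith)
          (hb _ (by rw [hr]; linarith) (by rw [hr]; norm_num at h2; linarith))
        rw [sub_add_cancel, hr, hi, ← hW] at h4
        rw [show x.re - 1 / 2 = x.re - 1 + 1 / 2 by ring]
        linarith
    | succ n ih =>
      intro x h1 h2
      by_cases h3 : x.re ≤ n + 5 / 2
      · exact ih x h1 h3
      · push Not at h3
        push_cast at h2
        have hn0 : (0 : ℝ) ≤ n := Nat.cast_nonneg n
        have hr : (x - 1).re = x.re - 1 := by simp
        have hi : (x - 1).im = x.im := by simp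
        have hn : 3 / 2 ≤ ‖x - 1‖ := by
          have := re_le_norm (x - 1)
          rw [hr] at this
          linarith
        have h4 := step (x - 1) (by rw [hr]; linarith) (15 * K * 7 ^ (x - 1).re) 7 (by positivity)
          (by linarith) (ih _ (by rw [hr]; linarith) (by rw [hr]; linarith))
        rw [sub_add_cancel, hr, hi] at h4
        rw [show x.re - 1 / 2 = x.re - 1 + 1 / 2 by ring]
        refine h4.trans (le_of_eq ?_)
        have : (7 : ℝ) ^ x.re = 7 * 7 ^ (x.re - 1) := by
          rw [← Real.rpow_one_add' (by norm_num) (by linarith)]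
          congr 1; ring
        rw [this]; ring
  intro x hx
  obtain ⟨n, hn⟩ := exists_nat_ge x.re
  exact key n x hx (by linarith)

/-! ### Lower bounds away from zeros -/

/-- If exp z were close to 1, its principal logarithm would be small; but that logarithm differs
from z by a period 2πik. -/
theorem norm_one_sub_exp_ge {δ : ℝ} {z : ℂ} (h : ∀ k : ℤ, δ ≤ ‖z - k * (2 * Real.pi * I)‖) :
    min (1 / 2) (2 / 3 * δ) ≤ ‖1 - Complex.exp z‖ := by
  by_contra! hlt
  rw [lt_min_iff] at hlt
  have h1 : ‖Complex.exp z - 1‖ ≤ 1 / 2 := by rw [norm_sub_rev]; exact hlt.1.le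
  have h2 := norm_log_one_add_half_le_self h1
  rw [add_sub_cancel] at h2
  obtain ⟨k, hk⟩ := Complex.exp_eq_exp_iff_exists_int.mp (Complex.exp_log (Complex.exp_ne_zero z))
  have h3 := h (-k)
  rw [show z - ((-k : ℤ) : ℂ) * (2 * Real.pi * I) = Complex.log (Complex.exp z) by
    rw [hk]; push_cast; ring] at h3
  rw [norm_sub_rev] at h2
  linarith [hlt.2]

theorem norm_one_sub_exp_ge_max {δ : ℝ} {z : ℂ}
    (h : ∀ k : ℤ, δ ≤ ‖z - k * (2 * Real.pi * I)‖) :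
    min (1 / 2) (2 / 3 * δ) * max 1 ‖Complex.exp z‖ ≤ ‖1 - Complex.exp z‖ := by
  have h1 := norm_one_sub_exp_ge h
  rcases le_total 1 ‖Complex.exp z‖ with hm | hm
  · rw [max_eq_right hm]
    have h2 : ∀ k : ℤ, δ ≤ ‖-z - k * (2 * Real.pi * I)‖ := by
      intro k
      have := h (-k)
      rwa [← norm_neg, show -(z - ((-k : ℤ) : ℂ) * (2 * Real.pi * I)) =
        -z - k * (2 * Real.pi * I) by push_cast; ring] at this
    have h3 := norm_one_sub_exp_ge h2
    calc _ ≤ ‖1 - Complex.exp (-z)‖ * ‖Complex.exp z‖ := by gcongr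
      _ = ‖1 - Complex.exp z‖ := by
        rw [← norm_mul, sub_mul, ← Complex.exp_add, neg_add_cancel, Complex.exp_zero, one_mul,
          norm_sub_rev]
  · rwa [max_eq_left hm, mul_one]

theorem norm_cos_half_ge {δ : ℝ} (hδ : 0 < δ) {w : ℂ} (h : ∀ k : ℤ, δ ≤ ‖w - k‖) :
    min (1 / 2) (2 / 3 * δ) / 2 * Real.exp (Real.pi / 2 * |w.im|) ≤
      ‖Complex.cos (Real.pi * w / 2)‖ := by
  have h1 := norm_one_sub_exp_ge_max (z := Real.pi * (w + 1) * I) fun k => by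
    have : (Real.pi * (w + 1) * I - k * (2 * Real.pi * I) : ℂ) =
        (w - ((2 * k - 1 : ℤ) : ℂ)) * (Real.pi * I) := by push_cast; ring
    rw [this, norm_mul, norm_mul, norm_I, mul_one, norm_real, Real.norm_of_nonneg Real.pi_pos.le]
    exact (h _).trans (le_mul_of_one_le_right (norm_nonneg _) (by linarith [Real.pi_gt_three]))
  have h2 : Complex.cos (Real.pi * w / 2) = Complex.exp (-(Real.pi * w / 2) * I) *
      (1 - Complex.exp (Real.pi * (w + 1) * I)) / 2 := by
    rw [Complex.cos, mul_sub, mul_one, ← Complex.exp_add,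
      show (-(Real.pi * w / 2) * I + Real.pi * (w + 1) * I : ℂ) =
        Real.pi * w / 2 * I + Real.pi * I by ring, Complex.exp_add, Complex.exp_pi_mul_I]
    ring
  have h3 : ‖Complex.exp (-(Real.pi * w / 2) * I)‖ = Real.exp (Real.pi / 2 * w.im) := by
    rw [norm_exp]
    congr 1
    simp
    ring
  have h4 : ‖Complex.exp (Real.pi * (w + 1) * I)‖ = Real.exp (-(Real.pi * w.im)) := by
    rw [norm_exp]
    congr 1
    simp
  rw [h4] at h1
  rw [h2, norm_div, norm_mul, h3, Complex.norm_two]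
  set c := min (1 / 2) (2 / 3 * δ) with hc
  have hc0 : 0 < c := by positivity
  have h5 : Real.exp (Real.pi / 2 * |w.im|) ≤
      Real.exp (Real.pi / 2 * w.im) * max 1 (Real.exp (-(Real.pi * w.im))) := by
    rcases abs_cases w.im with ⟨ha, _⟩ | ⟨ha, _⟩
    · rw [ha]
      exact le_mul_of_one_le_right (Real.exp_pos _).le (le_max_left _ _)
    · rw [ha]
      refine le_trans (le_of_eq ?_)
        (mul_le_mul_of_nonneg_left (le_max_right _ _) (Real.exp_pos _).le)
      rw [← Real.exp_add]
      congr 1; ring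
  have h6 := Real.exp_pos (Real.pi / 2 * w.im)
  calc _ ≤ c / 2 * (Real.exp (Real.pi / 2 * w.im) * max 1 (Real.exp (-(Real.pi * w.im)))) := by
        gcongr
    _ = Real.exp (Real.pi / 2 * w.im) * (c * max 1 (Real.exp (-(Real.pi * w.im)))) / 2 := by ring
    _ ≤ _ := by gcongr

theorem norm_sin_half_ge {δ : ℝ} (hδ : 0 < δ) {w : ℂ} (h : ∀ k : ℤ, δ ≤ ‖w - k‖) :
    min (1 / 2) (2 / 3 * δ) / 2 * Real.exp (Real.pi / 2 * |w.im|) ≤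
      ‖Complex.sin (Real.pi * w / 2)‖ := by
  have h1 := norm_cos_half_ge hδ (w := w - 1) fun k => by
    have := h (k + 1)
    rwa [show w - ((k + 1 : ℤ) : ℂ) = w - 1 - k by push_cast; ring] at this
  rw [← Complex.cos_sub_pi_div_two]
  rwa [sub_im, one_im, sub_zero,
    show Real.pi * (w - 1) / 2 = Real.pi * w / 2 - (Real.pi : ℂ) / 2 by ring] at h1

end DoubleDirichlet

namespace DoubleDirichlet

open Complex Filter Topology Set

/-! ### The gamma quotients -/

theorem gammaEven_eq_inv {w : ℂ} (hw : 0 < w.re) :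
    gammaEven w = (Gammaℂ w * Complex.cos (Real.pi * w / 2))⁻¹ := by
  have h := inv_Gammaℝ_one_sub (s := w) fun n h => by
    rw [h] at hw; simp at hw; linarith [(Nat.cast_nonneg n : (0 : ℝ) ≤ n)]
  have h0 := Gammaℝ_ne_zero_of_re_pos hw
  rw [gammaEven, ← inv_inj, inv_inv, mul_inv, inv_inv, h, mul_assoc, inv_mul_cancel₀ h0, mul_one]

theorem gammaOdd_eq_inv {w : ℂ} (hw : 0 < w.re) :
    gammaOdd w = (Gammaℂ w * Complex.sin (Real.pi * w / 2))⁻¹ := by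
  have h := inv_Gammaℝ_two_sub (s := w) fun n h => by
    rw [h] at hw; simp at hw; linarith [(Nat.cast_nonneg n : (0 : ℝ) ≤ n)]
  have h0 := Gammaℝ_ne_zero_of_re_pos (s := w + 1) (by simp; linarith)
  rw [gammaOdd, ← inv_inj, inv_inv, mul_inv, inv_inv, h, mul_assoc, inv_mul_cancel₀ h0, mul_one]

theorem gammaEven_eq_mul {w : ℂ} (hw : w.re < 1) :
    gammaEven w = Gammaℂ (1 - w) * Complex.cos (Real.pi * (1 - w) / 2) := by
  have h := inv_Gammaℝ_one_sub (s := 1 - w) fun n h => by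
    have h' := congrArg re h
    simp at h'; linarith [(Nat.cast_nonneg n : (0 : ℝ) ≤ n)]
  have h0 := Gammaℝ_ne_zero_of_re_pos (s := 1 - w) (by simp; linarith)
  rw [sub_sub_cancel] at h
  rw [gammaEven, h, mul_left_comm, mul_inv_cancel₀ h0, mul_one]

theorem gammaOdd_eq_mul {w : ℂ} (hw : w.re < 1) :
    gammaOdd w = Gammaℂ (1 - w) * Complex.sin (Real.pi * (1 - w) / 2) := by
  have h := inv_Gammaℝ_two_sub (s := 1 - w) fun n h => by
    have h' := congrArg re h
    simp at h'; linarith [(Nat.cast_nonneg n : (0 : ℝ) ≤ n)]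
  have h0 := Gammaℝ_ne_zero_of_re_pos (s := 2 - w) (by simp; linarith)
  rw [show 2 - (1 - w) = w + 1 by ring, show 1 - w + 1 = 2 - w by ring] at h
  rw [gammaOdd, h, mul_left_comm, mul_inv_cancel₀ h0, mul_one]

theorem analyticAt_Gammaℝ {w : ℂ} (hw : Gammaℝ w ≠ 0) : AnalyticAt ℂ Gammaℝ w := by
  have h := (differentiable_Gammaℝ_inv.analyticAt w).inv (inv_ne_zero hw)
  have h2 : (fun z => (Gammaℝ z)⁻¹)⁻¹ = Gammaℝ := by ext z; simp
  rwa [h2] at h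

theorem norm_Gammaℂ (w : ℂ) :
    ‖Gammaℂ w‖ = 2 * ((2 * Real.pi) ^ w.re)⁻¹ * ‖Complex.Gamma w‖ := by
  have : ((2 : ℂ) * Real.pi) = ((2 * Real.pi : ℝ) : ℂ) := by push_cast; rfl
  rw [Gammaℂ_def, norm_mul, norm_mul, Complex.norm_two, this,
    norm_cpow_eq_rpow_re_of_pos (by positivity), neg_re, Real.rpow_neg (by positivity)]

/-- To the left the quotients are products Γ_ℂ(1-w)·cos or sin, and the growth of the trigonometric
factor is exactly absorbed by the exponential decay of Γ. No distance to poles is needed. -/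
theorem norm_gamma_left_le : ∃ K, 0 < K ∧ ∀ w : ℂ, w.re ≤ 1 / 2 →
    ‖gammaEven w‖ ≤ K * 2 ^ |w.re| * (1 + ‖w‖) ^ (1 / 2 - w.re) ∧
    ‖gammaOdd w‖ ≤ K * 2 ^ |w.re| * (1 + ‖w‖) ^ (1 / 2 - w.re) := by
  obtain ⟨K, hK, hb⟩ := norm_Gamma_mul_exp_le
  refine ⟨4 * K, by positivity, fun w hw => ?_⟩
  have hre : (1 - w).re = 1 - w.re := by simp
  have him : |(1 - w).im| = |w.im| := by simp
  have h1 := hb (1 - w) (by rw [hre]; linarith)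
  rw [hre, him] at h1
  have him2 : |(Real.pi * (1 - w) / 2 : ℂ).im| = Real.pi / 2 * |w.im| := by
    rw [show (Real.pi * (1 - w) / 2 : ℂ).im = Real.pi / 2 * (-w.im) by simp; ring, abs_mul,
      abs_neg, abs_of_pos (by positivity)]
  have h2 : ‖1 - w‖ ≤ 1 + ‖w‖ := by simpa using norm_sub_le 1 w
  have hpi : 1 ≤ (2 * Real.pi) ^ (1 - w.re) :=
    Real.one_le_rpow (by linarith [Real.pi_gt_three]) (by linarith)
  have key : ∀ t : ℂ, ‖t‖ ≤ Real.exp (Real.pi / 2 * |w.im|) →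
      ‖Gammaℂ (1 - w) * t‖ ≤ 4 * K * 2 ^ |w.re| * (1 + ‖w‖) ^ (1 / 2 - w.re) := by
    intro t ht
    rw [norm_mul, norm_Gammaℂ, hre]
    calc _ ≤ 2 * 1 * ‖Complex.Gamma (1 - w)‖ * Real.exp (Real.pi / 2 * |w.im|) := by
          gcongr
          exact inv_le_one_of_one_le₀ hpi
      _ ≤ 2 * (K * (1 + ‖1 - w‖) ^ (1 - w.re - 1 / 2)) := by linarith
      _ ≤ 2 * (K * (2 * (1 + ‖w‖)) ^ (1 - w.re - 1 / 2)) := by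
          gcongr
          · linarith
          · linarith [norm_nonneg w]
      _ = 2 * K * 2 ^ (1 / 2 - w.re) * (1 + ‖w‖) ^ (1 / 2 - w.re) := by
          rw [show 1 - w.re - 1 / 2 = 1 / 2 - w.re by ring,
            Real.mul_rpow (by norm_num) (by positivity)]
          ring
      _ ≤ 2 * K * (2 * 2 ^ |w.re|) * (1 + ‖w‖) ^ (1 / 2 - w.re) := by
          gcongr
          calc (2 : ℝ) ^ (1 / 2 - w.re) ≤ 2 ^ (1 + |w.re|) :=
                Real.rpow_le_rpow_of_exponent_le (by norm_num) (by linarith [neg_abs_le w.re])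
            _ = 2 * 2 ^ |w.re| := by rw [Real.rpow_add (by norm_num), Real.rpow_one]
      _ = _ := by ring
  refine ⟨?_, ?_⟩
  · rw [gammaEven_eq_mul (by linarith)]
    exact key _ (by rw [← him2]; exact norm_cos_le_exp _)
  · rw [gammaOdd_eq_mul (by linarith)]
    exact key _ (by rw [← him2]; exact norm_sin_le_exp _)

/-- To the right the quotients are reciprocals of Γ_ℂ(w)·cos or sin, so lower bounds for Γ and, away
from the integers, for the trigonometric factor are required. -/
theorem norm_gamma_right_le {δ : ℝ} (hδ : 0 < δ) : ∃ K, 0 < K ∧ ∀ w : ℂ, 1 / 2 ≤ w.re →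
    (∀ k : ℤ, δ ≤ ‖w - k‖) →
    ‖gammaEven w‖ ≤ K * (16 * Real.pi) ^ |w.re| * (1 + ‖w‖) ^ (1 / 2 - w.re) ∧
    ‖gammaOdd w‖ ≤ K * (16 * Real.pi) ^ |w.re| * (1 + ‖w‖) ^ (1 / 2 - w.re) := by
  obtain ⟨K, hK, hb⟩ := Gamma_lower_bound
  set c := min (1 / 2) (2 / 3 * δ) / 2 with hc
  have hc0 : 0 < c := by positivity
  refine ⟨K / c, by positivity, fun w hw hdist => ?_⟩
  have h1 := hb w hw
  have key : ∀ t : ℂ, c * Real.exp (Real.pi / 2 * |w.im|) ≤ ‖t‖ →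
      ‖(Gammaℂ w * t)⁻¹‖ ≤ K / c * (16 * Real.pi) ^ |w.re| * (1 + ‖w‖) ^ (1 / 2 - w.re) := by
    intro t ht
    have hG : 0 < ‖Complex.Gamma w‖ :=
      norm_pos_iff.mpr (Complex.Gamma_ne_zero_of_re_pos (by linarith))
    have ht0 : 0 < ‖t‖ := lt_of_lt_of_le (by positivity) ht
    have hP : (0 : ℝ) < (2 * Real.pi) ^ w.re := by positivity
    have hQ : (0 : ℝ) < (1 + ‖w‖) ^ (w.re - 1 / 2) := by positivity
    rw [norm_inv, norm_mul, norm_Gammaℂ, show 1 / 2 - w.re = -(w.re - 1 / 2) by ring,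
      Real.rpow_neg (by positivity), inv_le_iff_one_le_mul₀ (by positivity), abs_of_nonneg
        (by linarith)]
    have h2 : (1 + ‖w‖) ^ (w.re - 1 / 2) ≤ K * 7 ^ w.re * (‖Complex.Gamma w‖ * (‖t‖ / c)) := by
      refine h1.trans ?_
      gcongr
      rw [le_div_iff₀ hc0]
      linarith
    -- The base 16π of the final bound has room for the 7 lost in the Gamma bound: 7·2π = 14π.
    have h3 : (7 : ℝ) ^ w.re * (2 * Real.pi) ^ w.re ≤ (16 * Real.pi) ^ w.re := by
      rw [← Real.mul_rpow (by norm_num) (by positivity)]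
      exact Real.rpow_le_rpow (by positivity) (by linarith [Real.pi_pos]) (by linarith)
    have h4 : (7 : ℝ) ^ w.re ≤ (16 * Real.pi) ^ w.re * ((2 * Real.pi) ^ w.re)⁻¹ := by
      rwa [← div_eq_mul_inv, le_div_iff₀ hP]
    calc (1 : ℝ) = (1 + ‖w‖) ^ (w.re - 1 / 2) * ((1 + ‖w‖) ^ (w.re - 1 / 2))⁻¹ := by
          rw [mul_inv_cancel₀ hQ.ne']
      _ ≤ (K * ((16 * Real.pi) ^ w.re * ((2 * Real.pi) ^ w.re)⁻¹) *
          (‖Complex.Gamma w‖ * (‖t‖ / c))) * ((1 + ‖w‖) ^ (w.re - 1 / 2))⁻¹ := by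
          refine mul_le_mul_of_nonneg_right (h2.trans ?_) (by positivity)
          gcongr
      _ ≤ 2 * ((K * ((16 * Real.pi) ^ w.re * ((2 * Real.pi) ^ w.re)⁻¹) *
          (‖Complex.Gamma w‖ * (‖t‖ / c))) * ((1 + ‖w‖) ^ (w.re - 1 / 2))⁻¹) := by
          refine le_mul_of_one_le_left (by positivity) (by norm_num)
      _ = _ := by field_simp
  refine ⟨?_, ?_⟩
  · rw [gammaEven_eq_inv (by linarith)]
    exact key _ (norm_cos_half_ge hδ hdist)
  · rw [gammaOdd_eq_inv (by linarith)]
    exact key _ (norm_sin_half_ge hδ hdist)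

theorem analyticAt_gammaEven {w : ℂ} (hw : ∀ m : ℕ, 0 < m → w ≠ m) :
    AnalyticAt ℂ gammaEven w := by
  have h1 : AnalyticAt ℂ (fun z => Gammaℝ (1 - z)) w := by
    refine (analyticAt_Gammaℝ (w := 1 - w) ?_).comp_of_eq (by fun_prop) rfl
    rw [Ne, Gammaℝ_eq_zero_iff]
    rintro ⟨n, hn⟩
    refine hw (2 * n + 1) (by omega) ?_
    push_cast
    linear_combination -hn
  exact h1.mul (differentiable_Gammaℝ_inv.analyticAt w)

theorem analyticAt_gammaOdd {w : ℂ} (hw : ∀ m : ℕ, 0 < m → w ≠ m) :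
    AnalyticAt ℂ gammaOdd w := by
  have h1 : AnalyticAt ℂ (fun z => Gammaℝ (2 - z)) w := by
    refine (analyticAt_Gammaℝ (w := 2 - w) ?_).comp_of_eq (by fun_prop) rfl
    rw [Ne, Gammaℝ_eq_zero_iff]
    rintro ⟨n, hn⟩
    refine hw (2 * n + 2) (by omega) ?_
    push_cast
    linear_combination -hn
  exact h1.mul ((differentiable_Gammaℝ_inv.comp (differentiable_id.add_const 1)).analyticAt w)

theorem meromorphicAt_gammaEven (w : ℂ) : MeromorphicAt gammaEven w := by
  have h : MeromorphicAt (fun z => Gammaℝ (1 - z)) w := by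
    have h1 := (differentiable_Gammaℝ_inv.comp (f := fun z : ℂ => 1 - z)
      (by fun_prop)).analyticAt w |>.meromorphicAt.inv
    have h2 : ((fun z => (Gammaℝ z)⁻¹) ∘ fun z : ℂ => 1 - z)⁻¹ = fun z => Gammaℝ (1 - z) := by
      ext z; simp
    rwa [h2] at h1
  exact h.mul (differentiable_Gammaℝ_inv.analyticAt w).meromorphicAt

theorem meromorphicAt_gammaOdd (w : ℂ) : MeromorphicAt gammaOdd w := by
  have h : MeromorphicAt (fun z => Gammaℝ (2 - z)) w := by
    have h1 := (differentiable_Gammaℝ_inv.comp (f := fun z : ℂ => 2 - z)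
      (by fun_prop)).analyticAt w |>.meromorphicAt.inv
    have h2 : ((fun z => (Gammaℝ z)⁻¹) ∘ fun z : ℂ => 2 - z)⁻¹ = fun z => Gammaℝ (2 - z) := by
      ext z; simp
    rwa [h2] at h1
  exact h.mul ((differentiable_Gammaℝ_inv.comp
    (differentiable_id.add_const 1)).analyticAt w).meromorphicAt

end DoubleDirichlet

namespace DoubleDirichlet

open Complex Filter Topology Set

/-! ### The coefficient functions -/

/-- Numerators of the contributions of the Euler factor at `2`. -/
noncomputable def twoNum : Fin 3 → ℂ → ℂ
  | 0, _ => 1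
  | 1, _ => 1
  | 2, w => 2 * ((2 : ℂ) ^ (w - 1) - (2 : ℂ) ^ (-w))

/-- Denominators of the contributions of the Euler factor at `2`. -/
noncomputable def twoDen : Fin 3 → ℂ → ℂ
  | 0, _ => 1
  | 1, w => 1 - (4 : ℂ) ^ (w - 1)
  | 2, w => 1 - (4 : ℂ) ^ (w - 1)

/-- The family of functions to which the coefficients of the functional equation belong. -/
noncomputable def coeffFun (κ σ : ℂ) (c : ℕ) (i : Fin 3) (w : ℂ) : ℂ :=
  κ * ((c : ℂ) ^ (1 / 2 - w) * (gammaEven w + σ * gammaOdd w) * (twoNum i w / twoDen i w))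

/-- The possible poles of `coeffFun κ σ c i`. -/
def poleSet (i : Fin 3) : Set ℂ := {w | (∃ m : ℕ, 0 < m ∧ w = m) ∨ twoDen i w = 0}

theorem one_sub_four_cpow (w : ℂ) :
    1 - (4 : ℂ) ^ (w - 1) = 1 - Complex.exp (Real.log 4 * (w - 1)) := by
  rw [cpow_def_of_ne_zero (by norm_num), ofReal_log (by norm_num), ofReal_ofNat]

theorem log_four_ge : 1 ≤ Real.log 4 := by
  rw [Real.le_log_iff_exp_le (by norm_num)]
  linarith [Real.exp_one_lt_three]

theorem one_sub_four_cpow_eq_zero {w : ℂ} (h : 1 - (4 : ℂ) ^ (w - 1) = 0) :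
    ∃ k : ℤ, w = 1 + k * (2 * Real.pi * I) / Real.log 4 := by
  rw [one_sub_four_cpow, sub_eq_zero, eq_comm, Complex.exp_eq_one_iff] at h
  obtain ⟨k, hk⟩ := h
  have h4 : (Real.log 4 : ℂ) ≠ 0 := by
    rw [Ne, ofReal_eq_zero]; linarith [log_four_ge]
  refine ⟨k, ?_⟩
  rw [← hk]
  field_simp
  ring

theorem one_sub_four_cpow_point (k : ℤ) :
    1 - (4 : ℂ) ^ ((1 + k * (2 * Real.pi * I) / Real.log 4 : ℂ) - 1) = 0 := by
  have h4 : (Real.log 4 : ℂ) ≠ 0 := by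
    rw [Ne, ofReal_eq_zero]; linarith [log_four_ge]
  rw [one_sub_four_cpow, add_sub_cancel_left, mul_div_cancel₀ _ h4, sub_eq_zero, eq_comm,
    Complex.exp_eq_one_iff]
  exact ⟨k, rfl⟩

theorem twoDen_eq_zero {i : Fin 3} {w : ℂ} (h : twoDen i w = 0) : 1 - (4 : ℂ) ^ (w - 1) = 0 := by
  fin_cases i
  · simp [twoDen] at h
  · exact h
  · exact h

theorem re_of_twoDen_eq_zero {i : Fin 3} {w : ℂ} (h : twoDen i w = 0) : w.re = 1 := by
  obtain ⟨k, hk⟩ := one_sub_four_cpow_eq_zero (twoDen_eq_zero h)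
  rw [hk, add_re, div_ofReal_re]
  simp

theorem poleSet_countable (i : Fin 3) : (poleSet i).Countable := by
  refine ((countable_range fun m : ℕ => (m : ℂ)).union (countable_range fun k : ℤ =>
    (1 + k * (2 * Real.pi * I) / Real.log 4 : ℂ))).mono ?_
  rintro w (⟨m, _, rfl⟩ | h)
  · exact Or.inl ⟨m, rfl⟩
  · obtain ⟨k, hk⟩ := one_sub_four_cpow_eq_zero (twoDen_eq_zero h)
    exact Or.inr ⟨k, hk.symm⟩

theorem differentiable_natCast_cpow {c : ℕ} (hc : c ≠ 0) {g : ℂ → ℂ} (hg : Differentiable ℂ g) :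
    Differentiable ℂ fun w => (c : ℂ) ^ g w :=
  hg.const_cpow (Or.inl (Nat.cast_ne_zero.mpr hc))

theorem differentiable_twoNum (i : Fin 3) : Differentiable ℂ (twoNum i) := by
  have h1 := differentiable_natCast_cpow (c := 2) (by norm_num) (g := fun w => w - 1) (by fun_prop)
  have h2 := differentiable_natCast_cpow (c := 2) (by norm_num) (g := fun w => -w) (by fun_prop)
  fin_cases i
  · exact differentiable_const 1
  · exact differentiable_const 1
  · exact (h1.sub h2).const_mul 2

theorem differentiable_twoDen (i : Fin 3) : Differentiable ℂ (twoDen i) := by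
  have h1 := differentiable_natCast_cpow (c := 4) (by norm_num) (g := fun w => w - 1) (by fun_prop)
  fin_cases i
  · exact differentiable_const 1
  · exact h1.const_sub 1
  · exact h1.const_sub 1

theorem analyticAt_coeffFun (κ σ : ℂ) {c : ℕ} (hc : c ≠ 0) {i : Fin 3} {w : ℂ}
    (hw : w ∉ poleSet i) : AnalyticAt ℂ (coeffFun κ σ c i) w := by
  simp only [poleSet, mem_ofPred_eq, not_or, not_exists, not_and] at hw
  have h1 := (differentiable_natCast_cpow hc (g := fun w => 1 / 2 - w) (by fun_prop)).analyticAt w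
  exact analyticAt_const.mul ((h1.mul ((analyticAt_gammaEven hw.1).add
    (analyticAt_const.mul (analyticAt_gammaOdd hw.1)))).mul
    (((differentiable_twoNum i).analyticAt w).div ((differentiable_twoDen i).analyticAt w) hw.2))

theorem meromorphicAt_coeffFun (κ σ : ℂ) {c : ℕ} (hc : c ≠ 0) (i : Fin 3) (w : ℂ) :
    MeromorphicAt (coeffFun κ σ c i) w := by
  have h1 := (differentiable_natCast_cpow hc (g := fun w => 1 / 2 - w) (by fun_prop)).analyticAt w
  exact (MeromorphicAt.const κ w).mul ((h1.meromorphicAt.mul ((meromorphicAt_gammaEven w).add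
    ((MeromorphicAt.const σ w).mul (meromorphicAt_gammaOdd w)))).mul
    (((differentiable_twoNum i).analyticAt w).meromorphicAt.div
      ((differentiable_twoDen i).analyticAt w).meromorphicAt))

/-- Away from its zeros, 1 - 4^{w-1} is at least a constant times max(1, 4^{Re w - 1}), which
dominates the growing term 2^{w-1} of the numerator. Only 2^{-w} remains, for Re w < 0. -/
theorem norm_two_factor_le {δ : ℝ} (hδ : 0 < δ) : ∃ K, 0 < K ∧ ∀ (i : Fin 3) (w : ℂ),
    (∀ p, twoDen i p = 0 → δ ≤ ‖w - p‖) →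
    ‖twoNum i w / twoDen i w‖ ≤ K * 2 ^ max 0 (-w.re) := by
  set c := min (1 / 2) (2 / 3 * δ) with hc
  have hc0 : 0 < c := by positivity
  refine ⟨max 1 (4 / c), by positivity, fun i w hw => ?_⟩
  have h2 : (1 : ℝ) ≤ 2 ^ max 0 (-w.re) := Real.one_le_rpow (by norm_num) (le_max_left _ _)
  have hden : (∀ p, 1 - (4 : ℂ) ^ (p - 1) = 0 → δ ≤ ‖w - p‖) →
      c * max 1 ((4 : ℝ) ^ (w.re - 1)) ≤ ‖1 - (4 : ℂ) ^ (w - 1)‖ := by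
    intro h
    have h3 := norm_one_sub_exp_ge_max (z := Real.log 4 * (w - 1)) fun k => by
      have h4 := h _ (one_sub_four_cpow_point k)
      have h5 : (Real.log 4 : ℂ) ≠ 0 := by
        rw [Ne, ofReal_eq_zero]; linarith [log_four_ge]
      have h6 : (Real.log 4 * (w - 1) - k * (2 * Real.pi * I) : ℂ) =
          Real.log 4 * (w - (1 + k * (2 * Real.pi * I) / Real.log 4)) := by
        field_simp
        ring
      rw [h6, norm_mul, norm_real, Real.norm_of_nonneg (by linarith [log_four_ge])]
      exact h4.trans (le_mul_of_one_le_left (norm_nonneg _) log_four_ge)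
    rw [← one_sub_four_cpow] at h3
    have h7 : ‖Complex.exp (Real.log 4 * (w - 1))‖ = (4 : ℝ) ^ (w.re - 1) := by
      rw [norm_exp, Real.rpow_def_of_pos (by norm_num)]
      rw [re_ofReal_mul, sub_re, one_re]
    rwa [h7] at h3
  have hmain : ∀ t : ℂ, ‖t‖ ≤ 4 * 2 ^ max 0 (-w.re) * max 1 ((4 : ℝ) ^ (w.re - 1)) →
      (∀ p, 1 - (4 : ℂ) ^ (p - 1) = 0 → δ ≤ ‖w - p‖) →
      ‖t / (1 - (4 : ℂ) ^ (w - 1))‖ ≤ max 1 (4 / c) * 2 ^ max 0 (-w.re) := by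
    intro t ht h
    have h3 := hden h
    have hm : (1 : ℝ) ≤ max 1 ((4 : ℝ) ^ (w.re - 1)) := le_max_left _ _
    have h4 : 0 < ‖1 - (4 : ℂ) ^ (w - 1)‖ := lt_of_lt_of_le (by positivity) h3
    rw [norm_div, div_le_iff₀ h4]
    calc _ ≤ 4 / c * 2 ^ max 0 (-w.re) * (c * max 1 ((4 : ℝ) ^ (w.re - 1))) := by
          refine ht.trans (le_of_eq ?_)
          field_simp
      _ ≤ _ := by gcongr; exact le_max_right _ _
  have hone : ‖(1 : ℂ)‖ ≤ 4 * 2 ^ max 0 (-w.re) * max 1 ((4 : ℝ) ^ (w.re - 1)) := by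
    rw [norm_one]
    nlinarith [le_max_left 1 ((4 : ℝ) ^ (w.re - 1))]
  fin_cases i
  · simp only [twoNum, twoDen, div_one, norm_one]
    nlinarith [le_max_left 1 (4 / c)]
  · exact hmain 1 hone hw
  · refine hmain _ ?_ hw
    have e1 : ‖(2 : ℂ) ^ (w - 1)‖ = (2 : ℝ) ^ (w.re - 1) := by
      have := norm_cpow_eq_rpow_re_of_pos (x := 2) (by norm_num) (w - 1)
      simpa using this
    have e2 : ‖(2 : ℂ) ^ (-w)‖ = (2 : ℝ) ^ (-w.re) := by
      have := norm_cpow_eq_rpow_re_of_pos (x := 2) (by norm_num) (-w)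
      simpa using this
    have e3 : (2 : ℝ) ^ (w.re - 1) ≤ max 1 ((4 : ℝ) ^ (w.re - 1)) := by
      rcases le_total 1 w.re with h | h
      · exact (Real.rpow_le_rpow (by norm_num) (by norm_num) (by linarith)).trans (le_max_right _ _)
      · exact (Real.rpow_le_one_of_one_le_of_nonpos (by norm_num) (by linarith)).trans
          (le_max_left _ _)
    have e4 : (2 : ℝ) ^ (-w.re) ≤ 2 ^ max 0 (-w.re) :=
      Real.rpow_le_rpow_of_exponent_le (by norm_num) (le_max_right _ _)
    change ‖(2 : ℂ) * ((2 : ℂ) ^ (w - 1) - (2 : ℂ) ^ (-w))‖ ≤ _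
    rw [norm_mul, Complex.norm_two]
    have e5 := norm_sub_le ((2 : ℂ) ^ (w - 1)) ((2 : ℂ) ^ (-w))
    rw [e1, e2] at e5
    have e6 : (1 : ℝ) ≤ max 1 ((4 : ℝ) ^ (w.re - 1)) := le_max_left _ _
    nlinarith [mul_nonneg (sub_nonneg.mpr h2) (sub_nonneg.mpr e6)]

theorem norm_natCast_cpow_half_sub_le {c : ℕ} (hc : c ≠ 0) (hc8 : c ≤ 8) (w : ℂ) :
    ‖(c : ℂ) ^ (1 / 2 - w)‖ ≤ 8 * 8 ^ max 0 (-w.re) := by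
  have hc1 : (1 : ℝ) ≤ c := by exact_mod_cast Nat.one_le_iff_ne_zero.mpr hc
  have hc8' : (c : ℝ) ≤ 8 := by exact_mod_cast hc8
  rw [← ofReal_natCast, norm_cpow_eq_rpow_re_of_pos (by linarith)]
  have h1 : (1 / 2 - w).re ≤ 1 + max 0 (-w.re) := by
    have := le_max_right 0 (-w.re)
    simp
    linarith
  calc (c : ℝ) ^ (1 / 2 - w).re ≤ c ^ (1 + max 0 (-w.re)) :=
        Real.rpow_le_rpow_of_exponent_le hc1 h1
    _ ≤ 8 ^ (1 + max 0 (-w.re)) := Real.rpow_le_rpow (by linarith) hc8' (by positivity)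
    _ = _ := by rw [Real.rpow_add (by norm_num), Real.rpow_one]

theorem norm_coeffFun_le {δ : ℝ} (hδ : 0 < δ) : ∃ K, 0 < K ∧ ∀ (κ σ : ℂ) (c : ℕ) (i : Fin 3),
    ‖κ‖ ≤ 1 → ‖σ‖ ≤ 1 → c ≠ 0 → c ≤ 8 → ∀ w : ℂ, (∀ p ∈ poleSet i, δ ≤ ‖w - p‖) →
    ‖coeffFun κ σ c i w‖ ≤ K * (16 * Real.pi) ^ |w.re| * (1 + ‖w‖) ^ (1 / 2 - w.re) := by
  obtain ⟨K1, hK1, hb1⟩ := norm_gamma_left_le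
  obtain ⟨K2, hK2, hb2⟩ := norm_gamma_right_le (δ := min δ (1 / 2)) (by positivity)
  obtain ⟨K3, hK3, hb3⟩ := norm_two_factor_le hδ
  refine ⟨16 * K3 * (K1 + K2), by positivity, fun κ σ c i hκ hσ hc hc8 w hw => ?_⟩
  have h1 := norm_natCast_cpow_half_sub_le hc hc8 w
  have h2 := hb3 i w fun p hp => hw p (Or.inr hp)
  set T := (1 + ‖w‖) ^ (1 / 2 - w.re) with hT
  have hT0 : 0 < T := by positivity
  have combine : ∀ B : ℝ, 0 ≤ B → ‖gammaEven w‖ ≤ B * T → ‖gammaOdd w‖ ≤ B * T →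
      ‖coeffFun κ σ c i w‖ ≤ 16 * K3 * (8 ^ max 0 (-w.re) * B * 2 ^ max 0 (-w.re)) * T := by
    intro B hB he ho
    have h3 : ‖gammaEven w + σ * gammaOdd w‖ ≤ 2 * (B * T) := by
      refine (norm_add_le _ _).trans ?_
      rw [norm_mul]
      have : ‖σ‖ * ‖gammaOdd w‖ ≤ 1 * (B * T) :=
        mul_le_mul hσ ho (norm_nonneg _) zero_le_one
      linarith
    rw [coeffFun, norm_mul, norm_mul, norm_mul]
    calc _ ≤ 1 * (8 * 8 ^ max 0 (-w.re) * (2 * (B * T)) * (K3 * 2 ^ max 0 (-w.re))) := by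
          gcongr
      _ = _ := by ring
  have hpi := Real.pi_gt_three
  rcases le_total w.re (1 / 2) with hw2 | hw2
  · obtain ⟨he, ho⟩ := hb1 w hw2
    refine (combine (K1 * 2 ^ |w.re|) (by positivity) he ho).trans ?_
    have h4 : max 0 (-w.re) ≤ |w.re| := max_le (abs_nonneg _) (neg_le_abs _)
    have h5 : (8 : ℝ) ^ max 0 (-w.re) ≤ 8 ^ |w.re| :=
      Real.rpow_le_rpow_of_exponent_le (by norm_num) h4
    have h6 : (2 : ℝ) ^ max 0 (-w.re) ≤ 2 ^ |w.re| :=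
      Real.rpow_le_rpow_of_exponent_le (by norm_num) h4
    -- The conductor c ≤ 8, the gamma quotient and the factor at 2 together contribute the base
    -- 8·2·2 = 32 < 16π.
    have h7 : (8 : ℝ) ^ |w.re| * 2 ^ |w.re| * 2 ^ |w.re| ≤ (16 * Real.pi) ^ |w.re| := by
      rw [← Real.mul_rpow (by norm_num) (by norm_num), ← Real.mul_rpow (by norm_num) (by norm_num)]
      exact Real.rpow_le_rpow (by norm_num) (by linarith) (abs_nonneg _)
    calc _ ≤ 16 * K3 * (8 ^ |w.re| * (K1 * 2 ^ |w.re|) * 2 ^ |w.re|) * T := by gcongr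
      _ = 16 * K3 * K1 * (8 ^ |w.re| * 2 ^ |w.re| * 2 ^ |w.re|) * T := by ring
      _ ≤ 16 * K3 * (K1 + K2) * (16 * Real.pi) ^ |w.re| * T := by
          gcongr
          linarith
  · have hdist : ∀ k : ℤ, min δ (1 / 2) ≤ ‖w - k‖ := by
      intro k
      rcases lt_or_ge 0 k with hk | hk
      · lift k to ℕ using hk.le
        exact (min_le_left _ _).trans (hw _ (Or.inl ⟨k, by exact_mod_cast hk, by simp⟩))
      · refine (min_le_right _ _).trans (le_trans ?_ (re_le_norm _))
        have : (k : ℝ) ≤ 0 := by exact_mod_cast hk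
        simp
        linarith
    obtain ⟨he, ho⟩ := hb2 w hw2 hdist
    refine (combine (K2 * (16 * Real.pi) ^ |w.re|) (by positivity) he ho).trans ?_
    rw [max_eq_left (by linarith), Real.rpow_zero, Real.rpow_zero, one_mul, mul_one]
    calc _ = 16 * K3 * K2 * (16 * Real.pi) ^ |w.re| * T := by ring
      _ ≤ _ := by gcongr; linarith

/-- Points avoiding the real line and the line `Re w = 1`. -/
def genericSet : Set ℂ := {w | w.im ≠ 0 ∧ w.re ≠ 1}

theorem genericSet_disjoint_poleSet {i : Fin 3} {w : ℂ} (hw : w ∈ genericSet) : w ∉ poleSet i := by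
  rintro (⟨m, _, rfl⟩ | h)
  · exact hw.1 (by simp)
  · exact hw.2 (re_of_twoDen_eq_zero h)

/-- Density of `genericSet`: identities proved there extend by continuity, as limits within it are
unique. -/
theorem neBot_nhdsWithin_genericSet (w : ℂ) : (𝓝[genericSet] w).NeBot := by
  rw [← mem_closure_iff_nhdsWithin_neBot]
  have h2 : ({1}ᶜ : Set ℝ) ×ℂ ({0}ᶜ : Set ℝ) ⊆ genericSet := fun z hz => ⟨hz.2, hz.1⟩
  refine closure_mono h2 ?_
  rw [closure_reProdIm, closure_compl_singleton, closure_compl_singleton]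
  exact ⟨mem_univ _, mem_univ _⟩

theorem twoNum_ne_zero {i : Fin 3} {w : ℂ} (hw : 1 ≤ w.re) : twoNum i w ≠ 0 := by
  fin_cases i
  · exact one_ne_zero
  · exact one_ne_zero
  · intro h
    have h1 : (2 : ℂ) ^ (w - 1) = (2 : ℂ) ^ (-w) := by
      have h' : (2 : ℂ) * ((2 : ℂ) ^ (w - 1) - (2 : ℂ) ^ (-w)) = 0 := h
      rw [mul_eq_zero, or_iff_right two_ne_zero, sub_eq_zero] at h'
      exact h'
    have e1 := norm_cpow_eq_rpow_re_of_pos (x := 2) (by norm_num) (w - 1)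
    have e2 := norm_cpow_eq_rpow_re_of_pos (x := 2) (by norm_num) (-w)
    rw [ofReal_ofNat] at e1 e2
    rw [h1, e2] at e1
    have := Real.rpow_lt_rpow_of_exponent_lt (x := 2) (by norm_num)
      (show (-w).re < (w - 1).re by simp; linarith)
    linarith

/-- A zero would force sin² = cos² and hence cos(πw) = 0, so w would be half an odd integer. The
candidate poles are integers or have real part 1, so the numerator does not cancel them. -/
theorem sin_add_cos_ne_zero {σ w : ℂ} (hσ : σ ^ 2 = 1)
    (hw : (∃ m : ℕ, 0 < m ∧ w = m) ∨ w.re = 1) :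
    Complex.sin (Real.pi * w / 2) + σ * Complex.cos (Real.pi * w / 2) ≠ 0 := by
  intro h
  have h1 : Complex.sin (Real.pi * w / 2) ^ 2 = Complex.cos (Real.pi * w / 2) ^ 2 := by
    linear_combination (Complex.sin (Real.pi * w / 2) - σ * Complex.cos (Real.pi * w / 2)) * h +
      Complex.cos (Real.pi * w / 2) ^ 2 * hσ
  have h2 : Complex.cos (Real.pi * w) = 0 := by
    rw [show (Real.pi * w : ℂ) = 2 * (Real.pi * w / 2) by ring, Complex.cos_two_mul]
    linear_combination Complex.sin_sq_add_cos_sq (Real.pi * w / 2) - h1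
  rw [Complex.cos_eq_zero_iff] at h2
  obtain ⟨k, hk⟩ := h2
  have h3 : w = ((2 * k + 1 : ℤ) : ℂ) / 2 := by
    have : (Real.pi : ℂ) ≠ 0 := ofReal_ne_zero.mpr Real.pi_ne_zero
    field_simp at hk
    push_cast
    linear_combination hk / 2
  rcases hw with ⟨m, _, rfl⟩ | hw
  · have h4 : ((2 * m : ℤ) : ℂ) = ((2 * k + 1 : ℤ) : ℂ) := by
      push_cast at h3 ⊢
      linear_combination 2 * h3
    have h5 : (2 * m : ℤ) = 2 * k + 1 := by exact_mod_cast h4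
    omega
  · rw [h3, show (((2 * k + 1 : ℤ) : ℂ) / 2).re = ((2 * k + 1 : ℤ) : ℝ) / 2 by
      rw [show (2 : ℂ) = ((2 : ℝ) : ℂ) by simp, div_ofReal_re, intCast_re]] at hw
    have h5 : ((2 * k + 1 : ℤ) : ℝ) = ((2 : ℤ) : ℝ) := by push_cast at hw ⊢; linarith
    have h6 : (2 * k + 1 : ℤ) = 2 := by exact_mod_cast h5
    omega

/-- The normal form of `coeffFun`. -/
noncomputable def coeffNF (κ σ : ℂ) (c : ℕ) (i : Fin 3) : ℂ → ℂ :=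
  toMeromorphicNFOn (coeffFun κ σ c i) univ

theorem coeffNF_eq (κ σ : ℂ) {c : ℕ} (hc : c ≠ 0) {i : Fin 3} {w : ℂ} (hw : w ∉ poleSet i) :
    coeffNF κ σ c i w = coeffFun κ σ c i w := by
  rw [coeffNF, toMeromorphicNFOn_eq_toMeromorphicNFAt
    (fun z _ => meromorphicAt_coeffFun κ σ hc i z) (mem_univ w),
    toMeromorphicNFAt_eq_self.mpr (analyticAt_coeffFun κ σ hc hw).meromorphicNFAt]

theorem isClosed_poleSet (i : Fin 3) : IsClosed (poleSet i) := by
  have h1 : IsClosed (range fun m : ℕ => ((m + 1 : ℕ) : ℂ)) := by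
    refine Metric.isClosed_of_pairwise_le_dist one_pos ?_ 
    rintro _ ⟨a, rfl⟩ _ ⟨b, rfl⟩ hab
    have hne : (a : ℤ) - b ≠ 0 := by
      intro h
      apply hab
      have : a = b := by omega
      simp [this]
    rw [dist_eq_norm, show ((a + 1 : ℕ) : ℂ) - ((b + 1 : ℕ) : ℂ) = (((a : ℤ) - b : ℤ) : ℂ) by
      push_cast; ring, norm_intCast]
    exact_mod_cast Int.one_le_abs hne
  have h2 : poleSet i = (range fun m : ℕ => ((m + 1 : ℕ) : ℂ)) ∪ twoDen i ⁻¹' {0} := by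
    ext w
    constructor
    · rintro (⟨m, hm, rfl⟩ | h)
      · exact Or.inl ⟨m - 1, by simp [Nat.sub_add_cancel hm]⟩
      · exact Or.inr h
    · rintro (⟨m, rfl⟩ | h)
      · exact Or.inl ⟨m + 1, by omega, rfl⟩
      · exact Or.inr h
  rw [h2]
  exact h1.union (isClosed_singleton.preimage (differentiable_twoDen i).continuous)

theorem analyticAt_coeffNF (κ σ : ℂ) {c : ℕ} (hc : c ≠ 0) {i : Fin 3} {w : ℂ}
    (hw : w ∉ poleSet i) : AnalyticAt ℂ (coeffNF κ σ c i) w := by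
  refine (analyticAt_coeffFun κ σ hc hw).congr ?_
  filter_upwards [(isClosed_poleSet i).isOpen_compl.mem_nhds hw] with z hz
  exact (coeffNF_eq κ σ hc hz).symm

/-- Near p, the function times D = Γ_ℂ·sin·cos·`twoDen` equals H. Here D(p) = 0 but H(p) ≠ 0, so the
function cannot stay finite. This makes distance to the actual poles the same as distance to
`poleSet`, where the estimates were proved. -/
theorem not_analyticAt_coeffNF {κ σ : ℂ} (hκ : κ ≠ 0) (hσ : σ ^ 2 = 1) {c : ℕ} (hc : c ≠ 0)
    {i : Fin 3} {p : ℂ} (hp : p ∈ poleSet i) : ¬ AnalyticAt ℂ (coeffNF κ σ c i) p := by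
  intro hA
  have hp' : (∃ m : ℕ, 0 < m ∧ p = m) ∨ p.re = 1 := hp.imp_right re_of_twoDen_eq_zero
  have hre : 1 ≤ p.re := by
    rcases hp' with ⟨m, hm, rfl⟩ | h
    · rw [natCast_re]; exact_mod_cast hm
    · exact h.ge
  set H : ℂ → ℂ := fun w => κ * ((c : ℂ) ^ (1 / 2 - w) * (Complex.sin (Real.pi * w / 2) +
    σ * Complex.cos (Real.pi * w / 2)) * twoNum i w) with hH
  set D : ℂ → ℂ := fun w => Gammaℂ w * (Complex.sin (Real.pi * w / 2) *
    Complex.cos (Real.pi * w / 2)) * twoDen i w with hD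
  have hcp := differentiable_natCast_cpow hc (g := fun w => 1 / 2 - w) (by fun_prop)
  have hHc : ContinuousAt H p := by
    have := hcp.continuous.continuousAt (x := p)
    have := (differentiable_twoNum i).continuous.continuousAt (x := p)
    fun_prop
  have hDc : ContinuousAt D p := by
    have h1 := (differentiable_twoDen i).continuous.continuousAt (x := p)
    have h2 : ContinuousAt Gammaℂ p := by
      have h3 : DifferentiableAt ℂ Complex.Gamma p := by
        refine Complex.differentiableAt_Gamma p fun m h => ?_
        rw [h] at hre
        simp at hre
        linarith [(Nat.cast_nonneg m : (0 : ℝ) ≤ m)]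
      have h4 : Differentiable ℂ fun s : ℂ => (2 * Real.pi : ℂ) ^ (-s) :=
        differentiable_neg.const_cpow (Or.inl (by simp [Real.pi_ne_zero]))
      exact ((continuousAt_const.mul h4.continuous.continuousAt).mul h3.continuousAt)
    fun_prop
  have hDp : D p = 0 := by
    rcases hp with ⟨m, _, rfl⟩ | h
    · have : Complex.sin (Real.pi * m / 2) * Complex.cos (Real.pi * m / 2) = 0 := by
        have h1 := Complex.sin_two_mul (Real.pi * m / 2)
        rw [show (2 * (Real.pi * m / 2) : ℂ) = m * Real.pi by ring, Complex.sin_nat_mul_pi] at h1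
        linear_combination -h1 / 2
      simp only [hD]
      rw [this]; ring
    · simp only [hD]
      rw [h, mul_zero]
  have hHp : H p ≠ 0 := by
    refine mul_ne_zero hκ (mul_ne_zero (mul_ne_zero ?_ (sin_add_cos_ne_zero hσ hp'))
      (twoNum_ne_zero hre))
    rw [Ne, cpow_eq_zero_iff, not_and_or]
    exact Or.inl (Nat.cast_ne_zero.mpr hc)
  have hev : ∀ᶠ w in 𝓝[genericSet] p, coeffNF κ σ c i w * D w = H w := by
    have hpos : ∀ᶠ w in 𝓝[genericSet] p, 0 < w.re :=
      nhdsWithin_le_nhds ((isOpen_lt continuous_const continuous_re).mem_nhds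
        (show (0 : ℝ) < p.re by linarith))
    filter_upwards [hpos, self_mem_nhdsWithin] with w hw0 hwg
    have hnot := genericSet_disjoint_poleSet (i := i) hwg
    rw [coeffNF_eq κ σ hc hnot, coeffFun, gammaEven_eq_inv hw0, gammaOdd_eq_inv hw0]
    have hden : twoDen i w ≠ 0 := fun h => hnot (Or.inr h)
    have hG : Gammaℂ w ≠ 0 := by
      rw [Gammaℂ_def]
      refine mul_ne_zero (mul_ne_zero two_ne_zero ?_) (Complex.Gamma_ne_zero_of_re_pos hw0)
      rw [Ne, cpow_eq_zero_iff, not_and_or]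
      exact Or.inl (by simp [Real.pi_ne_zero])
    have him : ∀ k : ℤ, (Real.pi * w / 2 : ℂ) ≠ k * Real.pi / 2 := by
      intro k hk
      have : w = k := by
        have : (Real.pi : ℂ) ≠ 0 := ofReal_ne_zero.mpr Real.pi_ne_zero
        field_simp at hk
        linear_combination hk
      exact hwg.1 (by simp [this])
    have hs : Complex.sin (Real.pi * w / 2) ≠ 0 := by
      rw [Complex.sin_ne_zero_iff]
      intro k hk
      exact him (2 * k) (by rw [hk]; push_cast; ring)
    have hcs : Complex.cos (Real.pi * w / 2) ≠ 0 := by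
      rw [Complex.cos_ne_zero_iff]
      intro k hk
      exact him (2 * k + 1) (by rw [hk]; push_cast; ring)
    simp only [hD, hH]
    generalize Complex.sin (Real.pi * w / 2) = S at *
    generalize Complex.cos (Real.pi * w / 2) = T at *
    generalize (c : ℂ) ^ (1 / 2 - w) = A at *
    field_simp
  have hlim1 : Tendsto (fun w => coeffNF κ σ c i w * D w) (𝓝[genericSet] p) (𝓝 0) := by
    have := (hA.continuousAt.mul hDc).tendsto
    simp only [Pi.mul_apply, hDp, mul_zero] at this
    exact this.mono_left nhdsWithin_le_nhds
  have hlim2 : Tendsto (fun w => coeffNF κ σ c i w * D w) (𝓝[genericSet] p) (𝓝 (H p)) :=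
    (hHc.tendsto.mono_left nhdsWithin_le_nhds).congr' (hev.mono fun w h => h.symm)
  have := neBot_nhdsWithin_genericSet p
  exact hHp (tendsto_nhds_unique hlim2 hlim1)

theorem coeffNF_zero (σ : ℂ) (c : ℕ) (i : Fin 3) : coeffNF 0 σ c i = 0 := by
  have h : coeffFun 0 σ c i = 0 := by ext w; simp [coeffFun]
  rw [coeffNF, h, toMeromorphicNFOn_eq_self]
  exact fun z _ => (analyticAt_const (v := (0 : ℂ))).meromorphicNFAt

/-- The analytic properties of the coefficients. -/
theorem coeffNF_properties : ∃ C : ℝ → ℝ, ∀ (κ σ : ℂ) (c : ℕ) (i : Fin 3),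
    ‖κ‖ ≤ 1 → σ ^ 2 = 1 → c ≠ 0 → c ≤ 8 →
    MeromorphicNFOn (coeffNF κ σ c i) univ ∧
    (∀ w : ℂ, ¬ AnalyticAt ℂ (coeffNF κ σ c i) w → (∃ m : ℕ, 0 < m ∧ w = m) ∨ w.re = 1) ∧
    {w : ℂ | ¬ AnalyticAt ℂ (coeffNF κ σ c i) w}.Countable ∧
    (∀ δ : ℝ, 0 < δ → ∀ w : ℂ,
      (∀ p : ℂ, ¬ AnalyticAt ℂ (coeffNF κ σ c i) p → δ ≤ ‖w - p‖) →
      ‖coeffNF κ σ c i w‖ ≤ C δ * (16 * Real.pi) ^ |w.re| * (1 + ‖w‖) ^ (1 / 2 - w.re)) := by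
  have h : ∀ δ : ℝ, ∃ K, 0 < K ∧ (0 < δ → ∀ (κ σ : ℂ) (c : ℕ) (i : Fin 3),
      ‖κ‖ ≤ 1 → ‖σ‖ ≤ 1 → c ≠ 0 → c ≤ 8 → ∀ w : ℂ, (∀ p ∈ poleSet i, δ ≤ ‖w - p‖) →
      ‖coeffFun κ σ c i w‖ ≤ K * (16 * Real.pi) ^ |w.re| * (1 + ‖w‖) ^ (1 / 2 - w.re)) := by
    intro δ
    by_cases hδ : 0 < δ
    · obtain ⟨K, hK, hb⟩ := norm_coeffFun_le hδ
      exact ⟨K, hK, fun _ => hb⟩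
    · exact ⟨1, one_pos, fun h => absurd h hδ⟩
  choose C hC0 hC using h
  refine ⟨C, fun κ σ c i hκ hσ hc hc8 => ?_⟩
  have hsub : ∀ w, ¬ AnalyticAt ℂ (coeffNF κ σ c i) w → w ∈ poleSet i := fun w hw => by
    by_contra h
    exact hw (analyticAt_coeffNF κ σ hc h)
  refine ⟨meromorphicNFOn_toMeromorphicNFOn _ _,
    fun w hw => (hsub w hw).imp_right re_of_twoDen_eq_zero,
    (poleSet_countable i).mono hsub, fun δ hδ w hw => ?_⟩
  -- For κ = 0 the points of `poleSet` are no longer poles, but the function vanishes identically.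
  by_cases hκ0 : κ = 0
  · subst hκ0
    rw [coeffNF_zero, Pi.zero_apply, norm_zero]
    have := hC0 δ
    positivity
  · have hw' : ∀ p ∈ poleSet i, δ ≤ ‖w - p‖ := fun p hp => hw p (not_analyticAt_coeffNF hκ0 hσ hc hp)
    have hwp : w ∉ poleSet i := fun h => by
      have := hw' w h
      rw [sub_self, norm_zero] at this
      linarith
    rw [coeffNF_eq κ σ hc hwp]
    have hσ1 : ‖σ‖ ≤ 1 := by
      have := congrArg norm hσ
      rw [norm_pow, norm_one] at this
      nlinarith [norm_nonneg σ]
    exact hC δ hδ κ σ c i hκ hσ1 hc hc8 w hw'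

end DoubleDirichlet

/-! ### Arithmetic of the correction polynomials and the triple sum. -/

namespace DoubleDirichlet

open Complex Filter Topology
open scoped NumberTheorySymbols

/-! ### The decomposition `d = d₀ d₁²` -/

theorem factorization_sqPart (d : ℕ) (p : ℕ) :
    (sqPart d).factorization p = d.factorization p / 2 := by
  have h : sqPart d = (d.factorization.mapRange (· / 2) (by simp)).prod fun p k => p ^ k := by
    rw [Finsupp.prod_mapRange_index (by simp), Finsupp.prod, Nat.support_factorization, sqPart]
  rw [h, Nat.prod_pow_factorization_eq_self]
  · simp
  · intro q hq
    refine Nat.prime_of_mem_primeFactors (n := d) ?_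
    rw [← Nat.support_factorization]
    exact Finsupp.support_mapRange hq

theorem factorization_sqfreePart (d : ℕ) (p : ℕ) :
    (sqfreePart d).factorization p = d.factorization p % 2 := by
  have h : sqfreePart d =
      (d.factorization.mapRange (· % 2) (by simp)).prod fun p k => p ^ k := by
    rw [Finsupp.prod_mapRange_index (by simp), Finsupp.prod, Nat.support_factorization, sqfreePart]
  rw [h, Nat.prod_pow_factorization_eq_self]
  · simp
  · intro q hq
    refine Nat.prime_of_mem_primeFactors (n := d) ?_
    rw [← Nat.support_factorization]
    exact Finsupp.support_mapRange hq

theorem sqPart_ne_zero (d : ℕ) : sqPart d ≠ 0 :=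
  Finset.prod_ne_zero_iff.mpr fun _ hp => pow_ne_zero _ (Nat.pos_of_mem_primeFactors hp).ne'

theorem sqfreePart_ne_zero (d : ℕ) : sqfreePart d ≠ 0 := (squarefree_sqfreePart d).ne_zero

theorem sqPart_mul_sq {a b : ℕ} (ha : Squarefree a) (hb : b ≠ 0) : sqPart (a * b ^ 2) = b := by
  refine Nat.eq_of_factorization_eq (sqPart_ne_zero _) hb fun p => ?_
  rw [factorization_sqPart, Nat.factorization_mul ha.ne_zero (pow_ne_zero 2 hb),
    Nat.factorization_pow, Finsupp.add_apply, Finsupp.smul_apply, smul_eq_mul]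
  have := ha.natFactorization_le_one p
  omega

theorem sqfreePart_mul_sq {a b : ℕ} (ha : Squarefree a) (hb : b ≠ 0) :
    sqfreePart (a * b ^ 2) = a := by
  refine Nat.eq_of_factorization_eq (sqfreePart_ne_zero _) ha.ne_zero fun p => ?_
  rw [factorization_sqfreePart, Nat.factorization_mul ha.ne_zero (pow_ne_zero 2 hb),
    Nat.factorization_pow, Finsupp.add_apply, Finsupp.smul_apply, smul_eq_mul]
  have := ha.natFactorization_le_one p
  omega

theorem sq_dvd_iff_dvd_sqPart {g n : ℕ} (hn : n ≠ 0) : g ^ 2 ∣ n ↔ g ∣ sqPart n := by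
  by_cases hg : g = 0
  · subst hg
    simp [hn, sqPart_ne_zero]

  rw [← Nat.factorization_le_iff_dvd (pow_ne_zero 2 hg) hn,
    ← Nat.factorization_le_iff_dvd hg (sqPart_ne_zero n)]
  refine forall_congr' fun p => ?_
  rw [factorization_sqPart, Nat.factorization_pow, Finsupp.smul_apply, smul_eq_mul]
  omega

theorem div_sq_eq {n g : ℕ} (hn : n ≠ 0) (hg : g ∣ sqPart n) :
    n / g ^ 2 = sqfreePart n * (sqPart n / g) ^ 2 := by
  have hg0 : g ≠ 0 := fun h => sqPart_ne_zero n (by rwa [h, zero_dvd_iff] at hg)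
  refine Nat.div_eq_of_eq_mul_left (by positivity) ?_
  conv_lhs => rw [← sqfreePart_mul_sqPart_sq hn, ← Nat.div_mul_cancel hg]
  ring

theorem sqPart_div_ne_zero {n g : ℕ} (hg : g ∣ sqPart n) : sqPart n / g ≠ 0 := by
  intro h
  have := Nat.div_mul_cancel hg
  rw [h, zero_mul] at this
  exact sqPart_ne_zero n this.symm

theorem sqfreePart_div_sq {n g : ℕ} (hn : n ≠ 0) (hg : g ∣ sqPart n) :
    sqfreePart (n / g ^ 2) = sqfreePart n := by
  rw [div_sq_eq hn hg, sqfreePart_mul_sq (squarefree_sqfreePart n) (sqPart_div_ne_zero hg)]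

theorem sqPart_div_sq {n g : ℕ} (hn : n ≠ 0) (hg : g ∣ sqPart n) :
    sqPart (n / g ^ 2) = sqPart n / g := by
  rw [div_sq_eq hn hg, sqPart_mul_sq (squarefree_sqfreePart n) (sqPart_div_ne_zero hg)]

/-- Regrouping a sum over pairs `(g, e)` according to the value of `g² e`. -/
theorem hasSum_sq_mul {h : ℕ → ℕ → ℂ} {a : ℂ} (hf : HasSum (fun x : ℕ × ℕ => h x.1 x.2) a)
    (h0 : ∀ g e, g = 0 ∨ e = 0 → h g e = 0) :
    HasSum (fun n => ∑ g ∈ (sqPart n).divisors, h g (n / g ^ 2)) a := by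
  classical
  have key : (fun n => ∑ g ∈ (sqPart n).divisors, h g (n / g ^ 2)) = fun n =>
      ∑' b : ((fun x : ℕ × ℕ => x.1 ^ 2 * x.2) ⁻¹' ({n} : Set ℕ)), h b.1.1 b.1.2 := ?_
  · rw [key]
    exact hf.tsum_fiberwise (fun x => x.1 ^ 2 * x.2)
  funext n
  rw [tsum_subtype ((fun x : ℕ × ℕ => x.1 ^ 2 * x.2) ⁻¹' ({n} : Set ℕ)) fun x => h x.1 x.2]
  by_cases hn : n = 0
  · subst hn
    have h1 : sqPart 0 = 1 := by simp [sqPart]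
    rw [h1, Nat.divisors_one, Finset.sum_singleton, Nat.zero_div, h0 1 0 (Or.inr rfl)]
    rw [eq_comm, ← tsum_zero (α := ℂ) (β := ℕ × ℕ)]
    refine tsum_congr fun x => ?_
    rw [Set.indicator_apply]
    split_ifs with hx
    · refine h0 _ _ ?_
      have hx' : x.1 ^ 2 * x.2 = 0 := hx
      simpa using hx'
    · rfl
  · rw [tsum_eq_sum (s := (sqPart n).divisors.image fun g => (g, n / g ^ 2))]
    · rw [Finset.sum_image (fun x _ y _ hxy => (Prod.mk.inj hxy).1)]
      refine Finset.sum_congr rfl fun g hg => ?_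
      rw [Set.indicator_of_mem]
      exact Nat.mul_div_cancel' ((sq_dvd_iff_dvd_sqPart hn).mpr (Nat.dvd_of_mem_divisors hg))
    · rintro ⟨g, e⟩ hge
      rw [Set.indicator_apply, if_neg]
      rintro (rfl : g ^ 2 * e = n)
      apply hge
      have hg : g ≠ 0 := by rintro rfl; simp at hn
      rw [Finset.mem_image]
      refine ⟨g, ?_, ?_⟩
      · rw [Nat.mem_divisors]
        exact ⟨(sq_dvd_iff_dvd_sqPart hn).mp (dvd_mul_right _ _), sqPart_ne_zero _⟩
      · rw [Nat.mul_div_cancel_left _ (by positivity)]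

/-! ### The correction polynomials -/

/-- The local factor at `p` of the correction polynomials. -/
noncomputable def localPoly (ε f : ℂ) (p α : ℕ) : ℂ :=
  ∑ i ∈ Finset.range (α + 1), (p : ℂ) ^ i * f ^ (2 * i) -
    ∑ i ∈ Finset.range α, ε * (p : ℂ) ^ i * f ^ (2 * i + 1)

/-- Both sides are multiplicative in N. At p^α, the divisor p^i with i < α pairs an even term with
the following odd one, and p^α contributes the unpaired last even term. Multiplied by an L-value,
each summand only removes Euler factors, so the product becomes a Dirichlet series. -/
theorem prod_localPoly (ε f : ℕ → ℂ) (hf1 : f 1 = 1) (hf : ∀ m n, f (m * n) = f m * f n) {N : ℕ}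
    (hN : N ≠ 0) :
    ∏ p ∈ N.primeFactors, localPoly (ε p) (f p) p (N.factorization p) =
      ∑ g ∈ N.divisors, g * f g ^ 2 * ∏ p ∈ (N / g).primeFactors, (1 - ε p * f p) := by
  let G : ArithmeticFunction ℂ := ⟨fun n => n * f n ^ 2, by simp⟩
  let H : ArithmeticFunction ℂ := ArithmeticFunction.prodPrimeFactors fun p => 1 - ε p * f p
  have hG : G.IsMultiplicative := by
    refine ⟨by simp [G, hf1], fun {m n} _ => ?_⟩
    simp only [G, ArithmeticFunction.coe_mk, hf]
    push_cast
    ring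
  have hH : H.IsMultiplicative := ArithmeticFunction.IsMultiplicative.prodPrimeFactors _
  have hGH : ∀ n, (G * H) n = ∑ g ∈ n.divisors, G g * H (n / g) := fun n => by
    rw [ArithmeticFunction.mul_apply, Nat.sum_divisorsAntidiagonal fun a b => G a * H b]
  have hfpow : ∀ p k, f (p ^ k) = f p ^ k := by
    intro p k
    induction k with
    | zero => simp [hf1]
    | succ k ih => rw [pow_succ, hf, ih, pow_succ]
  have h1 : ∑ g ∈ N.divisors, g * f g ^ 2 * ∏ p ∈ (N / g).primeFactors, (1 - ε p * f p) =
      (G * H) N := by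
    rw [hGH]
    refine Finset.sum_congr rfl fun g hg => ?_
    have : N / g ≠ 0 := (Nat.div_pos (Nat.divisor_le hg) (Nat.pos_of_mem_divisors hg)).ne'
    rw [ArithmeticFunction.prodPrimeFactors_apply this]
    rfl
  rw [h1, (hG.mul hH).multiplicative_factorization _ hN, Finsupp.prod, Nat.support_factorization]
  refine Finset.prod_congr rfl fun p hp => ?_
  have hpp := Nat.prime_of_mem_primeFactors hp
  rw [hGH, Nat.sum_divisors_prime_pow hpp, localPoly]
  generalize N.factorization p = α
  rw [Finset.sum_range_succ, Finset.sum_range_succ _ α, add_sub_right_comm,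
    ← Finset.sum_sub_distrib]
  congr 1
  · refine Finset.sum_congr rfl fun i hi => ?_
    have hi' := Finset.mem_range.mp hi
    rw [Nat.pow_div hi'.le hpp.pos, ArithmeticFunction.prodPrimeFactors_apply
      (pow_ne_zero _ hpp.ne_zero), Nat.primeFactors_prime_pow (by omega) hpp,
      Finset.prod_singleton]
    simp only [G, ArithmeticFunction.coe_mk, hfpow]
    push_cast
    ring
  · rw [Nat.div_self (pow_pos hpp.pos _), hH.map_one, mul_one]
    simp only [G, ArithmeticFunction.coe_mk, hfpow]
    push_cast
    ring

/-! ### `L`-functions with Euler factors removed -/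

theorem LRemoved_eq {q : ℕ} [NeZero q] (χ : DirichletCharacter ℂ q) (Q : ℕ) (s : ℂ) :
    LRemoved Q χ s = DirichletCharacter.LFunction χ s *
      ∏ p ∈ Q.primeFactors, (1 - χ (p : ZMod q) * (p : ℂ) ^ (-s)) := by
  rw [LRemoved, dirichletL, dif_neg (NeZero.ne q)]

/-- Removing the Euler factors at Q is the same as inducing χ to level qQ, since the factors at
primes dividing q are already 1. -/
theorem hasSum_LRemoved {q : ℕ} [NeZero q] (χ : DirichletCharacter ℂ q) {Q : ℕ} (hQ : Q ≠ 0)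
    {s : ℂ} (hs : 1 < s.re) :
    HasSum (fun n : ℕ => if n.Coprime Q then χ n * (n : ℂ) ^ (-s) else 0) (LRemoved Q χ s) := by
  have : NeZero Q := ⟨hQ⟩
  have hs1 : s ≠ 1 := by rintro rfl; simp at hs
  have hs0 : s ≠ 0 := by rintro rfl; simp at hs; linarith
  have h1 := DirichletCharacter.LFunction_changeLevel (dvd_mul_right q Q) χ (Or.inr hs1)
  have h2 : LRemoved Q χ s = DirichletCharacter.LFunction
      (DirichletCharacter.changeLevel (dvd_mul_right q Q) χ) s := by
    rw [LRemoved_eq, h1]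
    congr 1
    refine Finset.prod_subset (Nat.primeFactors_mono (dvd_mul_left _ _) (NeZero.ne _)) ?_
    intro p hp hp'
    have hpp := Nat.prime_of_mem_primeFactors hp
    have hpq : p ∣ q := by
      rcases hpp.dvd_mul.mp (Nat.dvd_of_mem_primeFactors hp) with h | h
      · exact h
      · exact absurd (Nat.mem_primeFactors.mpr ⟨hpp, h, hQ⟩) hp'
    have : χ (p : ZMod q) = 0 := by
      refine χ.map_nonunit fun h => ?_
      rw [ZMod.isUnit_iff_coprime] at h
      exact hpp.one_lt.ne' (Nat.Coprime.eq_one_of_dvd h hpq)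
    rw [this, zero_mul, sub_zero]
  rw [h2, DirichletCharacter.LFunction_eq_LSeries _ hs]
  have h3 := (ZMod.LSeriesSummable_of_one_lt_re
    (DirichletCharacter.changeLevel (dvd_mul_right q Q) χ : ZMod (q * Q) → ℂ) hs).hasSum
  rw [LSeries]
  convert h3 using 1
  funext n
  by_cases hn : n = 0
  · subst hn
    simp [zero_cpow (neg_ne_zero.mpr hs0)]
  · rw [LSeries.term_of_ne_zero hn, div_eq_mul_inv, ← cpow_neg]
    have h5 : ∀ m : ℕ, IsCoprime ((n : ℕ) : ℤ) m ↔ n.Coprime m := fun m =>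
      Nat.isCoprime_iff_coprime
    by_cases hq : n.Coprime q
    · split_ifs with hnQ
      · have := DirichletCharacter.changeLevel_eq_cast_of_dvd' χ (dvd_mul_right q Q) (a := n)
          ((h5 _).mpr (hq.mul_right hnQ))
        rw [Int.cast_natCast, Int.cast_natCast] at this
        rw [this]
      · rw [MulChar.map_nonunit _ fun h => hnQ (Nat.Coprime.coprime_mul_left_right
          ((ZMod.isUnit_iff_coprime _ _).mp h)), zero_mul]
    · rw [MulChar.map_nonunit _ fun h => hq (Nat.Coprime.coprime_mul_right_right
          ((ZMod.isUnit_iff_coprime _ _).mp h)), zero_mul, MulChar.map_nonunit _ fun h =>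
          hq ((ZMod.isUnit_iff_coprime _ _).mp h), zero_mul, ite_self]

theorem LRemoved_mul_prod {q : ℕ} (χ : DirichletCharacter ℂ q) {Q h : ℕ} (hQh : Q.Coprime h)
    (s : ℂ) : LRemoved Q χ s * ∏ p ∈ h.primeFactors, (1 - χ (p : ZMod q) * (p : ℂ) ^ (-s)) =
      LRemoved (Q * h) χ s := by
  rw [LRemoved, LRemoved, hQh.primeFactors_mul, Finset.prod_union hQh.disjoint_primeFactors,
    mul_assoc]

theorem chi_natCast {d : ℕ} (hd : d ≠ 0) (n : ℕ) :
    chi d (n : ZMod (4 * d)) = if Odd n then (J(d | n) : ℂ) else 0 := by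
  have : NeZero (4 * d) := ⟨by omega⟩
  by_cases hu : IsUnit (n : ZMod (4 * d))
  · have h1 : n.Coprime (4 * d) := (ZMod.isUnit_iff_coprime n (4 * d)).mp hu
    have hodd : Odd n := Nat.coprime_two_right.mp
      (Nat.Coprime.coprime_dvd_right ⟨2 * d, by ring⟩ h1)
    rw [if_pos hodd]
    have h2 : chi d (n : ZMod (4 * d)) = (J(d | (n : ZMod (4 * d)).val) : ℂ) := if_pos hu
    rw [h2, ZMod.val_natCast, jacobiSym.mod_right (d : ℤ) hodd, Int.natAbs_natCast]
  · rw [(chi d).map_nonunit hu]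
    split_ifs with hodd
    · have h1 : ¬ n.Coprime d := fun h => hu ((ZMod.isUnit_iff_coprime n (4 * d)).mpr
        (Nat.Coprime.mul_right (by
          have := Nat.coprime_two_right.mpr hodd
          exact Nat.Coprime.pow_right 2 this) h))
      have h2 : J((d : ℤ) | n) = 0 := by
        have : NeZero n := ⟨hodd.pos.ne'⟩
        rw [jacobiSym.eq_zero_iff_not_coprime]
        rwa [Int.gcd_natCast_natCast, Nat.gcd_comm]
      rw [h2, Int.cast_zero]
    · rfl

end DoubleDirichlet

namespace DoubleDirichlet

open Complex Filter Topology
open scoped NumberTheorySymbols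

/-! ### The triple series -/

theorem norm_jacobiSym_le (a : ℤ) (n : ℕ) : ‖((J(a | n) : ℤ) : ℂ)‖ ≤ 1 := by
  rcases jacobiSym.trichotomy a n with h | h | h <;> simp [h]

theorem ne_zero_of_coprime {n P : ℕ} (h : n.Coprime P) (hP : Even P) : n ≠ 0 := by
  rintro rfl
  rw [Nat.coprime_zero_left] at h
  subst h
  simp at hP

theorem odd_of_coprime {n P : ℕ} (h : n.Coprime P) (hP : Even P) : Odd n :=
  Nat.coprime_two_right.mp (Nat.Coprime.coprime_dvd_right hP.two_dvd h)

/-- The completely multiplicative function `n ↦ χ(n) n^{-s}`. -/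
noncomputable def twist {q : ℕ} (χ : DirichletCharacter ℂ q) (s : ℂ) (n : ℕ) : ℂ :=
  χ (n : ZMod q) * (n : ℂ) ^ (-s)

theorem twist_one {q : ℕ} (χ : DirichletCharacter ℂ q) (s : ℂ) : twist χ s 1 = 1 := by
  simp [twist]

theorem twist_mul {q : ℕ} (χ : DirichletCharacter ℂ q) (s : ℂ) (m n : ℕ) :
    twist χ s (m * n) = twist χ s m * twist χ s n := by
  rw [twist, twist, twist, Nat.cast_mul, map_mul, Nat.cast_mul, natCast_mul_natCast_cpow]
  ring

theorem twist_pow {q : ℕ} (χ : DirichletCharacter ℂ q) (s : ℂ) (m k : ℕ) :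
    twist χ s (m ^ k) = twist χ s m ^ k := by
  induction k with
  | zero => simp [twist_one]
  | succ k ih => rw [pow_succ, twist_mul, ih, pow_succ]

theorem norm_twist_le {q : ℕ} (χ : DirichletCharacter ℂ q) (s : ℂ) {n : ℕ} (hn : n ≠ 0) :
    ‖twist χ s n‖ ≤ (n : ℝ) ^ (-s.re) := by
  rw [twist, norm_mul, norm_natCast_cpow_of_pos (Nat.pos_of_ne_zero hn), neg_re]
  exact mul_le_of_le_one_left (by positivity) (χ.norm_le_one _)

/-- The terms of the triple series. -/
noncomputable def tripleTerm (P : ℕ) {q q' : ℕ} (χ : DirichletCharacter ℂ q)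
    (χ' : DirichletCharacter ℂ q') (s w : ℂ) (g e m : ℕ) : ℂ :=
  if g.Coprime P ∧ e.Coprime P ∧ m.Coprime P then
    g * twist χ s g ^ 2 * twist χ' w g ^ 2 * twist χ' w e * (J(e | m) * twist χ s m) else 0

section

variable {P q q' : ℕ} (χ : DirichletCharacter ℂ q) (χ' : DirichletCharacter ℂ q') {s w : ℂ}

theorem norm_tripleTerm_le (hP : Even P) (g e m : ℕ) :
    ‖tripleTerm P χ χ' s w g e m‖ ≤
      (g : ℝ) ^ (1 - 2 * s.re - 2 * w.re) * (e : ℝ) ^ (-w.re) * (m : ℝ) ^ (-s.re) := by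
  rw [tripleTerm]
  split_ifs with h
  · have hg := ne_zero_of_coprime h.1 hP
    have he := ne_zero_of_coprime h.2.1 hP
    have hm := ne_zero_of_coprime h.2.2 hP
    have hg' : (0 : ℝ) < g := by positivity
    have h1 : (g : ℝ) ^ (1 - 2 * s.re - 2 * w.re) =
        g * ((g : ℝ) ^ (-s.re)) ^ 2 * ((g : ℝ) ^ (-w.re)) ^ 2 := by
      rw [← Real.rpow_natCast, ← Real.rpow_natCast, ← Real.rpow_mul hg'.le,
        ← Real.rpow_mul hg'.le]
      nth_rw 2 [← Real.rpow_one (g : ℝ)]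
      rw [← Real.rpow_add hg', ← Real.rpow_add hg']
      congr 1
      push_cast
      ring
    rw [h1]
    simp only [norm_mul, norm_pow, norm_natCast]
    have h2 := norm_twist_le χ s hg
    have h3 := norm_twist_le χ' w hg
    have h4 := norm_twist_le χ' w he
    have h5 := norm_twist_le χ s hm
    have h6 := norm_jacobiSym_le e m
    gcongr
    exact (mul_le_of_le_one_left (norm_nonneg _) h6).trans h5
  · rw [norm_zero]
    positivity

theorem summable_tripleTerm (hP : Even P) (hs : 1 < s.re) (hw : 1 < w.re) :
    Summable fun x : (ℕ × ℕ) × ℕ => tripleTerm P χ χ' s w x.1.1 x.1.2 x.2 := by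
  have h1 : Summable fun n : ℕ => (n : ℝ) ^ (1 - 2 * s.re - 2 * w.re) :=
    Real.summable_nat_rpow.mpr (by linarith)
  have h2 : Summable fun n : ℕ => (n : ℝ) ^ (-w.re) := Real.summable_nat_rpow.mpr (by linarith)
  have h3 : Summable fun n : ℕ => (n : ℝ) ^ (-s.re) := Real.summable_nat_rpow.mpr (by linarith)
  have h12 := h1.mul_of_nonneg h2 (fun n => by positivity) (fun n => by positivity)
  have h123 := h12.mul_of_nonneg h3 (fun n => by positivity) (fun n => by positivity)
  exact Summable.of_norm_bounded h123 fun x => norm_tripleTerm_le χ χ' hP _ _ _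

theorem chi_pow_odd {d : ℕ} (hd : d ≠ 0) (p n : ℕ) :
    chi d ((p ^ (2 * n + 1) : ℕ) : ZMod (4 * d)) = chi d (p : ZMod (4 * d)) := by
  rw [Nat.cast_pow, map_pow, chi_natCast hd]
  split_ifs with h
  · rw [pow_succ, pow_mul]
    rcases jacobiSym.trichotomy (d : ℤ) p with h | h | h <;> simp [h]
  · simp

theorem corrP_eq {d₀ d₁ : ℕ} (hd : d₀ ≠ 0) :
    corrP χ d₀ d₁ s = ∏ p ∈ d₁.primeFactors,
      localPoly (chi d₀ (p : ZMod (4 * d₀))) (twist χ s p) p (d₁.factorization p) := by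
  refine Finset.prod_congr rfl fun p hp => ?_
  have hpp := Nat.prime_of_mem_primeFactors hp
  have hp0 : (p : ℂ) ≠ 0 := Nat.cast_ne_zero.mpr hpp.ne_zero
  rw [localPoly]
  congr 1
  · refine Finset.sum_congr rfl fun n _ => ?_
    rw [cpow_sub _ _ hp0, cpow_natCast, twist, mul_pow, Nat.cast_pow, map_pow,
      ← cpow_nat_mul, div_eq_mul_inv, ← cpow_neg]
    push_cast
    rw [show -(2 * (n : ℂ) * s) = 2 * n * -s by ring]
    ring
  · refine Finset.sum_congr rfl fun n _ => ?_
    rw [mul_apply_natCast, chi_pow_odd hd, cpow_sub _ _ hp0, cpow_natCast, twist, mul_pow,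
      Nat.cast_pow, map_pow, ← cpow_nat_mul, div_eq_mul_inv, ← cpow_neg]
    push_cast
    rw [show -((2 * (n : ℂ) + 1) * s) = (2 * n + 1) * -s by ring]
    ring

theorem jacobiSym_mul_sq {a b m : ℕ} (hm : m ≠ 0) :
    (J(((a * b ^ 2 : ℕ) : ℤ) | m) : ℤ) = if m.Coprime b then J((a : ℤ) | m) else 0 := by
  push_cast
  rw [jacobiSym.mul_left]
  split_ifs with h
  · rw [jacobiSym.sq_one' (by rw [Int.gcd_natCast_natCast]; exact h.symm), mul_one]
  · have : NeZero m := ⟨hm⟩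
    have h0 : J((b : ℤ) | m) = 0 := by
      rw [jacobiSym.eq_zero_iff_not_coprime, Int.gcd_natCast_natCast, Nat.gcd_comm]
      exact h
    rw [jacobiSym.pow_left, h0]
    simp

/-- The symbol (e/m) equals (e₀/m) when m is prime to e₁ and vanishes otherwise, so the square part
of e acts by removing Euler factors. -/
theorem hasSum_jacobi [NeZero q] (hP : Even P) (hP0 : P ≠ 0) (hs : 1 < s.re) {e : ℕ} (he : e ≠ 0) :
    HasSum (fun m : ℕ => if m.Coprime P then ((J(e | m) : ℤ) : ℂ) * twist χ s m else 0)
      (LRemoved (P * sqPart e) ((chi (sqfreePart e)).mul χ) s) := by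
  have h0 := sqfreePart_ne_zero e
  have : NeZero (4 * sqfreePart e) := ⟨by omega⟩
  have : NeZero ((4 * sqfreePart e).lcm q) := ⟨Nat.lcm_ne_zero (NeZero.ne _) (NeZero.ne _)⟩
  convert hasSum_LRemoved ((chi (sqfreePart e)).mul χ)
    (mul_ne_zero hP0 (sqPart_ne_zero e)) hs using 1
  funext m
  rw [mul_apply_natCast, chi_natCast h0]
  have hc : m.Coprime (P * sqPart e) ↔ m.Coprime P ∧ m.Coprime (sqPart e) :=
    Nat.coprime_mul_iff_right
  by_cases h1 : m.Coprime P
  · nth_rw 1 [← sqfreePart_mul_sqPart_sq he]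
    rw [jacobiSym_mul_sq (ne_zero_of_coprime h1 hP), if_pos h1, if_pos (odd_of_coprime h1 hP)]
    by_cases h2 : m.Coprime (sqPart e)
    · rw [if_pos h2, if_pos (hc.mpr ⟨h1, h2⟩), twist]
      ring
    · rw [if_neg h2, if_neg fun h => h2 (hc.mp h).2]
      simp
  · rw [if_neg h1, if_neg fun h => h1 (hc.mp h).1]

/-- By `prod_localPoly` the correction polynomial runs over g dividing d₁. The Euler factors at d₁/g
complete the L-value to the series of (e/m)χ(m)m^{-s} with e = d/g², whose squarefree part is still
d₀. -/
theorem zTerm_eq_sum {M N : ℕ} [NeZero q] (hMN : 2 * M * N ≠ 0) (hs : 1 < s.re) (d : ℕ) :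
    zTerm M N χ χ' s w d = ∑ g ∈ (sqPart d).divisors,
      ∑' m, tripleTerm (2 * M * N) χ χ' s w g (d / g ^ 2) m := by
  have hP : Even (2 * M * N) := ⟨M * N, by ring⟩
  set P := 2 * M * N with hPdef
  rw [zTerm, ← hPdef]
  split_ifs with hd
  · have hd0 := ne_zero_of_coprime hd hP
    have h0 := sqfreePart_ne_zero d
    have hX : ∀ p : ℕ, ((chi (sqfreePart d)).mul χ) (p : ZMod ((4 * sqfreePart d).lcm q)) *
        (p : ℂ) ^ (-s) = chi (sqfreePart d) (p : ZMod (4 * sqfreePart d)) * twist χ s p := by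
      intro p
      rw [mul_apply_natCast, twist, mul_assoc]
    rw [corrP_eq χ h0, prod_localPoly (fun p => chi (sqfreePart d) (p : ZMod (4 * sqfreePart d)))
      (twist χ s) (twist_one χ s) (twist_mul χ s) (sqPart_ne_zero d), Finset.mul_sum,
      Finset.sum_div]
    refine Finset.sum_congr rfl fun g hg => ?_
    have hgd := Nat.dvd_of_mem_divisors hg
    have hg2 : g ^ 2 ∣ d := (sq_dvd_iff_dvd_sqPart hd0).mpr hgd
    have hgP : g.Coprime P := Nat.Coprime.coprime_dvd_left ((dvd_pow_self g two_ne_zero).trans hg2) hd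
    have heP : (d / g ^ 2).Coprime P := Nat.Coprime.coprime_dvd_left (Nat.div_dvd_of_dvd hg2) hd
    have he0 := ne_zero_of_coprime heP hP
    have hS := (hasSum_jacobi χ hP hMN hs he0).mul_left
      (g * twist χ s g ^ 2 * twist χ' w g ^ 2 * twist χ' w (d / g ^ 2))
    have hT : ∀ m, tripleTerm P χ χ' s w g (d / g ^ 2) m =
        (g * twist χ s g ^ 2 * twist χ' w g ^ 2 * twist χ' w (d / g ^ 2)) *
        (if m.Coprime P then ((J((d / g ^ 2 : ℕ) | m) : ℤ) : ℂ) * twist χ s m else 0) := by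
      intro m
      rw [tripleTerm]
      by_cases hm : m.Coprime P
      · rw [if_pos ⟨hgP, heP, hm⟩, if_pos hm]
      · rw [if_neg fun h => hm h.2.2, if_neg hm, mul_zero]
    rw [tsum_congr hT, hS.tsum_eq, sqfreePart_div_sq hd0 hgd, sqPart_div_sq hd0 hgd,
      ← LRemoved_mul_prod _ (Nat.Coprime.coprime_dvd_right ((Nat.div_dvd_of_dvd hgd).trans
        ((dvd_pow_self _ two_ne_zero).trans ⟨sqfreePart d,
          by rw [mul_comm, sqfreePart_mul_sqPart_sq hd0]⟩)) hd.symm)]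
    simp only [hX]
    have h3 : χ' (d : ZMod q') / (d : ℂ) ^ w = twist χ' w g ^ 2 * twist χ' w (d / g ^ 2) := by
      rw [← twist_pow, ← twist_mul, Nat.mul_div_cancel' hg2, twist, cpow_neg, div_eq_mul_inv]
    linear_combination (LRemoved P ((chi (sqfreePart d)).mul χ) s * g * twist χ s g ^ 2 *
      ∏ p ∈ (sqPart d / g).primeFactors,
        (1 - chi (sqfreePart d) (p : ZMod (4 * sqfreePart d)) * twist χ s p)) * h3
  · refine (Finset.sum_eq_zero fun g hg => ?_).symm
    rw [← tsum_zero (α := ℂ) (β := ℕ)]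
    refine tsum_congr fun m => if_neg fun h => hd ?_
    by_cases hd0 : d = 0
    · subst hd0
      simpa using h.2.1
    have hg2 : g ^ 2 ∣ d := (sq_dvd_iff_dvd_sqPart hd0).mpr (Nat.dvd_of_mem_divisors hg)
    rw [← Nat.mul_div_cancel' hg2]
    exact (h.1.pow_left 2).mul_left h.2.1

/-- The terms of the series over pairs. -/
noncomputable def pairTerm (P : ℕ) {q q' : ℕ} (χ : DirichletCharacter ℂ q)
    (χ' : DirichletCharacter ℂ q') (L : ℕ → ℂ → ℂ) (s w : ℂ) (x : ℕ × ℕ) : ℂ :=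
  if x.1.Coprime P ∧ x.2.Coprime P then
    x.1 * twist χ s x.1 ^ 2 * twist χ' w x.1 ^ 2 * (twist χ s x.2 * L x.2 w) else 0

/-- Absolute convergence of the triple sum allows interchanging e and m (the equivalence `E`), so
that the inner sum becomes an L-function in w. -/
theorem hasSum_zTerm {M N : ℕ} [NeZero q] (hMN : 2 * M * N ≠ 0) (hs : 1 < s.re) (hw : 1 < w.re)
    {L : ℕ → ℂ → ℂ} (hL : ∀ m : ℕ, m.Coprime (2 * M * N) → HasSum (fun e : ℕ =>
      if e.Coprime (2 * M * N) then ((J(e | m) : ℤ) : ℂ) * twist χ' w e else 0) (L m w)) :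
    HasSum (zTerm M N χ χ' s w) (∑' x, pairTerm (2 * M * N) χ χ' L s w x) := by
  have hP : Even (2 * M * N) := ⟨M * N, by ring⟩
  set P := 2 * M * N with hPdef
  have hsum := summable_tripleTerm χ χ' hP hs hw
  have h1 := hsum.hasSum.prod_fiberwise fun x => (hsum.prod_factor x).hasSum
  have h2 := hasSum_sq_mul (h := fun g e => ∑' m, tripleTerm P χ χ' s w g e m) h1 (by
    intro g e hge
    rw [← tsum_zero (α := ℂ) (β := ℕ)]
    refine tsum_congr fun m => if_neg fun h => ?_
    rcases hge with hge | hge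
    · exact ne_zero_of_coprime h.1 hP hge
    · exact ne_zero_of_coprime h.2.1 hP hge)
  have h3 : zTerm M N χ χ' s w = fun d => ∑ g ∈ (sqPart d).divisors,
      ∑' m, tripleTerm P χ χ' s w g (d / g ^ 2) m := funext fun d => zTerm_eq_sum χ χ' hMN hs d
  rw [h3]
  convert h2 using 1
  let E : (ℕ × ℕ) × ℕ ≃ (ℕ × ℕ) × ℕ :=
    ⟨fun x => ((x.1.1, x.2), x.1.2), fun x => ((x.1.1, x.2), x.1.2), fun _ => rfl, fun _ => rfl⟩
  have h4 := (E.hasSum_iff (f := fun x : (ℕ × ℕ) × ℕ => tripleTerm P χ χ' s w x.1.1 x.1.2 x.2)).mpr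
    hsum.hasSum
  have h5 := h4.summable
  have h6 := (h4.prod_fiberwise fun x => (h5.prod_factor x).hasSum).tsum_eq
  rw [← h6]
  refine tsum_congr fun x => ?_
  rw [pairTerm]
  split_ifs with hx
  · have h7 := (hL x.2 hx.2).mul_left (x.1 * twist χ s x.1 ^ 2 * twist χ' w x.1 ^ 2 * twist χ s x.2)
    rw [← mul_assoc, ← h7.tsum_eq]
    refine tsum_congr fun e => ?_
    simp only [Function.comp_apply, E, Equiv.coe_fn_mk, tripleTerm]
    by_cases he : e.Coprime P
    · rw [if_pos he, if_pos ⟨hx.1, he, hx.2⟩]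
      ring
    · rw [if_neg he, if_neg fun h => he h.2.1, mul_zero]
  · rw [← tsum_zero (α := ℂ) (β := ℕ)]
    exact (tsum_congr fun e => if_neg fun h => hx ⟨h.1, h.2.2⟩).symm

end

end DoubleDirichlet

/-! ### Analytic continuation and its uniqueness. -/

namespace DoubleDirichlet

open Complex Filter Topology Metric
open scoped NumberTheorySymbols

/-! ### Series of holomorphic functions of two variables -/

/-- The one-variable Cauchy estimate on complex lines through x; it justifies differentiating series
of functions of two variables term by term. -/
theorem norm_fderiv_le {F : ℂ × ℂ → ℂ} {x : ℂ × ℂ} {r C : ℝ} (hr : 0 < r)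
    (hd : DifferentiableOn ℂ F (ball x r)) (hb : ∀ y ∈ ball x r, ‖F y‖ ≤ C) :
    ‖fderiv ℂ F x‖ ≤ C * (2 / r) := by
  have hC : 0 ≤ C := (norm_nonneg _).trans (hb x (mem_ball_self hr))
  refine ContinuousLinearMap.opNorm_le_bound _ (by positivity) fun v => ?_
  by_cases hv : v = 0
  · simp [hv]
  have hv0 : 0 < ‖v‖ := norm_pos_iff.mpr hv
  have hmem : ∀ t : ℂ, ‖t‖ ≤ r / 2 / ‖v‖ → x + t • v ∈ ball x r := by
    intro t ht
    rw [mem_ball, dist_eq_norm, add_sub_cancel_left, norm_smul]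
    calc ‖t‖ * ‖v‖ ≤ r / 2 / ‖v‖ * ‖v‖ := by gcongr
      _ = r / 2 := by field_simp
      _ < r := by linarith
  have hg : HasDerivAt (fun t : ℂ => F (x + t • v)) (fderiv ℂ F x v) 0 := by
    have h1 : HasFDerivAt F (fderiv ℂ F x) (x + (0 : ℂ) • v) := by
      rw [zero_smul, add_zero]
      exact (hd.differentiableAt (ball_mem_nhds x hr)).hasFDerivAt
    have h2 : HasDerivAt (fun t : ℂ => x + t • v) v 0 := by
      simpa using ((hasDerivAt_id (0 : ℂ)).smul_const v).const_add x
    exact h1.comp_hasDerivAt (0 : ℂ) h2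
  have hdiff : DiffContOnCl ℂ (fun t : ℂ => F (x + t • v)) (ball 0 (r / 2 / ‖v‖)) := by
    refine DifferentiableOn.diffContOnCl fun t ht => ?_
    have ht' : ‖t‖ ≤ r / 2 / ‖v‖ := by
      have := closure_ball_subset_closedBall ht
      simpa using this
    have h1 : DifferentiableAt ℂ F (x + t • v) :=
      hd.differentiableAt (isOpen_ball.mem_nhds (hmem t ht'))
    exact (DifferentiableAt.comp (f := fun t : ℂ => x + t • v) t h1
      (by fun_prop)).differentiableWithinAt
  have h3 := norm_deriv_le_of_forall_mem_sphere_norm_le (C := C) (by positivity) hdiff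
    fun t ht => hb _ (hmem t (by simpa using ht.le))
  rw [hg.deriv] at h3
  refine h3.trans (le_of_eq ?_)
  field_simp

theorem differentiableAt_tsum {ι : Type*} {F : ι → ℂ × ℂ → ℂ} {x₀ : ℂ × ℂ} {R : ℝ} (hR : 0 < R)
    {u : ι → ℝ} (hu : Summable u) (hd : ∀ i, DifferentiableOn ℂ (F i) (ball x₀ R))
    (hb : ∀ i, ∀ x ∈ ball x₀ R, ‖F i x‖ ≤ u i) :
    DifferentiableAt ℂ (fun x => ∑' i, F i x) x₀ := by
  have hsub : ∀ x ∈ ball x₀ (R / 2), ball x (R / 2) ⊆ ball x₀ R := by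
    intro x hx
    refine ball_subset_ball' ?_
    rw [mem_ball] at hx
    linarith
  refine (hasFDerivAt_tsum_of_isPreconnected (x₀ := x₀) (hu.mul_right (2 / (R / 2)))
    (isOpen_ball (x := x₀) (ε := R / 2)) (convex_ball x₀ (R / 2)).isPreconnected
    (f' := fun i x => fderiv ℂ (F i) x) ?_ ?_ (mem_ball_self (by positivity)) ?_
    (mem_ball_self (by positivity))).differentiableAt
  · intro i x hx
    exact ((hd i).differentiableAt (isOpen_ball.mem_nhds
      (hsub x hx (mem_ball_self (by positivity))))).hasFDerivAt
  · intro i x hx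
    exact norm_fderiv_le (by positivity) ((hd i).mono (hsub x hx)) fun y hy =>
      hb i y (hsub x hx hy)
  · exact Summable.of_norm_bounded hu fun i => hb i x₀ (mem_ball_self hR)

/-! ### The region of continuation -/

/-- The region is where n^{-s}, weighted by the convexity bound for the L-function in w, is
summable; the three pieces of the union correspond to the three terms of the maximum. -/
theorem mem_R12_iff {s w : ℂ} : (s, w) ∈ R12 ↔ 1 + convexityExponent w.re < s.re := by
  have h : 1 + convexityExponent w.re < s.re ↔
      0 < s.re - 1 ∧ (1 - w.re) / 2 < s.re - 1 ∧ 1 / 2 - w.re < s.re - 1 := by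
    rw [← lt_sub_iff_add_lt', convexityExponent, max_lt_iff, max_lt_iff, and_assoc]
  rw [h]
  simp only [R12, Set.mem_union, Set.mem_ofPred_eq]
  constructor
  · rintro ((⟨h1, h2⟩ | ⟨h1, h2, h3⟩) | ⟨h1, h2⟩) <;> refine ⟨?_, ?_, ?_⟩ <;> linarith
  · rintro ⟨h1, h2, h3⟩
    rcases le_or_gt w.re 0 with h4 | h4
    · exact Or.inl (Or.inl ⟨h4, by linarith⟩)
    rcases le_or_gt w.re 1 with h5 | h5
    · exact Or.inl (Or.inr ⟨h4, h5, by linarith⟩)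
    · exact Or.inr ⟨by linarith, h5⟩

theorem continuous_convexityExponent : Continuous convexityExponent := by
  unfold convexityExponent
  fun_prop

theorem isOpen_R12 : IsOpen R12 := by
  have h : R12 = {x : ℂ × ℂ | 1 + convexityExponent x.2.re < x.1.re} := by
    ext ⟨s, w⟩
    exact mem_R12_iff
  rw [h]
  exact isOpen_lt (continuous_const.add (continuous_convexityExponent.comp
    (continuous_re.comp continuous_snd))) (continuous_re.comp continuous_fst)

theorem isOpen_R12_diff : IsOpen (R12 \ {x | x.2 = 1}) :=
  isOpen_R12.sdiff (isClosed_eq continuous_snd continuous_const)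

/-- The reflection exchanges the conditions Re s > 1 and Re s + Re w > 3/2 and fixes the middle one.
-/
theorem R12_reflect {s w : ℂ} (h : (s, w) ∈ R12) : (s + w - 1 / 2, 1 - w) ∈ R12 := by
  rw [mem_R12_iff, convexityExponent, ← lt_sub_iff_add_lt', max_lt_iff, max_lt_iff] at h ⊢
  obtain ⟨⟨h1, h2⟩, h3⟩ := h
  have e1 : (s + w - 1 / 2).re = s.re + w.re - 1 / 2 := by
    rw [sub_re, add_re]; norm_num
  rw [e1, sub_re, one_re]
  refine ⟨⟨?_, ?_⟩, ?_⟩ <;> linarith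

/-! ### Uniqueness of the continuation -/

theorem convex_slice (σ : ℝ) : Convex ℝ {w : ℂ | 1 + convexityExponent w.re < σ} := by
  have h : {w : ℂ | 1 + convexityExponent w.re < σ} =
      {_w : ℂ | 0 < σ - 1} ∩ {w : ℂ | 1 - 2 * (σ - 1) < w.re} ∩ {w : ℂ | 1 / 2 - (σ - 1) < w.re} := by
    ext w
    simp only [Set.mem_ofPred_eq, Set.mem_inter_iff]
    rw [← lt_sub_iff_add_lt', convexityExponent, max_lt_iff, max_lt_iff]
    constructor
    · rintro ⟨⟨h1, h2⟩, h3⟩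
      refine ⟨⟨?_, ?_⟩, ?_⟩ <;> linarith
    · rintro ⟨⟨h1, h2⟩, h3⟩
      refine ⟨⟨?_, ?_⟩, ?_⟩ <;> linarith
  rw [h]
  refine ((?_ : Convex ℝ {_w : ℂ | 0 < σ - 1}).inter (convex_halfSpace_re_gt _)).inter
    (convex_halfSpace_re_gt _)
  by_cases hσ : 0 < σ - 1
  · simp [hσ, convex_univ]
  · simp [hσ, convex_empty]

/-- For fixed s the slice in w is convex. To stay away from w = 1, the identity theorem is applied
in the upper and lower half-planes separately, both of which meet Re w > 1. Real w follow by
continuity. -/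
theorem IsContinuation.eq {M N q q' : ℕ} {χ : DirichletCharacter ℂ q}
    {χ' : DirichletCharacter ℂ q'} {f g : ℂ × ℂ → ℂ} (hf : IsContinuation M N χ χ' f)
    (hg : IsContinuation M N χ χ' g) {s w : ℂ} (hsw : (s, w) ∈ R12) (hw : w ≠ 1) :
    f (s, w) = g (s, w) := by
  have hs : 1 < s.re := by
    have := mem_R12_iff.mp hsw
    have h0 : 0 ≤ convexityExponent w.re := (le_max_left _ _).trans (le_max_left _ _)
    linarith
  have hsame : ∀ w' : ℂ, 1 < w'.re → f (s, w') = g (s, w') := fun w' hw' =>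
    (hf.hasSum s w' hs hw').unique (hg.hasSum s w' hs hw')
  set V : Set ℂ := {w : ℂ | 1 + convexityExponent w.re < s.re} with hV
  have hVopen : IsOpen V := isOpen_lt (continuous_const.add (continuous_convexityExponent.comp
    continuous_re)) continuous_const
  have hdiff : ∀ {h : ℂ × ℂ → ℂ}, IsContinuation M N χ χ' h → ∀ z ∈ V, z ≠ 1 →
      DifferentiableAt ℂ (fun z => h (s, z)) z := by
    intro h hh z hz hz1
    have h1 : DifferentiableAt ℂ h (s, z) := hh.holomorphic.differentiableAt
      (isOpen_R12_diff.mem_nhds ⟨mem_R12_iff.mpr hz, hz1⟩)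
    exact DifferentiableAt.comp (f := fun z : ℂ => (s, z)) z h1 (by fun_prop)
  -- the two half-planes
  have hhalf : ∀ H : Set ℂ, IsOpen H → Convex ℝ H → (1 : ℂ) ∉ H → (∃ z ∈ H, 1 < z.re) →
      ∀ z ∈ V ∩ H, f (s, z) = g (s, z) := by
    intro H hHo hHc hH1 hHne z hz
    obtain ⟨z₁, hz₁, hz₁re⟩ := hHne
    have hz₁V : z₁ ∈ V := by
      rw [hV, Set.mem_ofPred_eq, convexityExponent, ← lt_sub_iff_add_lt', max_lt_iff, max_lt_iff]
      refine ⟨⟨?_, ?_⟩, ?_⟩ <;> linarith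
    have hopen : IsOpen (V ∩ H) := hVopen.inter hHo
    have han : ∀ {h : ℂ × ℂ → ℂ}, IsContinuation M N χ χ' h →
        AnalyticOnNhd ℂ (fun z => h (s, z)) (V ∩ H) := fun hh =>
      DifferentiableOn.analyticOnNhd (fun z hz => (hdiff hh z hz.1 (by
        rintro rfl; exact hH1 hz.2)).differentiableWithinAt) hopen
    refine (han hf).eqOn_of_preconnected_of_eventuallyEq (han hg)
      ((convex_slice s.re).inter hHc).isPreconnected ⟨hz₁V, hz₁⟩ ?_ hz
    filter_upwards [(isOpen_lt continuous_const continuous_re).mem_nhds hz₁re] with z' hz'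
    exact hsame z' hz'
  have him : ∀ z ∈ V, z.im ≠ 0 → f (s, z) = g (s, z) := by
    intro z hz hz0
    rcases lt_or_gt_of_ne hz0 with h | h
    · exact hhalf {z | z.im < 0} (isOpen_lt continuous_im continuous_const)
        (convex_halfSpace_im_lt 0) (by simp) ⟨2 - I, by simp, by simp⟩ z ⟨hz, h⟩
    · exact hhalf {z | 0 < z.im} (isOpen_lt continuous_const continuous_im)
        (convex_halfSpace_im_gt 0) (by simp) ⟨2 + I, by simp, by simp⟩ z ⟨hz, h⟩
  have hwV : w ∈ V := mem_R12_iff.mp hsw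
  have := neBot_nhdsWithin_genericSet w
  have hev : ∀ᶠ z in 𝓝[genericSet] w, f (s, z) = g (s, z) := by
    filter_upwards [nhdsWithin_le_nhds (hVopen.mem_nhds hwV), self_mem_nhdsWithin] with z hz hzg
    exact him z hz hzg.1
  have hl1 := (hdiff hf w hwV hw).continuousAt.tendsto.mono_left
    (nhdsWithin_le_nhds (s := genericSet))
  have hl2 := (hdiff hg w hwV hw).continuousAt.tendsto.mono_left
    (nhdsWithin_le_nhds (s := genericSet))
  exact tendsto_nhds_unique (hl1.congr' hev) hl2

/-! ### Existence of the continuation -/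

/-- A family of functions `L m` continuing `∑_e (e / m) χ'(e) e^{-w}`, with convexity bounds. -/
structure CoeffFamily (P : ℕ) {q' : ℕ} (χ' : DirichletCharacter ℂ q') (L : ℕ → ℂ → ℂ) :
    Prop where
  hasSum : ∀ m : ℕ, m.Coprime P → ∀ w : ℂ, 1 < w.re → HasSum (fun e : ℕ =>
    if e.Coprime P then ((J(e | m) : ℤ) : ℂ) * twist χ' w e else 0) (L m w)
  differentiableAt : ∀ m : ℕ, m.Coprime P → ∀ w : ℂ, w ≠ 1 → DifferentiableAt ℂ (L m) w
  bound : ∀ w₀ : ℂ, w₀ ≠ 1 → ∀ e, convexityExponent w₀.re < e → ∃ r, 0 < r ∧ ∃ C,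
    ∀ m : ℕ, m.Coprime P → ∀ w : ℂ, ‖w - w₀‖ < r →
      ‖L m w‖ ≤ C * ((sqfreePart m : ℝ) ^ e * (sqPart m : ℝ) ^ (1 + 2 * e))

/-- As m ↦ (m₀, m₁) is injective, the sum is part of a product of two convergent zeta sums. -/
theorem summable_sqfreePart_sqPart {a b : ℝ} (ha : a < -1) (hb : b < -1) :
    Summable fun m : ℕ => if m = 0 then 0 else (sqfreePart m : ℝ) ^ a * (sqPart m : ℝ) ^ b := by
  have h1 := (Real.summable_nat_rpow.mpr ha).mul_of_nonneg (Real.summable_nat_rpow.mpr hb)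
    (fun n => by positivity) (fun n => by positivity)
  have h2 : Function.Injective fun m : ℕ => if m = 0 then (0, 0) else (sqfreePart m, sqPart m) := by
    intro m n hmn
    dsimp only at hmn
    have h0 := sqfreePart_ne_zero
    split_ifs at hmn with hm hn hn
    · rw [hm, hn]
    · exact absurd (Prod.mk.inj hmn).1.symm (h0 n)
    · exact absurd (Prod.mk.inj hmn).1 (h0 m)
    · rw [← sqfreePart_mul_sqPart_sq hm, ← sqfreePart_mul_sqPart_sq hn, (Prod.mk.inj hmn).1,
        (Prod.mk.inj hmn).2]
  refine (h1.comp_injective h2).congr fun m => ?_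
  rw [Function.comp_apply]
  split_ifs with hm
  · rw [Nat.cast_zero, Real.zero_rpow (by linarith), zero_mul]
  · rfl

section

variable {P q q' : ℕ} (χ : DirichletCharacter ℂ q) {χ' : DirichletCharacter ℂ q'}
  {L : ℕ → ℂ → ℂ}

theorem CoeffFamily.exists_bound (hL : CoeffFamily P χ' L) (hP : Even P) {s₀ w₀ : ℂ}
    (hsw : (s₀, w₀) ∈ R12) (hw₀ : w₀ ≠ 1) :
    ∃ ρ, 0 < ρ ∧ ∃ u : ℕ × ℕ → ℝ, Summable u ∧ ∀ s w : ℂ, ‖s - s₀‖ < ρ → ‖w - w₀‖ < ρ →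
      ∀ x, ‖pairTerm P χ χ' L s w x‖ ≤ u x := by
  rw [mem_R12_iff] at hsw
  set θ := convexityExponent w₀.re with hθ
  -- Halfway between the convexity exponent and Re s₀ - 1, so that the slack η is positive; half of
  -- η pays for moving s, the rest for convergence in m.
  set e := (θ + (s₀.re - 1)) / 2 with he
  set η := s₀.re - 1 - e with hη
  have hη0 : 0 < η := by rw [hη, he]; linarith
  -- Convergence in g: the exponent is 1 - 2Re s - 2Re w, that is, -1 - 2κ at the centre, and it
  -- stays at most -1 - κ nearby.
  have hκ : 0 < s₀.re + w₀.re - 1 := by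
    have h1 : (0 : ℝ) ≤ θ := (le_max_left _ _).trans (le_max_left _ _)
    have h3 : 1 / 2 - w₀.re ≤ θ := le_max_right _ _
    rcases le_total 0 w₀.re with h | h <;> linarith
  set κ := s₀.re + w₀.re - 1 with hκdef
  obtain ⟨r, hr, C, hC⟩ := hL.bound w₀ hw₀ e (by rw [he]; linarith)
  refine ⟨min r (min (η / 2) (κ / 4)), by positivity,
    fun x => (x.1 : ℝ) ^ (-1 - κ) * (|C| * (if x.2 = 0 then 0 else
      (sqfreePart x.2 : ℝ) ^ (-1 - η / 2) * (sqPart x.2 : ℝ) ^ (-1 - η))), ?_, ?_⟩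
  · refine Summable.mul_of_nonneg (f := fun n : ℕ => (n : ℝ) ^ (-1 - κ))
      (g := fun m : ℕ => |C| * (if m = 0 then 0 else
      (sqfreePart m : ℝ) ^ (-1 - η / 2) * (sqPart m : ℝ) ^ (-1 - η)))
      (Real.summable_nat_rpow.mpr (by linarith))
      ((summable_sqfreePart_sqPart (by linarith) (by linarith)).mul_left _)
      (fun n => by positivity) fun m => ?_
    refine mul_nonneg (abs_nonneg _) ?_
    split_ifs
    · exact le_rfl
    · positivity
  · rintro s w hs hw ⟨g, m⟩
    have hsre : |s.re - s₀.re| < min (η / 2) (κ / 4) := by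
      have := abs_re_le_norm (s - s₀)
      rw [sub_re] at this
      exact this.trans_lt (hs.trans_le (min_le_right _ _))
    have hwre : |w.re - w₀.re| < min (η / 2) (κ / 4) := by
      have := abs_re_le_norm (w - w₀)
      rw [sub_re] at this
      exact this.trans_lt (hw.trans_le (min_le_right _ _))
    rw [lt_min_iff, abs_lt, abs_lt] at hsre hwre
    rw [pairTerm]
    split_ifs with h
    · have hg0 := ne_zero_of_coprime h.1 hP
      have hm0 := ne_zero_of_coprime h.2 hP
      dsimp only at hg0 hm0 ⊢
      have hg1 : (1 : ℝ) ≤ g := by exact_mod_cast Nat.one_le_iff_ne_zero.mpr hg0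
      have hm1 : (1 : ℝ) ≤ m := by exact_mod_cast Nat.one_le_iff_ne_zero.mpr hm0
      have hgp : (0 : ℝ) < g := by linarith
      have h1 := hC m h.2 w (hw.trans_le (min_le_left _ _))
      have h2 := norm_twist_le χ s hg0
      have h3 := norm_twist_le χ' w hg0
      have h4 := norm_twist_le χ s hm0
      have h5 : (g : ℝ) * ((g : ℝ) ^ (-s.re)) ^ 2 * ((g : ℝ) ^ (-w.re)) ^ 2 ≤ g ^ (-1 - κ) := by
        rw [← Real.rpow_natCast, ← Real.rpow_natCast, ← Real.rpow_mul hgp.le,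
          ← Real.rpow_mul hgp.le]
        nth_rw 1 [← Real.rpow_one (g : ℝ)]
        rw [← Real.rpow_add hgp, ← Real.rpow_add hgp]
        refine Real.rpow_le_rpow_of_exponent_le hg1 ?_
        push_cast
        linarith [hsre.2.1, hwre.2.1]
      have hA := sqfreePart_ne_zero m
      have hB := sqPart_ne_zero m
      have hAp : (0 : ℝ) < sqfreePart m := by positivity
      have hBp : (0 : ℝ) < sqPart m := by positivity
      have h6 : (m : ℝ) ^ (-s.re) * (|C| * ((sqfreePart m : ℝ) ^ e *
          (sqPart m : ℝ) ^ (1 + 2 * e))) ≤ |C| * ((sqfreePart m : ℝ) ^ (-1 - η / 2) *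
          (sqPart m : ℝ) ^ (-1 - η)) := by
        have h7 : (m : ℝ) ^ (-s.re) ≤ (sqfreePart m : ℝ) ^ (-(1 + e + η / 2)) *
            (sqPart m : ℝ) ^ (2 * -(1 + e + η / 2)) := by
          calc (m : ℝ) ^ (-s.re) ≤ (m : ℝ) ^ (-(1 + e + η / 2)) := by
                refine Real.rpow_le_rpow_of_exponent_le hm1 ?_
                linarith [hsre.1.1]
            _ = _ := by
                nth_rw 1 [← sqfreePart_mul_sqPart_sq hm0]
                push_cast
                rw [Real.mul_rpow hAp.le (by positivity), ← Real.rpow_natCast,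
                  ← Real.rpow_mul hBp.le]
                norm_num
        calc _ ≤ (sqfreePart m : ℝ) ^ (-(1 + e + η / 2)) *
              (sqPart m : ℝ) ^ (2 * -(1 + e + η / 2)) * (|C| * ((sqfreePart m : ℝ) ^ e *
              (sqPart m : ℝ) ^ (1 + 2 * e))) := by gcongr
          _ = |C| * (((sqfreePart m : ℝ) ^ (-(1 + e + η / 2)) * (sqfreePart m : ℝ) ^ e) *
              ((sqPart m : ℝ) ^ (2 * -(1 + e + η / 2)) * (sqPart m : ℝ) ^ (1 + 2 * e))) := by ring
          _ = _ := by
              rw [← Real.rpow_add hAp, ← Real.rpow_add hBp]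
              congr 3 <;> ring
      rw [if_neg hm0]
      simp only [norm_mul, norm_pow, norm_natCast]
      have h8 : ‖L m w‖ ≤ |C| * ((sqfreePart m : ℝ) ^ e * (sqPart m : ℝ) ^ (1 + 2 * e)) :=
        h1.trans (mul_le_mul_of_nonneg_right (le_abs_self C) (by positivity))
      calc _ ≤ (g : ℝ) * ((g : ℝ) ^ (-s.re)) ^ 2 * ((g : ℝ) ^ (-w.re)) ^ 2 *
            ((m : ℝ) ^ (-s.re) * (|C| * ((sqfreePart m : ℝ) ^ e *
            (sqPart m : ℝ) ^ (1 + 2 * e)))) := by gcongr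
        _ ≤ _ := by gcongr
    · rw [norm_zero]
      refine mul_nonneg (by positivity) (mul_nonneg (abs_nonneg _) ?_)
      split_ifs
      · exact le_rfl
      · positivity

theorem differentiableAt_twist (s : ℂ) {n : ℕ} (hn : n ≠ 0) :
    DifferentiableAt ℂ (fun s => twist χ s n) s :=
  ((differentiable_natCast_cpow hn (g := fun s => -s) (by fun_prop)).const_mul _) s

theorem CoeffFamily.differentiableAt_pairTerm (hL : CoeffFamily P χ' L) (hP : Even P)
    (x : ℕ × ℕ) {y : ℂ × ℂ} (hy : y.2 ≠ 1) :
    DifferentiableAt ℂ (fun y : ℂ × ℂ => pairTerm P χ χ' L y.1 y.2 x) y := by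
  unfold pairTerm
  split_ifs with h
  · have hg0 := ne_zero_of_coprime h.1 hP
    have hm0 := ne_zero_of_coprime h.2 hP
    have h1 : DifferentiableAt ℂ (fun y : ℂ × ℂ => twist χ y.1 x.1) y :=
      (differentiableAt_twist χ y.1 hg0).comp (f := Prod.fst) y differentiableAt_fst
    have h2 : DifferentiableAt ℂ (fun y : ℂ × ℂ => twist χ' y.2 x.1) y :=
      (differentiableAt_twist χ' y.2 hg0).comp (f := Prod.snd) y differentiableAt_snd
    have h3 : DifferentiableAt ℂ (fun y : ℂ × ℂ => twist χ y.1 x.2) y :=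
      (differentiableAt_twist χ y.1 hm0).comp (f := Prod.fst) y differentiableAt_fst
    have h4 : DifferentiableAt ℂ (fun y : ℂ × ℂ => L x.2 y.2) y :=
      (hL.differentiableAt x.2 h.2 y.2 hy).comp (f := Prod.snd) y differentiableAt_snd
    exact (((h1.pow 2).const_mul _).mul (h2.pow 2)).mul (h3.mul h4)
  · exact differentiableAt_const _

/-- The coefficient of `χ(n) n^{-s}` in the double Dirichlet series. -/
noncomputable def rowCoeff {q' : ℕ} (χ' : DirichletCharacter ℂ q') (L : ℕ → ℂ → ℂ) (n : ℕ)
    (w : ℂ) : ℂ :=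
  ∑ g ∈ (sqPart n).divisors, g * twist χ' w g ^ 2 * L (n / g ^ 2) w

theorem sum_pairTerm (hP : Even P) (s w : ℂ) (n : ℕ) :
    ∑ g ∈ (sqPart n).divisors, pairTerm P χ χ' L s w (g, n / g ^ 2) =
      if n.Coprime P then twist χ s n * rowCoeff χ' L n w else 0 := by
  split_ifs with h
  · rw [rowCoeff, Finset.mul_sum]
    have hn0 := ne_zero_of_coprime h hP
    refine Finset.sum_congr rfl fun g hg => ?_
    have hg2 : g ^ 2 ∣ n := (sq_dvd_iff_dvd_sqPart hn0).mpr (Nat.dvd_of_mem_divisors hg)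
    rw [pairTerm, if_pos ⟨Nat.Coprime.coprime_dvd_left ((dvd_pow_self g two_ne_zero).trans hg2) h,
      Nat.Coprime.coprime_dvd_left (Nat.div_dvd_of_dvd hg2) h⟩]
    have h1 : twist χ s n = twist χ s g ^ 2 * twist χ s (n / g ^ 2) := by
      rw [← twist_pow, ← twist_mul, Nat.mul_div_cancel' hg2]
    rw [h1]
    ring
  · refine Finset.sum_eq_zero fun g hg => if_neg fun hc => h ?_
    by_cases hn0 : n = 0
    · subst hn0
      simpa using hc.2
    have hg2 : g ^ 2 ∣ n := (sq_dvd_iff_dvd_sqPart hn0).mpr (Nat.dvd_of_mem_divisors hg)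
    rw [← Nat.mul_div_cancel' hg2]
    exact (hc.1.pow_left 2).mul_left hc.2

theorem CoeffFamily.hasSum_rowCoeff (hL : CoeffFamily P χ' L) (hP : Even P) {s w : ℂ}
    (hsw : (s, w) ∈ R12) (hw : w ≠ 1) :
    HasSum (fun n : ℕ => if n.Coprime P then twist χ s n * rowCoeff χ' L n w else 0)
      (∑' x, pairTerm P χ χ' L s w x) := by
  obtain ⟨ρ, hρ, u, hu, hb⟩ := hL.exists_bound χ hP hsw hw
  have h1 : Summable (pairTerm P χ χ' L s w) :=
    Summable.of_norm_bounded hu (hb s w (by simpa using hρ) (by simpa using hρ))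
  have h2 := hasSum_sq_mul (h := fun g m => pairTerm P χ χ' L s w (g, m)) h1.hasSum
    fun g m hgm => if_neg fun h => by
      rcases hgm with hgm | hgm
      · exact ne_zero_of_coprime h.1 hP hgm
      · exact ne_zero_of_coprime h.2 hP hgm
  convert h2 using 1
  funext n
  exact (sum_pairTerm χ hP s w n).symm

theorem CoeffFamily.isContinuation [NeZero q] {M N : ℕ} (hMN : 2 * M * N ≠ 0)
    (hL : CoeffFamily (2 * M * N) χ' L) :
    IsContinuation M N χ χ' fun x => ∑' y, pairTerm (2 * M * N) χ χ' L x.1 x.2 y := by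
  have hP : Even (2 * M * N) := ⟨M * N, by ring⟩
  refine ⟨fun x hx => ?_, fun s w hs hw => ?_⟩
  · obtain ⟨ρ, hρ, u, hu, hb⟩ := hL.exists_bound χ hP (s₀ := x.1) (w₀ := x.2) hx.1 hx.2
    have hx1 : 0 < ‖x.2 - 1‖ := norm_pos_iff.mpr (sub_ne_zero.mpr hx.2)
    refine (differentiableAt_tsum (R := min ρ ‖x.2 - 1‖) (by positivity) hu (fun i y hy => ?_)
      fun i y hy => ?_).differentiableWithinAt
    · refine (hL.differentiableAt_pairTerm χ hP i fun h => ?_).differentiableWithinAt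
      rw [mem_ball, dist_eq_norm] at hy
      have := (norm_snd_le (y - x)).trans_lt (hy.trans_le (min_le_right _ _))
      rw [Prod.snd_sub, h, norm_sub_rev] at this
      exact lt_irrefl _ this
    · rw [mem_ball, dist_eq_norm] at hy
      have hy' := hy.trans_le (min_le_left _ _)
      exact hb y.1 y.2 ((norm_fst_le (y - x)).trans_lt hy') ((norm_snd_le (y - x)).trans_lt hy') i
  · exact hasSum_zTerm χ χ' hMN hs hw fun m hm => hL.hasSum m hm w hw

theorem CoeffFamily.isContinuation_Z [NeZero q] {M N : ℕ} (hMN : 2 * M * N ≠ 0)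
    (hL : CoeffFamily (2 * M * N) χ' L) : IsContinuation M N χ χ' (Z M N χ χ') :=
  Classical.epsilon_spec ⟨_, hL.isContinuation χ hMN⟩

theorem CoeffFamily.hasSum_Z [NeZero q] {M N : ℕ} (hMN : 2 * M * N ≠ 0)
    (hL : CoeffFamily (2 * M * N) χ' L) {s w : ℂ} (hsw : (s, w) ∈ R12) (hw : w ≠ 1) :
    HasSum (fun n : ℕ => if n.Coprime (2 * M * N) then twist χ s n * rowCoeff χ' L n w else 0)
      (Z M N χ χ' (s, w)) := by
  rw [(hL.isContinuation_Z χ hMN).eq (hL.isContinuation χ hMN) hsw hw]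
  exact hL.hasSum_rowCoeff χ ⟨M * N, by ring⟩ hsw hw

end

end DoubleDirichlet

namespace DoubleDirichlet

open Complex Filter Topology Metric
open scoped NumberTheorySymbols

/-! ### The self-dual characters `(· / m₀) χ' ψ'` -/

/-- The character `a ↦ (a / m) ψ(a)`. -/
noncomputable abbrev starChar {c : ℕ} (ψ : DirichletCharacter ℂ c) (m : ℕ) :
    DirichletCharacter ℂ (m * c) :=
  prodChar (chiTilde m) ψ

theorem starChar_intCast {c : ℕ} (ψ : DirichletCharacter ℂ c) {m : ℕ} (hm : m ≠ 0) (a : ℤ) :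
    starChar ψ m (a : ZMod (m * c)) = (J(a | m) : ℤ) * ψ a := by
  rw [starChar, prodChar_intCast, chiTilde_intCast hm]

theorem starChar_natCast {c : ℕ} (ψ : DirichletCharacter ℂ c) {m : ℕ} (hm : m ≠ 0) (a : ℕ) :
    starChar ψ m (a : ZMod (m * c)) = (J(a | m) : ℤ) * ψ a := by
  exact_mod_cast starChar_intCast ψ hm a

theorem jacobiSym_eq_zero_of_not_coprime {a m : ℕ} (hm : m ≠ 0) (h : ¬ a.Coprime m) :
    J((a : ℤ) | m) = 0 := by
  have : NeZero m := ⟨hm⟩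
  rw [jacobiSym.eq_zero_iff_not_coprime, Int.gcd_natCast_natCast]
  exact h

theorem jacobiSym_sq_mul {a b e : ℕ} (ha : a ≠ 0) (hb : b ≠ 0) :
    (J((e : ℤ) | a * b ^ 2) : ℤ) = if e.Coprime b then J((e : ℤ) | a) else 0 := by
  rw [jacobiSym.mul_right' _ ha (pow_ne_zero 2 hb), jacobiSym.pow_right]
  split_ifs with h
  · rw [sq, jacobiSym_sq_eq_one (Nat.isCoprime_iff_coprime.mpr h), mul_one]
  · rw [jacobiSym_eq_zero_of_not_coprime hb h]
    simp

theorem starChar_eq_zero {c : ℕ} (ψs : DirichletCharacter ℂ c) {m p : ℕ} (hm : m ≠ 0) (hp : p.Prime) (hpm : p ∣ m) :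
    starChar ψs m (p : ZMod (m * c)) = 0 := by
  rw [starChar_natCast ψs hm, jacobiSym_eq_zero_of_not_coprime hm, Int.cast_zero, zero_mul]
  exact fun h => hp.one_lt.ne' (Nat.Coprime.eq_one_of_dvd h hpm)

/-- The data attached to the second character of the double Dirichlet series: `ψs`, of conductor
`c`, is the self-dual character inducing the character `ψ'` modulo `8`. -/
structure StarData (j c : ℕ) (ψ' : DirichletCharacter ℂ 8) (ψs : DirichletCharacter ℂ c)
    [NeZero c] : Prop where
  odd_j : Odd j
  squarefree_j : Squarefree j
  dvd : c ∣ 8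
  eq_one_or : c = 1 ∨ 2 ∣ c
  selfDual : SelfDual ψs
  eq_of_odd : ∀ a : ℤ, Odd a → ψs a = ψ' a
  reciprocity : ∀ m : ℕ, Odd m →
    ((J(c | m) : ℤ) : ℂ) * ψs m = if m % 4 = 3 ∧ ψs (-1) = -1 then -1 else 1

section

variable {j c : ℕ} {ψ' : DirichletCharacter ℂ 8} {ψs : DirichletCharacter ℂ c}

theorem StarData.selfDual_starChar [NeZero c] (h : StarData j c ψ' ψs) {m : ℕ} (hodd : Odd m)
    (hsq : Squarefree m) [NeZero m] : SelfDual (starChar ψs m) := by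
  have hc : m.Coprime c := by
    have h8 : m.Coprime (2 ^ 3) := Nat.Coprime.pow_right 3 (Nat.coprime_two_right.mpr hodd)
    exact Nat.Coprime.coprime_dvd_right h.dvd h8
  refine SelfDual.prodChar hc (selfDual_chiTilde m hodd hsq) h.selfDual ?_
  rw [chiTilde_natCast (NeZero.ne m), h.reciprocity m hodd, chiTilde_neg_one hodd]
  have h4 : m % 4 = 1 ∨ m % 4 = 3 := by
    rcases hodd with ⟨k, rfl⟩; omega
  rcases h4 with h4 | h4
  · rw [if_neg (by omega), if_pos h4, if_neg]
    rintro ⟨h1, _⟩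
    norm_num at h1
  · by_cases h1 : ψs (-1) = -1
    · rw [if_pos ⟨h4, h1⟩, if_pos ⟨if_neg (by omega), h1⟩]
    · rw [if_neg fun h => h1 h.2, if_neg fun h => h1 h.2]

/-- The `L`-functions `∑_e (e / m) χ'ψ'(e) e^{-w}`, continued. -/
noncomputable def starL (P j : ℕ) {c : ℕ} (ψs : DirichletCharacter ℂ c) (m : ℕ) (w : ℂ) : ℂ :=
  LRemoved (P * m) (starChar ψs (sqfreePart m * j)) w

theorem sqfreePart_dvd {m : ℕ} (hm : m ≠ 0) : sqfreePart m ∣ m :=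
  ⟨sqPart m ^ 2, (sqfreePart_mul_sqPart_sq hm).symm⟩

theorem sqPart_dvd {m : ℕ} (hm : m ≠ 0) : sqPart m ∣ m :=
  ((dvd_pow_self _ two_ne_zero).trans ⟨sqfreePart m,
    by rw [mul_comm, sqfreePart_mul_sqPart_sq hm]⟩)

theorem squarefree_mul_of_coprime {P m : ℕ} (hj : Squarefree j) (hjP : j ∣ P)
    (hm : m.Coprime P) (hm0 : m ≠ 0) : Squarefree (sqfreePart m * j) := by
  refine (Nat.squarefree_mul ?_).mpr ⟨squarefree_sqfreePart m, hj⟩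
  exact Nat.Coprime.coprime_dvd_left (sqfreePart_dvd hm0)
    (Nat.Coprime.coprime_dvd_right hjP hm)

/-- The crude 1 + p^{2e} ≤ 2p^{2e} ≤ p^{1+2e} is enough: such factors occur only at fixed primes and
at the square part m₁, which carries m₁^{-2s}. It is the source of the exponent 1 + 2e in
`CoeffFamily.bound`. -/
theorem norm_one_sub_mul_cpow_le {z w : ℂ} (hz : ‖z‖ ≤ 1) {p : ℕ} (hp : 2 ≤ p) {e : ℝ}
    (he : 0 ≤ e) (hw : -w.re ≤ 2 * e) : ‖1 - z * (p : ℂ) ^ (-w)‖ ≤ (p : ℝ) ^ (1 + 2 * e) := by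
  have hp' : (2 : ℝ) ≤ p := by exact_mod_cast hp
  have h1 : ‖(p : ℂ) ^ (-w)‖ ≤ (p : ℝ) ^ (2 * e) := by
    rw [norm_natCast_cpow_of_pos (by omega), neg_re]
    exact Real.rpow_le_rpow_of_exponent_le (by linarith) hw
  have h2 : (1 : ℝ) ≤ (p : ℝ) ^ (2 * e) := Real.one_le_rpow (by linarith) (by linarith)
  have h3 : ‖z * (p : ℂ) ^ (-w)‖ ≤ (p : ℝ) ^ (2 * e) := by
    rw [norm_mul]
    exact (mul_le_of_le_one_left (norm_nonneg _) hz).trans h1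
  calc _ ≤ ‖(1 : ℂ)‖ + ‖z * (p : ℂ) ^ (-w)‖ := norm_sub_le _ _
    _ ≤ 2 * (p : ℝ) ^ (2 * e) := by rw [norm_one]; linarith
    _ ≤ p * (p : ℝ) ^ (2 * e) := by gcongr
    _ = _ := by rw [Real.rpow_add (by linarith), Real.rpow_one]

theorem prod_norm_one_sub_le {z : ℕ → ℂ} (hz : ∀ n, ‖z n‖ ≤ 1) {w : ℂ} {e : ℝ} (he : 0 ≤ e)
    (hw : -w.re ≤ 2 * e) {n : ℕ} (hn : n ≠ 0) :
    ∏ p ∈ n.primeFactors, ‖1 - z p * (p : ℂ) ^ (-w)‖ ≤ (n : ℝ) ^ (1 + 2 * e) := by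
  calc _ ≤ ∏ p ∈ n.primeFactors, (p : ℝ) ^ (1 + 2 * e) :=
        Finset.prod_le_prod (fun _ _ => norm_nonneg _) fun p hp =>
          norm_one_sub_mul_cpow_le (hz p) (Nat.prime_of_mem_primeFactors hp).two_le he hw
    _ = ((∏ p ∈ n.primeFactors, p : ℕ) : ℝ) ^ (1 + 2 * e) := by
        rw [Real.finsetProd_rpow _ _ fun p _ => Nat.cast_nonneg p, Nat.cast_prod]
    _ ≤ _ := by
        refine Real.rpow_le_rpow (Nat.cast_nonneg _) ?_ (by linarith)
        exact_mod_cast Nat.le_of_dvd (Nat.pos_of_ne_zero hn) (Nat.prod_primeFactors_dvd n)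

/-- Only the primes dividing the square part contribute to the Euler factors at `m`. -/
theorem starL_eq {P m : ℕ} (hmP : m.Coprime P) (hm : m ≠ 0) (hj : j ≠ 0) (w : ℂ) :
    starL P j ψs m w = LRemoved (P * sqPart m) (starChar ψs (sqfreePart m * j)) w := by
  rw [starL, ← LRemoved_mul_prod _ hmP.symm, ← LRemoved_mul_prod _
    (Nat.Coprime.coprime_dvd_right (sqPart_dvd hm) hmP.symm)]
  congr 1
  refine (Finset.prod_subset (Nat.primeFactors_mono (sqPart_dvd hm) hm) fun p hp hp' => ?_).symm
  have hpp := Nat.prime_of_mem_primeFactors hp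
  have hpm := Nat.dvd_of_mem_primeFactors hp
  rw [← sqfreePart_mul_sqPart_sq hm] at hpm
  have h1 : p ∣ sqfreePart m := by
    rcases hpp.dvd_mul.mp hpm with h | h
    · exact h
    · exact absurd (Nat.mem_primeFactors.mpr ⟨hpp, hpp.dvd_of_dvd_pow h, sqPart_ne_zero m⟩) hp'
  rw [starChar_eq_zero ψs (mul_ne_zero (sqfreePart_ne_zero m) hj) hpp (h1.mul_right j), zero_mul,
    sub_zero]

/-- The character attached to m has level m₀jc and is self-dual, so the uniform convexity bound
gives m₀^e. The square part of m enters only through removed Euler factors. -/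
theorem StarData.coeffFamily [NeZero c] (h : StarData j c ψ' ψs) {P : ℕ} (hP : Even P) (hP0 : P ≠ 0)
    (hjP : j ∣ P) {χ' : DirichletCharacter ℂ j} (hχ' : χ' = chiTilde j) :
    CoeffFamily P (χ'.mul ψ') (starL P j ψs) := by
  have hj0 : j ≠ 0 := h.squarefree_j.ne_zero
  have hne : ∀ m, sqfreePart m * j ≠ 0 := fun m => mul_ne_zero (sqfreePart_ne_zero m) hj0
  have hnz : ∀ m, NeZero (sqfreePart m * j * c) := fun m => ⟨mul_ne_zero (hne m) (NeZero.ne c)⟩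
  refine ⟨fun m hm w hw => ?_, fun m hm w hw => ?_, fun w₀ hw₀ e he => ?_⟩
  · have := hnz m
    have hm0 := ne_zero_of_coprime hm hP
    rw [starL_eq hm hm0 hj0]
    convert hasSum_LRemoved (starChar ψs (sqfreePart m * j))
      (mul_ne_zero hP0 (sqPart_ne_zero m)) hw using 1
    funext a
    have hc : a.Coprime (P * sqPart m) ↔ a.Coprime P ∧ a.Coprime (sqPart m) :=
      Nat.coprime_mul_iff_right
    by_cases h1 : a.Coprime P
    · rw [if_pos h1]
      nth_rw 1 [← sqfreePart_mul_sqPart_sq hm0]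
      rw [jacobiSym_sq_mul (sqfreePart_ne_zero m) (sqPart_ne_zero m)]
      by_cases h2 : a.Coprime (sqPart m)
      · rw [if_pos h2, if_pos (hc.mpr ⟨h1, h2⟩), twist, mul_apply_natCast, starChar_natCast _ (hne m),
          hχ', chiTilde_natCast hj0, jacobiSym.mul_right' _ (sqfreePart_ne_zero m) hj0]
        have h3 := h.eq_of_odd a (by exact_mod_cast odd_of_coprime h1 hP)
        rw [Int.cast_natCast, Int.cast_natCast] at h3
        rw [h3]
        push_cast
        ring
      · rw [if_neg h2, if_neg fun h => h2 (hc.mp h).2]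
        simp
    · rw [if_neg h1, if_neg fun h => h1 (hc.mp h).1]
  · have := hnz m
    unfold starL
    simp only [LRemoved_eq]
    refine (DirichletCharacter.differentiableAt_LFunction _ w (Or.inl hw)).mul ?_
    refine DifferentiableAt.fun_finsetProd fun p hp => ?_
    exact ((differentiable_natCast_cpow (Nat.prime_of_mem_primeFactors hp).ne_zero
      (g := fun w => -w) (by fun_prop)).const_mul _).const_sub 1 w
  · have h0 : (0 : ℝ) ≤ convexityExponent w₀.re := (le_max_left _ _).trans (le_max_left _ _)
    have h3 : 1 / 2 - w₀.re ≤ convexityExponent w₀.re := le_max_right _ _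
    have he0 : 0 < e := by linarith
    obtain ⟨r, hr, C, hC⟩ := exists_convexity_bound hw₀ he
    refine ⟨min r (2 * e + w₀.re), lt_min hr (by linarith),
      C * ((j * c : ℕ) : ℝ) ^ e * (P : ℝ) ^ (1 + 2 * e), fun m hm w hw => ?_⟩
    have hm0 := ne_zero_of_coprime hm hP
    have := hnz m
    have : NeZero (sqfreePart m * j) := ⟨hne m⟩
    have hwre : -w.re ≤ 2 * e := by
      have h4 := abs_re_le_norm (w - w₀)
      have h5 := h4.trans_lt (hw.trans_le (min_le_right _ _))
      rw [sub_re, abs_lt] at h5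
      linarith [h5.1]
    have hsd : SelfDual (starChar ψs (sqfreePart m * j)) := by
      refine h.selfDual_starChar (Odd.mul ?_ h.odd_j)
        (squarefree_mul_of_coprime h.squarefree_j hjP hm hm0)
      exact Odd.of_dvd_nat (odd_of_coprime hm hP) (sqfreePart_dvd hm0)
    have h6 := hC _ _ hsd w (hw.trans_le (min_le_left _ _))
    rw [starL_eq hm hm0 hj0, ← LRemoved_mul_prod _
      (Nat.Coprime.coprime_dvd_right (sqPart_dvd hm0) hm.symm), LRemoved_eq, norm_mul, norm_mul,
      norm_prod, norm_prod]
    have hz : ∀ n : ℕ, ‖starChar ψs (sqfreePart m * j) (n : ZMod (sqfreePart m * j * c))‖ ≤ 1 :=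
      fun n => DirichletCharacter.norm_le_one _ _
    have h7 := prod_norm_one_sub_le hz he0.le hwre hP0
    have h8 := prod_norm_one_sub_le hz he0.le hwre (sqPart_ne_zero m)
    have h9 : ((sqfreePart m * j * c : ℕ) : ℝ) ^ e =
        (sqfreePart m : ℝ) ^ e * ((j * c : ℕ) : ℝ) ^ e := by
      rw [← Real.mul_rpow (by positivity) (by positivity)]
      push_cast
      ring_nf
    rw [h9] at h6
    have h10 : 0 ≤ C * ((sqfreePart m : ℝ) ^ e * ((j * c : ℕ) : ℝ) ^ e) :=
      (norm_nonneg _).trans h6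
    calc _ ≤ C * ((sqfreePart m : ℝ) ^ e * ((j * c : ℕ) : ℝ) ^ e) * (P : ℝ) ^ (1 + 2 * e) *
          (sqPart m : ℝ) ^ (1 + 2 * e) := by gcongr
      _ = _ := by ring

end

end DoubleDirichlet

/-! ### Reflecting the rows and expanding the Euler factors at MN. -/

namespace DoubleDirichlet

open Complex Filter Topology Metric
open scoped NumberTheorySymbols

/-! ### The functional equation of the row coefficients -/

theorem psi_sq_eq_one (ψ : DirichletCharacter ℂ 8) {a : ℤ} (ha : Odd a) : ψ a ^ 2 = 1 := by
  obtain ⟨r, hr, h8, _⟩ := odd_intCast_zmod_eight ha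
  rw [h8, ← map_pow]
  have : ((r : ℤ) : ZMod 8) ^ 2 = 1 := by
    rcases hr with rfl | rfl | rfl | rfl <;> rfl
  rw [this, map_one]

/-- With r = p^{1-2w}, both sums are geometric in r, the odd one carrying an extra p^{-w}. The
reflection inverts r, and multiplication by r^α amounts to reversing the order of summation. -/
theorem localPoly_reflect (ε : ℂ) {η : ℂ} (hη : η ^ 2 = 1) {p : ℕ} (hp : p ≠ 0) (α : ℕ) (w : ℂ) :
    localPoly ε (η * (p : ℂ) ^ (-w)) p α =
      ((p : ℂ) ^ (1 - 2 * w)) ^ α * localPoly ε (η * (p : ℂ) ^ (-(1 - w))) p α := by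
  have hp0 : (p : ℂ) ≠ 0 := Nat.cast_ne_zero.mpr hp
  set z := (p : ℂ) ^ (-w) with hz
  have hz0 : z ≠ 0 := by rw [hz, Ne, cpow_eq_zero_iff]; exact fun h => hp0 h.1
  have h1 : (p : ℂ) ^ (1 - 2 * w) = p * z ^ 2 := by
    rw [show (1 - 2 * w : ℂ) = 1 + (-w) + (-w) by ring, cpow_add _ _ hp0, cpow_add _ _ hp0,
      cpow_one]
    ring
  have h2 : (p : ℂ) ^ (-(1 - w)) = (p * z)⁻¹ := by
    rw [show -(1 - w : ℂ) = -(1 + -w) by ring, cpow_neg, cpow_add _ _ hp0, cpow_one]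
  rw [h1, h2]
  have hr0 : (p : ℂ) * z ^ 2 ≠ 0 := mul_ne_zero hp0 (pow_ne_zero 2 hz0)
  set r := (p : ℂ) * z ^ 2 with hr
  have e1 : ∀ i, (p : ℂ) ^ i * (η * z) ^ (2 * i) = r ^ i := fun i => by
    rw [pow_mul, mul_pow, hη, one_mul, ← mul_pow]
  have e2 : ∀ i, ε * (p : ℂ) ^ i * (η * z) ^ (2 * i + 1) = ε * η * z * r ^ i := fun i => by
    rw [← e1 i, pow_succ]; ring
  have e3 : ∀ i, (p : ℂ) ^ i * (η * (p * z)⁻¹) ^ (2 * i) = r⁻¹ ^ i := fun i => by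
    rw [pow_mul, mul_pow, hη, one_mul, ← mul_pow]
    congr 1
    rw [hr]; field_simp
  have e4 : ∀ i, ε * (p : ℂ) ^ i * (η * (p * z)⁻¹) ^ (2 * i + 1) = ε * η * (p * z)⁻¹ * r⁻¹ ^ i :=
    fun i => by rw [← e3 i, pow_succ]; ring
  simp only [localPoly, e1, e2, e3, e4]
  rw [mul_sub, Finset.mul_sum, Finset.mul_sum]
  congr 1
  · rw [← Finset.sum_range_reflect]
    refine Finset.sum_congr rfl fun i hi => ?_
    have hi' : i ≤ α := Nat.lt_succ_iff.mp (Finset.mem_range.mp hi)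
    rw [show α + 1 - 1 - i = α - i by omega, pow_sub₀ _ hr0 hi', inv_pow]
  · rw [← Finset.sum_range_reflect]
    refine Finset.sum_congr rfl fun i hi => ?_
    have hi' : i < α := Finset.mem_range.mp hi
    have h3 : r ^ α = r ^ (α - 1 - i) * r * r ^ i := by
      rw [← pow_succ, ← pow_add]; congr 1; omega
    rw [h3, inv_pow, hr]
    field_simp

theorem prod_pow_cpow (n : ℕ) (hn : n ≠ 0) (z : ℂ) :
    ∏ p ∈ n.primeFactors, ((p : ℂ) ^ z) ^ n.factorization p = (n : ℂ) ^ z := by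
  let φ : ℕ →* ℂ := ⟨⟨fun n => (n : ℂ) ^ z, by simp⟩, fun m n => by
    simp only [Nat.cast_mul, natCast_mul_natCast_cpow]⟩
  have h : φ n = ∏ p ∈ n.primeFactors, φ p ^ n.factorization p := by
    conv_lhs => rw [← Nat.prod_factorization_pow_eq_self hn]
    rw [Finsupp.prod, map_prod, Nat.support_factorization]
    simp only [map_pow]
  exact h.symm

/-- The quotient of Euler factors at `w` and `1 - w`. -/
noncomputable def eulerRatio (η : ℂ) (p : ℕ) (w : ℂ) : ℂ :=
  (1 - η * (p : ℂ) ^ (-w)) / (1 - η * (p : ℂ) ^ (-(1 - w)))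

theorem one_sub_mul_cpow_ne_zero {η : ℂ} (hη : η = 0 ∨ ‖η‖ = 1) {p : ℕ} (hp : 2 ≤ p) {w : ℂ}
    (hw : w.re ≠ 0) : 1 - η * (p : ℂ) ^ (-w) ≠ 0 := by
  rcases hη with rfl | hη
  · simp
  intro h
  have h1 := congrArg norm (sub_eq_zero.mp h)
  rw [norm_one, norm_mul, hη, one_mul, norm_natCast_cpow_of_pos (by omega), neg_re] at h1
  have hp' : (1 : ℝ) < p := by exact_mod_cast hp
  rcases lt_or_gt_of_ne hw with h2 | h2
  · have := Real.one_lt_rpow hp' (show 0 < -w.re by linarith)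
    linarith
  · have := Real.rpow_lt_one_of_one_lt_of_neg hp' (show -w.re < 0 by linarith)
    linarith

section

variable {j c : ℕ} {ψ' : DirichletCharacter ℂ 8} {ψs : DirichletCharacter ℂ c}

theorem norm_starChar (ψs : DirichletCharacter ℂ c) {m : ℕ} (a : ZMod (m * c))
    (hmc : m * c ≠ 0) : starChar ψs m a = 0 ∨ ‖starChar ψs m a‖ = 1 := by
  have : NeZero (m * c) := ⟨hmc⟩
  by_cases ha : IsUnit a
  · obtain ⟨u, rfl⟩ := ha
    exact Or.inr (DirichletCharacter.unit_norm_eq_one _ u)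
  · exact Or.inl (MulChar.map_nonunit _ ha)

theorem StarData.starChar_mul_cpow [NeZero c] (h : StarData j c ψ' ψs)
    {χ' : DirichletCharacter ℂ j} (hχ' : χ' = chiTilde j) {m p : ℕ} (hm : m ≠ 0) (hp : Odd p) (w : ℂ) :
    starChar ψs (m * j) (p : ZMod (m * j * c)) * (p : ℂ) ^ (-w) =
      (J(p | m) : ℤ) * twist (χ'.mul ψ') w p := by
  have hj0 : j ≠ 0 := h.squarefree_j.ne_zero
  have h3 := h.eq_of_odd p (by exact_mod_cast hp)
  rw [Int.cast_natCast, Int.cast_natCast] at h3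
  rw [starChar_natCast _ (mul_ne_zero hm hj0), twist, mul_apply_natCast, hχ',
    chiTilde_natCast hj0, jacobiSym.mul_right' _ hm hj0, h3]
  push_cast
  ring

/-- `prod_localPoly` read backwards, with the roles of s and w exchanged: the divisor sum is one
L-function times a correction polynomial in w. -/
theorem StarData.rowCoeff_eq [NeZero c] (h : StarData j c ψ' ψs) {χ' : DirichletCharacter ℂ j}
    (hχ' : χ' = chiTilde j) {P n : ℕ} (hP : Even P) (hn : n.Coprime P) (w : ℂ) :
    rowCoeff (χ'.mul ψ') (starL P j ψs) n w =
      LRemoved P (starChar ψs (sqfreePart n * j)) w * ∏ p ∈ (sqPart n).primeFactors,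
        localPoly ((J(p | sqfreePart n) : ℤ) : ℂ) (twist (χ'.mul ψ') w p) p
          ((sqPart n).factorization p) := by
  have hn0 := ne_zero_of_coprime hn hP
  have hj0 : j ≠ 0 := h.squarefree_j.ne_zero
  rw [prod_localPoly (fun p => ((J(p | sqfreePart n) : ℤ) : ℂ)) (twist (χ'.mul ψ') w)
    (twist_one _ w) (twist_mul _ w) (sqPart_ne_zero n), Finset.mul_sum, rowCoeff]
  refine Finset.sum_congr rfl fun g hg => ?_
  have hgd := Nat.dvd_of_mem_divisors hg
  have hg2 : g ^ 2 ∣ n := (sq_dvd_iff_dvd_sqPart hn0).mpr hgd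
  have hmP : (n / g ^ 2).Coprime P := Nat.Coprime.coprime_dvd_left (Nat.div_dvd_of_dvd hg2) hn
  have hdn : sqPart n / g ∣ n := (Nat.div_dvd_of_dvd hgd).trans (sqPart_dvd hn0)
  rw [starL_eq hmP (ne_zero_of_coprime hmP hP) hj0, sqfreePart_div_sq hn0 hgd,
    sqPart_div_sq hn0 hgd, ← LRemoved_mul_prod _ (Nat.Coprime.coprime_dvd_right hdn hn.symm)]
  have h1 : ∏ p ∈ (sqPart n / g).primeFactors,
      (1 - starChar ψs (sqfreePart n * j) (p : ZMod (sqfreePart n * j * c)) * (p : ℂ) ^ (-w)) =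
      ∏ p ∈ (sqPart n / g).primeFactors,
        (1 - ((J(p | sqfreePart n) : ℤ) : ℂ) * twist (χ'.mul ψ') w p) := by
    refine Finset.prod_congr rfl fun p hp => ?_
    rw [h.starChar_mul_cpow hχ' (sqfreePart_ne_zero n)
      (Odd.of_dvd_nat (odd_of_coprime hn hP) ((Nat.dvd_of_mem_primeFactors hp).trans hdn))]
  rw [h1]
  ring

/-- The conductor n₀jc contributes its power 1/2 - w and the correction polynomial contributes
n₁^{1-2w}, which together contain n^{1/2-w}. The correction polynomials are designed for this match.
-/
theorem StarData.rowCoeff_reflect [NeZero c] (h : StarData j c ψ' ψs)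
    {χ' : DirichletCharacter ℂ j} (hχ' : χ' = chiTilde j) {P n : ℕ} (hP : Even P) (hjP : j ∣ P)
    (hn : n.Coprime P) {w : ℂ} (hw : w ∈ genericSet) :
    rowCoeff (χ'.mul ψ') (starL P j ψs) n w =
      (n : ℂ) ^ (1 / 2 - w) * (j : ℂ) ^ (1 / 2 - w) * (c : ℂ) ^ (1 / 2 - w) *
        gammaSgn (starChar ψs (sqfreePart n * j) (-1)) w *
        (∏ p ∈ P.primeFactors, eulerRatio (starChar ψs (sqfreePart n * j) p) p w) *
        rowCoeff (χ'.mul ψ') (starL P j ψs) n (1 - w) := by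
  have hn0 := ne_zero_of_coprime hn hP
  have hj0 : j ≠ 0 := h.squarefree_j.ne_zero
  have hm0 : sqfreePart n * j ≠ 0 := mul_ne_zero (sqfreePart_ne_zero n) hj0
  have : NeZero (sqfreePart n * j) := ⟨hm0⟩
  have hmc : sqfreePart n * j * c ≠ 0 := mul_ne_zero hm0 (NeZero.ne c)
  have : NeZero (sqfreePart n * j * c) := ⟨hmc⟩
  have hodd := odd_of_coprime hn hP
  have hsd : SelfDual (starChar ψs (sqfreePart n * j)) :=
    h.selfDual_starChar (Odd.mul (Odd.of_dvd_nat hodd (sqfreePart_dvd hn0)) h.odd_j)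
      (squarefree_mul_of_coprime h.squarefree_j hjP hn hn0)
  rw [h.rowCoeff_eq hχ' hP hn, h.rowCoeff_eq hχ' hP hn, LRemoved_eq, LRemoved_eq,
    hsd.LFunction_eq hw.1]
  -- the Euler factors at the primes dividing the square part
  have h1 : ∏ p ∈ (sqPart n).primeFactors,
      localPoly ((J(p | sqfreePart n) : ℤ) : ℂ) (twist (χ'.mul ψ') w p) p
        ((sqPart n).factorization p) = (sqPart n : ℂ) ^ (1 - 2 * w) *
      ∏ p ∈ (sqPart n).primeFactors,
        localPoly ((J(p | sqfreePart n) : ℤ) : ℂ) (twist (χ'.mul ψ') (1 - w) p) p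
          ((sqPart n).factorization p) := by
    rw [← prod_pow_cpow _ (sqPart_ne_zero n), ← Finset.prod_mul_distrib]
    refine Finset.prod_congr rfl fun p hp => ?_
    have hpp := Nat.prime_of_mem_primeFactors hp
    have hpn : p ∣ n := (Nat.dvd_of_mem_primeFactors hp).trans (sqPart_dvd hn0)
    refine localPoly_reflect _ ?_ hpp.ne_zero _ w
    have hpj : p.Coprime j := Nat.Coprime.coprime_dvd_left hpn
      (Nat.Coprime.coprime_dvd_right hjP hn)
    have h2 := jacobiSym_sq_eq_one (Nat.isCoprime_iff_coprime.mpr hpj)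
    have h3 := psi_sq_eq_one ψ' (a := p) (by exact_mod_cast Odd.of_dvd_nat hodd hpn)
    rw [Int.cast_natCast] at h3
    rw [mul_apply_natCast, hχ', chiTilde_natCast hj0, mul_pow, h3, mul_one, sq]
    exact_mod_cast h2
  -- the removed Euler factors
  have h2 : ∏ p ∈ P.primeFactors, (1 - starChar ψs (sqfreePart n * j)
      (p : ZMod (sqfreePart n * j * c)) * (p : ℂ) ^ (-w)) =
      (∏ p ∈ P.primeFactors, eulerRatio (starChar ψs (sqfreePart n * j) p) p w) *
      ∏ p ∈ P.primeFactors, (1 - starChar ψs (sqfreePart n * j)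
        (p : ZMod (sqfreePart n * j * c)) * (p : ℂ) ^ (-(1 - w))) := by
    rw [← Finset.prod_mul_distrib]
    refine Finset.prod_congr rfl fun p hp => ?_
    rw [eulerRatio, div_mul_cancel₀]
    refine one_sub_mul_cpow_ne_zero (norm_starChar ψs _ hmc)
      (Nat.prime_of_mem_primeFactors hp).two_le ?_
    rw [sub_re, one_re]
    exact sub_ne_zero.mpr (Ne.symm hw.2)
  have h3 : ((sqfreePart n * j * c : ℕ) : ℂ) ^ (1 / 2 - w) * (sqPart n : ℂ) ^ (1 - 2 * w) =
      (n : ℂ) ^ (1 / 2 - w) * (j : ℂ) ^ (1 / 2 - w) * (c : ℂ) ^ (1 / 2 - w) := by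
    have hn1 : (sqPart n : ℂ) ≠ 0 := Nat.cast_ne_zero.mpr (sqPart_ne_zero n)
    have hsplit : ∀ a b : ℕ, ((a * b : ℕ) : ℂ) ^ (1 / 2 - w) =
        (a : ℂ) ^ (1 / 2 - w) * (b : ℂ) ^ (1 / 2 - w) := fun a b => by
      rw [Nat.cast_mul, natCast_mul_natCast_cpow]
    have h4 : (n : ℂ) ^ (1 / 2 - w) = (sqfreePart n : ℂ) ^ (1 / 2 - w) *
        ((sqPart n : ℂ) ^ (1 / 2 - w) * (sqPart n : ℂ) ^ (1 / 2 - w)) := by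
      rw [← hsplit, ← hsplit, ← sq, sqfreePart_mul_sqPart_sq hn0]
    rw [h4, hsplit, hsplit, show (1 - 2 * w : ℂ) = (1 / 2 - w) + (1 / 2 - w) by ring,
      cpow_add _ _ hn1]
    ring
  rw [h1, h2, ← h3]
  ring

end

/-! ### The Euler factors at the primes dividing `M N` -/

/-- For χ(p) ≠ 0, multiplying numerator and denominator by 1 + χ(p)t·p^{w-1} makes the denominator
independent of the sign t; the parts even and odd in t are then F and tG. -/
theorem eulerRatio_eq {q : ℕ} (χ : DirichletCharacter ℂ q) {p : ℕ} (hp : p.Prime) {t w : ℂ}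
    (ht : t ^ 2 = 1) (hχ : χ (p : ZMod q) = 0 ∨ χ (p : ZMod q) ^ 2 = 1) (hw : w.re ≠ 1) :
    eulerRatio (χ (p : ZMod q) * t) p w = coeffF χ p w + t * coeffG χ p w := by
  have hp0 : (p : ℂ) ≠ 0 := Nat.cast_ne_zero.mpr hp.ne_zero
  rw [coeffF, coeffG, if_neg hp.one_lt.ne', if_neg hp.one_lt.ne', eulerRatio, Nat.cast_pow,
    map_pow]
  rcases hχ with h | h
  · have : (p : ℂ) ^ 2 ≠ 0 := pow_ne_zero 2 hp0
    rw [h]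
    simp [this]
  · set z := (p : ℂ) ^ w with hz
    have hz0 : z ≠ 0 := by rw [hz, Ne, cpow_eq_zero_iff]; exact fun h => hp0 h.1
    set η := χ (p : ZMod q) with hη
    have e1 : (p : ℂ) ^ (-w) = z⁻¹ := by rw [cpow_neg]
    have e2 : (p : ℂ) ^ (-(1 - w)) = z / p := by
      rw [show -(1 - w : ℂ) = w + -1 by ring, cpow_add _ _ hp0, cpow_neg_one, div_eq_mul_inv]
    have e3 : (p : ℂ) ^ (2 * w) = z ^ 2 := by rw [hz, ← cpow_nat_mul]; norm_num
    have e4 : (p : ℂ) ^ (2 - w) = p ^ 2 / z := by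
      rw [cpow_sub _ _ hp0, ← hz]; norm_num
    have e5 : (p : ℂ) ^ (1 + w) = p * z := by rw [cpow_add _ _ hp0, cpow_one]
    have hre : (1 - w).re ≠ 0 := by
      rw [sub_re, one_re]; exact sub_ne_zero.mpr (Ne.symm hw)
    have hnorm : ∀ ζ : ℂ, ζ ^ 2 = 1 → ‖ζ‖ = 1 := by
      intro ζ hζ
      have := congrArg norm hζ
      rw [norm_pow, norm_one] at this
      exact (pow_eq_one_iff_of_nonneg (norm_nonneg _) two_ne_zero).mp this
    have hηt : (η * t) ^ 2 = 1 := by rw [mul_pow, h, ht, one_mul]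
    have h1 := one_sub_mul_cpow_ne_zero (Or.inr (hnorm _ hηt)) hp.two_le hre
    have h2 := one_sub_mul_cpow_ne_zero (η := -(η * t))
      (Or.inr (hnorm _ (by rw [neg_sq, hηt]))) hp.two_le hre
    rw [e2] at h1 h2
    rw [e1, e2, e3, e4, e5, h]
    have h3 : 1 * z ^ 2 - (p : ℂ) ^ 2 ≠ 0 := by
      have h4 : 1 * z ^ 2 - (p : ℂ) ^ 2 =
          -((1 - η * t * (z / p)) * (1 - -(η * t) * (z / p)) * p ^ 2) := by
        field_simp
        linear_combination (-(z ^ 2)) * hηt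
      rw [h4]
      exact neg_ne_zero.mpr (mul_ne_zero (mul_ne_zero h1 h2) (pow_ne_zero 2 hp0))
    rw [← mul_div_assoc t, ← add_div, div_eq_div_iff h1 h3]
    field_simp
    linear_combination (z * (p - z ^ 2)) * hηt

/-- Multiply out (F_M + T(M)G_M)(F_N + T(N)G_N) for distinct primes. In the degenerate cases the
superfluous terms vanish: G₁ = 0, and M = N > 1 forces χ(M) = 0, whence F = 1 and G = 0. -/
theorem sum_coeffA {M N q : ℕ} (hM : M = 1 ∨ (M.Prime ∧ M ≠ 2)) (hN : N = 1 ∨ (N.Prime ∧ N ≠ 2))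
    (χ : DirichletCharacter ℂ q) (hMN : M = N → M ≠ 1 → χ (M : ZMod q) = 0) {w : ℂ} {R T : ℕ → ℂ}
    (hT1 : T 1 = 1) (hT : T (M * N) = T M * T N)
    (hRM : M ≠ 1 → R M = coeffF χ M w + T M * coeffG χ M w)
    (hRN : N ≠ 1 → R N = coeffF χ N w + T N * coeffG χ N w) :
    ∏ p ∈ (2 * M * N).primeFactors, R p =
      R 2 * ∑ ν ∈ (M * N).divisors, coeffA M N χ ν w * T ν := by
  have hF1 : coeffF χ 1 w = 1 := if_pos rfl
  have hG1 : coeffG χ 1 w = 0 := if_pos rfl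
  have hprod1 : ∀ p : ℕ, p.Prime → p ≠ 2 → ∏ p ∈ (2 * p).primeFactors, R p = R 2 * R p := by
    intro p hp hp2
    rw [Nat.primeFactors_mul two_ne_zero hp.ne_zero, Nat.prime_two.primeFactors, hp.primeFactors,
      Finset.prod_union (by simpa using Ne.symm hp2), Finset.prod_singleton, Finset.prod_singleton]
  rcases hM with rfl | ⟨hM, hM2⟩
  · rcases hN with rfl | ⟨hN, hN2⟩
    · simp [coeffA, hF1, hT1, Nat.prime_two.primeFactors]
    · have hN1 := hN.one_lt.ne'
      rw [mul_one, hprod1 N hN hN2, hRN hN1, one_mul, hN.divisors,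
        Finset.sum_pair hN1.symm]
      simp only [coeffA, if_pos, hF1, hG1, hT1, if_neg hN1]
      ring
  · have hM1 := hM.one_lt.ne'
    rcases hN with rfl | ⟨hN, hN2⟩
    · rw [mul_one, hprod1 M hM hM2, hRM hM1, mul_one, hM.divisors, Finset.sum_pair hM1.symm]
      simp only [coeffA, if_pos, hF1, hT1, if_neg hM1]
      ring
    · have hN1 := hN.one_lt.ne'
      by_cases hMN' : M = N
      · subst hMN'
        have h0 := hMN rfl hM1
        have hMc : (M : ℂ) ^ 2 ≠ 0 := pow_ne_zero 2 (Nat.cast_ne_zero.mpr hM.ne_zero)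
        have hF : coeffF χ M w = 1 := by
          rw [coeffF, if_neg hM1, Nat.cast_pow, map_pow, h0]
          simp [hMc]
        have hG : coeffG χ M w = 0 := by
          rw [coeffG, if_neg hM1, h0, zero_mul, zero_div]
        have h1 : (2 * M * M).primeFactors = (2 * M).primeFactors := by
          rw [Nat.primeFactors_mul (mul_ne_zero two_ne_zero hM.ne_zero) hM.ne_zero]
          exact Finset.union_eq_left.mpr (Nat.primeFactors_mono (dvd_mul_left _ _)
            (mul_ne_zero two_ne_zero hM.ne_zero))
        rw [h1, hprod1 M hM hM2, hRM hM1, hF, hG, Finset.sum_eq_single 1]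
        · simp [coeffA, hF, hT1]
        · intro ν _ hν
          simp [coeffA, hν, hG]
        · intro h
          simp [hM.ne_zero] at h
      · have hc : M.Coprime N := (Nat.coprime_primes hM hN).mpr hMN'
        have h1 : ∏ p ∈ (2 * M * N).primeFactors, R p = R 2 * R M * R N := by
          have hcop : (2 * M).Coprime N := Nat.Coprime.mul_left
            ((Nat.coprime_primes Nat.prime_two hN).mpr (Ne.symm hN2)) hc
          rw [hcop.primeFactors_mul, Finset.prod_union hcop.disjoint_primeFactors,
            hprod1 M hM hM2, hN.primeFactors, Finset.prod_singleton]
        have hMN1 : M * N ≠ 1 := fun h => hM1 (Nat.eq_one_of_mul_eq_one_right h)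
        have hMNM : M * N ≠ M := fun h => hN1 (by
          have := Nat.eq_of_mul_eq_mul_left hM.pos (h.trans (mul_one M).symm)
          exact this)
        have hMNN : M * N ≠ N := fun h => hM1 (by
          have := Nat.eq_of_mul_eq_mul_right hN.pos (h.trans (one_mul N).symm)
          exact this)
        have h2 : (M * N).divisors = {1, M, N, M * N} := by
          rw [Nat.divisors_mul, hM.divisors, hN.divisors]
          ext x
          simp only [Finset.mem_mul, Finset.mem_insert, Finset.mem_singleton]
          constructor
          · rintro ⟨a, rfl | rfl, b, rfl | rfl, rfl⟩ <;> simp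
          · rintro (rfl | rfl | rfl | rfl)
            · exact ⟨1, Or.inl rfl, 1, Or.inl rfl, rfl⟩
            · exact ⟨_, Or.inr rfl, 1, Or.inl rfl, mul_one _⟩
            · exact ⟨1, Or.inl rfl, _, Or.inr rfl, one_mul _⟩
            · exact ⟨_, Or.inr rfl, _, Or.inr rfl, rfl⟩
        rw [h1, h2, Finset.sum_insert (by simp [hM1.symm, hN1.symm, hMN1.symm]),
          Finset.sum_insert (by simp [hMN', hMNM.symm]), Finset.sum_pair hMNN.symm, hRM hM1,
          hRN hN1]
        simp only [coeffA, if_pos, if_neg hM1, if_neg hN1, if_neg (Ne.symm hMN'), if_neg hMN1,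
          if_neg hMNM, if_neg hMNN, hT1, hT]
        ring

end DoubleDirichlet

/-! ### Coefficients as sums over characters modulo 8. -/

namespace DoubleDirichlet

open Complex Filter Topology Metric
open scoped NumberTheorySymbols

/-! ### Sums over the characters modulo 8 -/

/-- The character `n ↦ (-1 / n)` modulo `8`. -/
noncomputable def charNegOne : DirichletCharacter ℂ 8 := complexChar ZMod.χ₈ * complexChar ZMod.χ₈'

/-- The character `n ↦ (2 / n)` modulo `8`. -/
noncomputable def charTwo : DirichletCharacter ℂ 8 := complexChar ZMod.χ₈

theorem charNegOne_natCast {n : ℕ} (hn : Odd n) : charNegOne n = (J(-1 | n) : ℤ) := by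
  have h : J(-1 | n) = J(2 | n) * J(-2 | n) := by
    rw [show (-2 : ℤ) = 2 * -1 by norm_num, jacobiSym.mul_left, ← mul_assoc,
      jacobiSym_sq_eq_one (by
        exact_mod_cast Nat.isCoprime_iff_coprime.mpr (Nat.coprime_two_left.mpr hn)), one_mul]
  rw [h, charNegOne, MulChar.mul_apply, complexChar_apply, complexChar_apply,
    jacobiSym.at_two hn, jacobiSym.at_neg_two hn]
  push_cast
  rfl

theorem charTwo_natCast {n : ℕ} (hn : Odd n) : charTwo n = (J(2 | n) : ℤ) := by
  rw [charTwo, complexChar_apply, jacobiSym.at_two hn]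

theorem charNegOne_neg_one : charNegOne (-1) = -1 := by
  rw [charNegOne, MulChar.mul_apply, complexChar_apply, complexChar_apply,
    show ZMod.χ₈ (-1) = 1 by decide, show ZMod.χ₈' (-1) = -1 by decide]
  norm_num

theorem charNegOne_five : charNegOne 5 = 1 := by
  rw [charNegOne, MulChar.mul_apply, complexChar_apply, complexChar_apply,
    show ZMod.χ₈ 5 = -1 by decide, show ZMod.χ₈' 5 = -1 by decide]
  norm_num

theorem charTwo_neg_one : charTwo (-1) = 1 := by
  rw [charTwo, complexChar_apply, show ZMod.χ₈ (-1) = 1 by decide, Int.cast_one]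

theorem charTwo_five : charTwo 5 = -1 := by
  rw [charTwo, complexChar_apply, show ZMod.χ₈ 5 = -1 by decide]
  norm_num

/-- The classes -1 and 5 generate the units modulo 8. -/
theorem ext_mod_eight {ψ φ : DirichletCharacter ℂ 8} (h1 : ψ (-1) = φ (-1)) (h5 : ψ 5 = φ 5) :
    ψ = φ := by
  refine dirichletCharacter_ext fun a => ?_
  rcases Int.even_or_odd a with ha | ha
  · have h : ¬ IsCoprime a (8 : ℕ) := fun h => by
      have := h.isUnit_of_dvd' ha.two_dvd (by norm_num)
      exact absurd this (by decide)
    rw [(DirichletCharacter.apply_eq_zero_iff _ a).mpr h,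
      (DirichletCharacter.apply_eq_zero_iff _ a).mpr h]
  · obtain ⟨r, hr, h8, _⟩ := odd_intCast_zmod_eight ha
    rw [h8]
    rcases hr with rfl | rfl | rfl | rfl
    · rw [Int.cast_one, map_one, map_one]
    · rw [show ((3 : ℤ) : ZMod 8) = -1 * 5 by rfl, map_mul, map_mul, h1, h5]
    · exact h5
    · exact h1

theorem sum_mod_eight (f : DirichletCharacter ℂ 8 → ℂ) :
    ∑ ψ, f ψ = f 1 + f charNegOne + f charTwo + f (charNegOne * charTwo) := by
  have hne : (1 : ℂ) ≠ -1 := by norm_num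
  have hval : ∀ (ψ : DirichletCharacter ℂ 8) (a : ZMod 8), a ^ 2 = 1 → ψ a = 1 ∨ ψ a = -1 :=
    fun ψ a ha => by rw [← sq_eq_one_iff, ← map_pow, ha, map_one]
  have h1 : (1 : DirichletCharacter ℂ 8) (-1) = 1 := MulChar.one_apply isUnit_one.neg
  have h5 : (1 : DirichletCharacter ℂ 8) 5 = 1 :=
    MulChar.one_apply (IsUnit.of_mul_eq_one 5 (by rfl))
  have e1 : (charNegOne * charTwo) (-1) = -1 := by
    rw [MulChar.mul_apply, charNegOne_neg_one, charTwo_neg_one, mul_one]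
  have e5 : (charNegOne * charTwo) 5 = -1 := by
    rw [MulChar.mul_apply, charNegOne_five, charTwo_five, one_mul]
  classical
  have huniv : (Finset.univ : Finset (DirichletCharacter ℂ 8)) =
      {1, charNegOne, charTwo, charNegOne * charTwo} := by
    symm
    rw [Finset.eq_univ_iff_forall]
    intro ψ
    simp only [Finset.mem_insert, Finset.mem_singleton]
    rcases hval ψ (-1) (by rfl) with a | a <;> rcases hval ψ 5 (by rfl) with b | b
    · exact Or.inl (ext_mod_eight (a.trans h1.symm) (b.trans h5.symm))
    · exact Or.inr (Or.inr (Or.inl (ext_mod_eight (a.trans charTwo_neg_one.symm)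
        (b.trans charTwo_five.symm))))
    · exact Or.inr (Or.inl (ext_mod_eight (a.trans charNegOne_neg_one.symm)
        (b.trans charNegOne_five.symm)))
    · exact Or.inr (Or.inr (Or.inr (ext_mod_eight (a.trans e1.symm) (b.trans e5.symm))))
  have hd : ∀ {ψ φ : DirichletCharacter ℂ 8} (a : ZMod 8), ψ a = 1 → φ a = -1 → ψ ≠ φ := by
    rintro ψ _ a h h' rfl
    exact hne (h.symm.trans h')
  rw [huniv, Finset.sum_insert, Finset.sum_insert, Finset.sum_pair]
  · ring
  · exact hd _ charTwo_neg_one e1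
  · simp only [Finset.mem_insert, Finset.mem_singleton, not_or]
    exact ⟨(hd _ charTwo_neg_one charNegOne_neg_one).symm, hd _ charNegOne_five e5⟩
  · simp only [Finset.mem_insert, Finset.mem_singleton, not_or]
    exact ⟨hd _ h1 charNegOne_neg_one, hd _ h5 charTwo_five, hd _ h1 e1⟩

/-! ### The coefficients of the functional equation -/

/-- The sign `(-1 / ν)`. -/
noncomputable def signAt (ν : ℕ) : ℂ := if ν % 4 = 3 then -1 else 1

/-- The coefficients of the functional equation. -/
noncomputable def coeff (j : ℕ) {c : ℕ} (ψ' : DirichletCharacter ℂ 8)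
    (ψs : DirichletCharacter ℂ c) (ν : ℕ) (ψ : DirichletCharacter ℂ 8) : ℂ → ℂ :=
  coeffNF
    (ψ' ν * (if ψ (-1) * signAt ν = 1 then 1 else ((J(-1 | j) : ℤ) : ℂ) * ψs (-1)) *
      (if c = 1 then (if ψ 5 = 1 then (1 / 4 : ℂ) else ((J(2 | j) : ℤ) : ℂ) / 4)
        else (if ψ 5 = 1 then 1 / 2 else 0)))
    (ψ (-1) * signAt ν) c (if c = 1 then (if ψ 5 = 1 then 1 else 2) else 0)

theorem signAt_eq (ν : ℕ) : signAt ν = 1 ∨ signAt ν = -1 := by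
  rw [signAt]; split_ifs <;> simp

theorem apply_neg_one_sq {n : ℕ} (ψ : DirichletCharacter ℂ n) : ψ (-1) ^ 2 = 1 := by
  rw [← map_pow, neg_one_sq, map_one]

theorem coeff_properties : ∃ C : ℝ → ℝ, ∀ (j c : ℕ) (ψ' : DirichletCharacter ℂ 8)
    (ψs : DirichletCharacter ℂ c) (ν : ℕ) (ψ : DirichletCharacter ℂ 8), c ∣ 8 →
    MeromorphicNFOn (coeff j ψ' ψs ν ψ) Set.univ ∧
    (∀ w : ℂ, ¬ AnalyticAt ℂ (coeff j ψ' ψs ν ψ) w → (∃ m : ℕ, 0 < m ∧ w = m) ∨ w.re = 1) ∧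
    {w : ℂ | ¬ AnalyticAt ℂ (coeff j ψ' ψs ν ψ) w}.Countable ∧
    (∀ δ : ℝ, 0 < δ → ∀ w : ℂ,
      (∀ p : ℂ, ¬ AnalyticAt ℂ (coeff j ψ' ψs ν ψ) p → δ ≤ ‖w - p‖) →
      ‖coeff j ψ' ψs ν ψ w‖ ≤ C δ * (16 * Real.pi) ^ |w.re| * (1 + ‖w‖) ^ (1 / 2 - w.re)) := by
  obtain ⟨C, hC⟩ := coeffNF_properties
  refine ⟨C, fun j c ψ' ψs ν ψ hc => hC _ _ _ _ ?_ ?_ (ne_zero_of_dvd_ne_zero (by norm_num) hc)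
    (Nat.le_of_dvd (by norm_num) hc)⟩
  · rw [norm_mul, norm_mul]
    have h1 : ‖ψ' (ν : ZMod 8)‖ ≤ 1 := DirichletCharacter.norm_le_one _ _
    have h2 : ‖(if ψ (-1) * signAt ν = 1 then 1 else ((J(-1 | j) : ℤ) : ℂ) * ψs (-1))‖ ≤ 1 := by
      split_ifs
      · rw [norm_one]
      · rw [norm_mul]
        exact mul_le_one₀ (norm_jacobiSym_le _ _) (norm_nonneg _)
          (DirichletCharacter.norm_le_one _ _)
    have h3 : ‖(if c = 1 then (if ψ 5 = 1 then (1 / 4 : ℂ) else ((J(2 | j) : ℤ) : ℂ) / 4)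
        else (if ψ 5 = 1 then 1 / 2 else 0))‖ ≤ 1 := by
      have := norm_jacobiSym_le 2 j
      split_ifs
      · norm_num
      · rw [norm_div]
        norm_num at this ⊢
        linarith
      · norm_num
      · norm_num
    exact mul_le_one₀ (mul_le_one₀ h1 (norm_nonneg _) h2) (norm_nonneg _) h3
  · rw [mul_pow, apply_neg_one_sq]
    rcases signAt_eq ν with h | h <;> norm_num [h]

theorem gammaSgn_eq {t : ℂ} (ht : t = 1 ∨ t = -1) (w : ℂ) : gammaSgn t w =
    (gammaEven w + gammaOdd w + t * (gammaEven w - gammaOdd w)) / 2 := by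
  rcases ht with rfl | rfl
  · rw [gammaSgn, if_pos rfl]; ring
  · rw [gammaSgn, if_neg (by norm_num)]; ring

theorem eulerRatio_two {η : ℂ} (hη : η ^ 2 = 1) {w : ℂ} (hw : w.re ≠ 1) :
    eulerRatio η 2 w = (twoNum 1 w / twoDen 1 w + η * (twoNum 2 w / twoDen 2 w)) / 2 := by
  have hη' : ‖η‖ = 1 := by
    have := congrArg norm hη
    rw [norm_pow, norm_one] at this
    exact (pow_eq_one_iff_of_nonneg (norm_nonneg _) two_ne_zero).mp this
  have hre : (1 - w).re ≠ 0 := by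
    rw [sub_re, one_re]; exact sub_ne_zero.mpr (Ne.symm hw)
  have h1 := one_sub_mul_cpow_ne_zero (Or.inr hη') le_rfl hre
  have h2 := one_sub_mul_cpow_ne_zero (η := -η) (Or.inr (by rw [norm_neg, hη'])) le_rfl hre
  have h4 : (4 : ℂ) ^ (w - 1) = ((2 : ℂ) ^ (w - 1)) ^ 2 := by
    rw [← cpow_nat_mul, show (4 : ℂ) = ((2 * 2 : ℕ) : ℂ) by norm_num, Nat.cast_mul,
      natCast_mul_natCast_cpow, ← cpow_add _ _ (by norm_num)]
    congr 1; push_cast; ring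
  have e : (2 : ℂ) ^ (w - 1) * 2 ^ (-w) = 1 / 2 := by
    rw [← cpow_add _ _ two_ne_zero, show w - 1 + -w = (-1 : ℂ) by ring, cpow_neg_one]
    norm_num
  simp only [eulerRatio, twoNum, twoDen, h4]
  rw [Nat.cast_ofNat, show -(1 - w) = w - 1 by ring] at *
  set u := (2 : ℂ) ^ (w - 1)
  set v := (2 : ℂ) ^ (-w)
  have h3 : 1 - u ^ 2 ≠ 0 := by
    have : 1 - u ^ 2 = (1 - η * u) * (1 - -η * u) := by linear_combination (u ^ 2) * hη
    rw [this]; exact mul_ne_zero h1 h2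
  rw [← mul_div_assoc η, ← add_div, div_div, div_eq_div_iff h1 (mul_ne_zero h3 two_ne_zero)]
  linear_combination (2 * η * u - 2) * e + (2 * u ^ 2 - 2 * u * v) * hη

/-- The Euler factor at `2` of the row coefficients. -/
theorem eulerRatio_two_eq {c : ℕ} (ψs : DirichletCharacter ℂ c) (hc : c = 1 ∨ 2 ∣ c) {y y0 w : ℂ}
    (hy : (y * y0) ^ 2 = 1) (hw : w.re ≠ 1) :
    eulerRatio (y * y0 * ψs (2 : ℕ)) 2 w = if c = 1 then
      (twoNum 1 w / twoDen 1 w + y * y0 * (twoNum 2 w / twoDen 2 w)) / 2 else 1 := by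
  split_ifs with h
  · subst h
    rw [Subsingleton.elim ((2 : ℕ) : ZMod 1) 1, map_one, mul_one, eulerRatio_two hy hw]
  · have h2 := hc.resolve_left h
    have h3 : ψs ((2 : ℕ) : ZMod c) = 0 := by
      refine MulChar.map_nonunit _ fun hu => ?_
      rw [ZMod.isUnit_iff_coprime] at hu
      exact absurd (Nat.Coprime.eq_one_of_dvd hu h2) (by norm_num)
    rw [h3, eulerRatio]
    simp

/-- This identity dictates the definition of `coeff`. The gamma quotient is linear in x = (-1/n).
The Euler factor at 2 is linear in y = (2/n) if c = 1, and is 1 otherwise. In the expansion over 1,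
x, y, xy, the value ψ(-1) records whether x occurs and ψ(5) whether y does. When ν ≡ 3 mod 4 the
extra factor x exchanges the two gamma parts, which is the role of `signAt`. -/
theorem sum_coeff_mul {j c : ℕ} (ψ' : DirichletCharacter ℂ 8) (ψs : DirichletCharacter ℂ c)
    (hj : Odd j) (hc : c = 1 ∨ 2 ∣ c) (hc0 : c ≠ 0) (ν : ℕ) {n : ℕ} (hn : Odd n) {w : ℂ}
    (hw : w ∈ genericSet) :
    ∑ ψ, coeff j ψ' ψs ν ψ w * ψ n = ψ' ν * (c : ℂ) ^ (1 / 2 - w) *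
      gammaSgn ((J(-1 | n) : ℤ) * ((J(-1 | j) : ℤ) * ψs (-1))) w *
      eulerRatio ((J(2 | n) : ℤ) * (J(2 | j) : ℤ) * ψs (2 : ℕ)) 2 w *
      (if ν % 4 = 3 then ((J(-1 | n) : ℤ) : ℂ) else 1) := by
  have hsq : ∀ (a : ℤ) {m : ℕ}, IsCoprime a m → ((J(a | m) : ℤ) : ℂ) ^ 2 = 1 := fun a m h => by
    rw [sq]; exact_mod_cast jacobiSym_sq_eq_one h
  have h2 : ∀ {m : ℕ}, Odd m → IsCoprime (2 : ℤ) m := fun hm => by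
    exact_mod_cast Nat.isCoprime_iff_coprime.mpr (Nat.coprime_two_left.mpr hm)
  have h1 : ∀ m : ℕ, IsCoprime (-1 : ℤ) m := fun m => isCoprime_one_left.neg_left
  have hx := hsq (-1) (h1 n)
  have hτ : (((J(-1 | j) : ℤ) : ℂ) * ψs (-1)) ^ 2 = 1 := by
    rw [mul_pow, hsq _ (h1 j), apply_neg_one_sq, one_mul]
  have hy : (((J(2 | n) : ℤ) : ℂ) * ((J(2 | j) : ℤ) : ℂ)) ^ 2 = 1 := by
    rw [mul_pow, hsq _ (h2 hn), hsq _ (h2 hj), one_mul]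
  have hone : (1 : DirichletCharacter ℂ 8) n = 1 :=
    MulChar.one_apply ((ZMod.isUnit_iff_coprime _ _).mpr
      (Nat.Coprime.pow_right 3 (Nat.coprime_two_right.mpr hn)))
  have h1' : (1 : DirichletCharacter ℂ 8) (-1) = 1 := MulChar.one_apply isUnit_one.neg
  have h5' : (1 : DirichletCharacter ℂ 8) 5 = 1 :=
    MulChar.one_apply (IsUnit.of_mul_eq_one 5 (by rfl))
  rw [eulerRatio_two_eq ψs hc hy hw.2, sum_mod_eight]
  simp only [coeff, coeffNF_eq _ _ hc0 (genericSet_disjoint_poleSet hw), coeffFun,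
    MulChar.mul_apply, charNegOne_neg_one, charNegOne_five, charTwo_neg_one, charTwo_five,
    charNegOne_natCast hn, charTwo_natCast hn, h1', h5', hone]
  set x := ((J(-1 | n) : ℤ) : ℂ)
  set y := ((J(2 | n) : ℤ) : ℂ)
  set τ := ((J(-1 | j) : ℤ) : ℂ) * ψs (-1)
  set y0 := ((J(2 | j) : ℤ) : ℂ)
  have hxτ : x * τ = 1 ∨ x * τ = -1 := by
    rw [← sq_eq_one_iff, mul_pow, hx, hτ, one_mul]
  have hne : (-1 : ℂ) ≠ 1 := by norm_num
  rw [gammaSgn_eq hxτ]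
  have t0 : twoNum 0 w / twoDen 0 w = 1 := by simp [twoNum, twoDen]
  by_cases hν : ν % 4 = 3 <;> by_cases hc1 : c = 1
  all_goals
    simp only [signAt, hν, hc1, if_true, if_false, hne, mul_one, one_mul, neg_mul, mul_neg,
      neg_neg, t0]
  · linear_combination (-(ψ' ν * (((1 : ℕ) : ℂ) ^ (1 / 2 - w)) * τ * (gammaEven w - gammaOdd w) *
      (twoNum 1 w / twoDen 1 w + y * y0 * (twoNum 2 w / twoDen 2 w)) / 4)) * hx
  · linear_combination (-(ψ' ν * ((c : ℂ) ^ (1 / 2 - w)) * τ * (gammaEven w - gammaOdd w) / 2)) * hx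
  · ring
  · ring

end DoubleDirichlet

namespace DoubleDirichlet

open Complex Filter Topology Metric
open scoped NumberTheorySymbols

/-! ### The functional equation -/

theorem jacobiSym_sqfreePart {a : ℤ} {n : ℕ} (hn : n ≠ 0) (h : IsCoprime a n) :
    J(a | sqfreePart n) = J(a | n) := by
  conv_rhs => rw [← sqfreePart_mul_sqPart_sq hn]
  have h1 : IsCoprime a (sqPart n) :=
    h.of_isCoprime_of_dvd_right (by exact_mod_cast sqPart_dvd hn)
  rw [jacobiSym.mul_right' _ (sqfreePart_ne_zero n) (pow_ne_zero 2 (sqPart_ne_zero n)),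
    jacobiSym.pow_right, sq, jacobiSym_sq_eq_one h1, mul_one]

/-- Reciprocity in the form needed here: as a function of n, the symbol (ν/n) is χ̃_ν times a
character modulo 8. -/
theorem jacobiSym_eq_mul_ite {ν n : ℕ} (hν : Odd ν) (hn : Odd n) (h : n.Coprime ν) :
    J(ν | n) = J(n | ν) * if ν % 4 = 3 then J(-1 | n) else 1 := by
  have h1 := jacobiSym_mul_comm hν hn h.symm
  have h2 := jacobiSym_sq_eq_one (a := n) (b := ν) (Nat.isCoprime_iff_coprime.mpr h)
  have h3 : J(ν | n) = J(n | ν) * if ν % 4 = 3 ∧ n % 4 = 3 then -1 else 1 := by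
    rw [← h1, ← mul_assoc, h2, one_mul]
  rw [h3, jacobiSym.at_neg_one hn]
  congr 1
  have h5 : n % 4 = 1 ∨ n % 4 = 3 := by rcases hn with ⟨k, hk⟩; omega
  rcases h5 with h5 | h5
  · rw [ZMod.χ₄_nat_one_mod_four h5]; simp [h5]
  · rw [ZMod.χ₄_nat_three_mod_four h5]; simp [h5]

theorem odd_mul_of_or {M N : ℕ} (hM : M = 1 ∨ (M.Prime ∧ M ≠ 2)) (hN : N = 1 ∨ (N.Prime ∧ N ≠ 2)) :
    Odd (M * N) := by
  have h : ∀ {M : ℕ}, M = 1 ∨ (M.Prime ∧ M ≠ 2) → Odd M := by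
    rintro M (rfl | ⟨h1, h2⟩)
    · exact odd_one
    · exact h1.odd_of_ne_two h2
  exact (h hM).mul (h hN)

section

variable {j c : ℕ} {ψ' : DirichletCharacter ℂ 8} {ψs : DirichletCharacter ℂ c}
  {χ' : DirichletCharacter ℂ j}

/-- The reflected row with its factor expanded: apart from n^{1/2-w}, the dependence on n is through
the characters χ̃_ν ψ, which can be absorbed into the first character of Z. -/
theorem StarData.rowCoeff_eq_sum [NeZero c] (h : StarData j c ψ' ψs) (hχ' : χ' = chiTilde j)
    {M N : ℕ} (hM : M = 1 ∨ (M.Prime ∧ M ≠ 2)) (hN : N = 1 ∨ (N.Prime ∧ N ≠ 2)) (hj : j ∣ M * N)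
    (hMN : M = N → j = M) {n : ℕ} (hn : n.Coprime (2 * M * N)) {w : ℂ} (hw : w ∈ genericSet) :
    rowCoeff (χ'.mul ψ') (starL (2 * M * N) j ψs) n w = (n : ℂ) ^ (1 / 2 - w) *
      ((j : ℂ) ^ (1 / 2 - w) * ∑ ν ∈ (M * N).divisors, coeffA M N χ' ν w *
        ∑ ψ, coeff j ψ' ψs ν ψ w * (chiTilde ν n * ψ n)) *
      rowCoeff (χ'.mul ψ') (starL (2 * M * N) j ψs) n (1 - w) := by
  have hP : Even (2 * M * N) := ⟨M * N, by ring⟩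
  have hjP : j ∣ 2 * M * N := hj.trans ⟨2, by ring⟩
  have hn0 := ne_zero_of_coprime hn hP
  have hno := odd_of_coprime hn hP
  have hj0 : j ≠ 0 := h.squarefree_j.ne_zero
  have hm0 : sqfreePart n * j ≠ 0 := mul_ne_zero (sqfreePart_ne_zero n) hj0
  have hstar : ∀ a : ℤ, IsCoprime a n → starChar ψs (sqfreePart n * j) a =
      (J(a | n) : ℤ) * (J(a | j) : ℤ) * ψs a := fun a ha => by
    rw [starChar_intCast ψs hm0, jacobiSym.mul_right' _ (sqfreePart_ne_zero n) hj0,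
      jacobiSym_sqfreePart hn0 ha, Int.cast_mul]
  have hcop : ∀ p : ℕ, p ∣ 2 * M * N → IsCoprime (p : ℤ) n := fun p hp =>
    Nat.isCoprime_iff_coprime.mpr (Nat.Coprime.coprime_dvd_right hp hn).symm
  -- The sign t of `eulerRatio_eq` at ν = p, extended multiplicatively to all divisors of MN.
  let T : ℕ → ℂ := fun ν => ψ' ν * (J(ν | n) : ℤ)
  have hR : ∀ p : ℕ, p.Prime → p ≠ 2 → p ∣ 2 * M * N →
      eulerRatio (starChar ψs (sqfreePart n * j) p) p w =
        coeffF χ' p w + T p * coeffG χ' p w := by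
    intro p hp hp2 hpP
    have hpo : Odd (p : ℤ) := by exact_mod_cast hp.odd_of_ne_two hp2
    have h1 := hstar p (hcop p hpP)
    have h2 := h.eq_of_odd p hpo
    rw [Int.cast_natCast, Int.cast_natCast] at h2
    rw [Int.cast_natCast, Int.cast_natCast, h2] at h1
    have h3 : χ' (p : ZMod j) = (J(p | j) : ℤ) := by rw [hχ', chiTilde_natCast hj0]
    rw [h1, ← eulerRatio_eq χ' hp (t := T p) _ _ hw.2, h3]
    · congr 1
      simp only [T]
      ring
    · have h4 := psi_sq_eq_one ψ' hpo
      rw [Int.cast_natCast] at h4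
      simp only [T]
      rw [mul_pow, h4, one_mul, sq]
      exact_mod_cast jacobiSym_sq_eq_one (hcop p hpP)
    · rw [h3]
      by_cases hpj : p.Coprime j
      · right
        rw [sq]
        exact_mod_cast jacobiSym_sq_eq_one (Nat.isCoprime_iff_coprime.mpr hpj)
      · left
        rw [jacobiSym_eq_zero_of_not_coprime hj0 hpj, Int.cast_zero]
  rw [h.rowCoeff_reflect hχ' hP hjP hn hw,
    sum_coeffA (R := fun p => eulerRatio (starChar ψs (sqfreePart n * j) p) p w) (T := T) hM hN χ'
      _ _ _ (fun hM1 => hR M (hM.resolve_left hM1).1 (hM.resolve_left hM1).2 ⟨2 * N, by ring⟩)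
      (fun hN1 => hR N (hN.resolve_left hN1).1 (hN.resolve_left hN1).2 ⟨2 * M, by ring⟩)]
  · have hneg : starChar ψs (sqfreePart n * j) (-1) =
        (J(-1 | n) : ℤ) * ((J(-1 | j) : ℤ) * ψs (-1)) := by
      have := hstar (-1) isCoprime_one_left.neg_left
      push_cast at this
      rw [this, mul_assoc]
    have htwo : starChar ψs (sqfreePart n * j) (2 : ℕ) =
        (J(2 | n) : ℤ) * (J(2 | j) : ℤ) * ψs (2 : ℕ) := by
      have := hstar 2 (hcop 2 ⟨M * N, by ring⟩)
      push_cast at this ⊢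
      exact this
    have hsum : ∀ ν ∈ (M * N).divisors, ∑ ψ, coeff j ψ' ψs ν ψ w * (chiTilde ν n * ψ n) =
        T ν * ((c : ℂ) ^ (1 / 2 - w) * gammaSgn (starChar ψs (sqfreePart n * j) (-1)) w *
          eulerRatio (starChar ψs (sqfreePart n * j) (2 : ℕ)) 2 w) := by
      intro ν hν
      have hνd := Nat.dvd_of_mem_divisors hν
      have hνo : Odd ν := Odd.of_dvd_nat (odd_mul_of_or hM hN) hνd
      have hνn : n.Coprime ν := Nat.Coprime.coprime_dvd_right (hνd.trans ⟨2, by ring⟩) hn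
      have h1 := sum_coeff_mul ψ' ψs h.odd_j h.eq_one_or (NeZero.ne c) ν hno hw
      have h2 : ∑ ψ, coeff j ψ' ψs ν ψ w * (chiTilde ν n * ψ n) =
          chiTilde ν n * ∑ ψ, coeff j ψ' ψs ν ψ w * ψ n := by
        rw [Finset.mul_sum]
        exact Finset.sum_congr rfl fun ψ _ => by ring
      rw [h2, h1, ← hneg, ← htwo, chiTilde_natCast hνo.pos.ne']
      simp only [T, jacobiSym_eq_mul_ite hνo hno hνn]
      push_cast
      split_ifs <;> ring
    rw [Finset.sum_congr rfl fun ν hν => congrArg (coeffA M N χ' ν w * ·) (hsum ν hν)]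
    simp only [← mul_assoc, ← Finset.sum_mul]
    ring
  · intro h1 h2
    have hjM := hMN h1
    have hMp := (hM.resolve_left h2).1
    rw [hχ', chiTilde_natCast hj0, jacobiSym_eq_zero_of_not_coprime hj0, Int.cast_zero]
    rw [hjM, Nat.coprime_self]
    exact h2
  · simp [T]
  · simp only [T]
    push_cast
    rw [map_mul, jacobiSym.mul_left]
    push_cast
    ring

end

end DoubleDirichlet

/-! ### The functional equation of the double series. -/

namespace DoubleDirichlet

open Complex Filter Topology Metric
open scoped NumberTheorySymbols

section

variable {j c k : ℕ} {ψ' : DirichletCharacter ℂ 8} {ψs : DirichletCharacter ℂ c}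
  {χ' : DirichletCharacter ℂ j}

theorem StarData.isContinuation_Z [NeZero c] (h : StarData j c ψ' ψs) (hχ' : χ' = chiTilde j)
    {M N : ℕ} (hMN0 : M * N ≠ 0) (hj : j ∣ M * N) {q : ℕ} (hq : q ≠ 0)
    (χ : DirichletCharacter ℂ q) :
    IsContinuation M N χ (χ'.mul ψ') (Z M N χ (χ'.mul ψ')) := by
  have : NeZero q := ⟨hq⟩
  have hP0 : 2 * M * N ≠ 0 := by rw [mul_assoc]; exact mul_ne_zero two_ne_zero hMN0
  exact CoeffFamily.isContinuation_Z χ hP0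
    (h.coeffFamily ⟨M * N, by ring⟩ hP0 (hj.trans ⟨2, by ring⟩) hχ')

/-- Both sides are sums over n, convergent since (s,w) and its reflection lie in R₁^{(2)}, and they
agree term by term because n^{-s}·n^{1/2-w} = n^{-(s+w-1/2)}. -/
theorem StarData.functional_equation_of_mem_genericSet [NeZero c] (h : StarData j c ψ' ψs)
    (hχ' : χ' = chiTilde j) {M N : ℕ} (hM : M = 1 ∨ (M.Prime ∧ M ≠ 2))
    (hN : N = 1 ∨ (N.Prime ∧ N ≠ 2)) (hj : j ∣ M * N) (hMN : M = N → j = M) (hk : k ≠ 0)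
    (χ : DirichletCharacter ℂ k) (ψ : DirichletCharacter ℂ 8) {s w : ℂ} (hsw : (s, w) ∈ R12)
    (hw : w ∈ genericSet) :
    Z M N (χ.mul ψ) (χ'.mul ψ') (s, w) = (j : ℂ) ^ (1 / 2 - w) *
      ∑ ν ∈ (M * N).divisors, coeffA M N χ' ν w * ∑ φ, coeff j ψ' ψs ν φ w *
        Z M N ((χ.mul (chiTilde ν)).mul (ψ * φ)) (χ'.mul ψ') (s + w - 1 / 2, 1 - w) := by
  have hMN0 : M * N ≠ 0 := (odd_mul_of_or hM hN).pos.ne'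
  have hP0 : 2 * M * N ≠ 0 := by rw [mul_assoc]; exact mul_ne_zero two_ne_zero hMN0
  have hL := h.coeffFamily (P := 2 * M * N) ⟨M * N, by ring⟩ hP0 (hj.trans ⟨2, by ring⟩) hχ'
  have hw1 : w ≠ 1 := fun h => hw.1 (by simp [h])
  have hw2 : 1 - w ≠ 1 := fun h => hw.1 (by
    have : w = 0 := by linear_combination -h
    simp [this])
  have : NeZero (k.lcm 8) := ⟨Nat.lcm_ne_zero hk (by norm_num)⟩
  refine (hL.hasSum_Z (χ.mul ψ) hP0 hsw hw1).unique ?_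
  have hsum : HasSum (fun n : ℕ => (j : ℂ) ^ (1 / 2 - w) * ∑ ν ∈ (M * N).divisors,
      coeffA M N χ' ν w * ∑ φ : DirichletCharacter ℂ 8, coeff j ψ' ψs ν φ w *
        (if n.Coprime (2 * M * N) then
          twist ((χ.mul (chiTilde ν)).mul (ψ * φ)) (s + w - 1 / 2) n *
            rowCoeff (χ'.mul ψ') (starL (2 * M * N) j ψs) n (1 - w) else 0))
      ((j : ℂ) ^ (1 / 2 - w) *
      ∑ ν ∈ (M * N).divisors, coeffA M N χ' ν w * ∑ φ, coeff j ψ' ψs ν φ w *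
        Z M N ((χ.mul (chiTilde ν)).mul (ψ * φ)) (χ'.mul ψ') (s + w - 1 / 2, 1 - w)) := by
    refine HasSum.mul_left _ (hasSum_sum fun ν hν => HasSum.mul_left _
      (hasSum_sum fun φ _ => HasSum.mul_left _ ?_))
    have hν0 : ν ≠ 0 := ne_zero_of_dvd_ne_zero hMN0 (Nat.dvd_of_mem_divisors hν)
    have : NeZero ((k.lcm ν).lcm 8) := ⟨Nat.lcm_ne_zero (Nat.lcm_ne_zero hk hν0) (by norm_num)⟩
    exact hL.hasSum_Z _ hP0 (R12_reflect hsw) hw2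
  convert hsum using 1
  funext n
  by_cases hn : n.Coprime (2 * M * N)
  · have hn0 : (n : ℂ) ≠ 0 :=
      Nat.cast_ne_zero.mpr (ne_zero_of_coprime hn ⟨M * N, by ring⟩)
    have hpow : (n : ℂ) ^ (-(s + w - 1 / 2)) = (n : ℂ) ^ (-s) * (n : ℂ) ^ (1 / 2 - w) := by
      rw [← cpow_add _ _ hn0]
      congr 1
      ring
    simp only [if_pos hn]
    rw [h.rowCoeff_eq_sum hχ' hM hN hj hMN hn hw]
    simp only [twist, mul_apply_natCast, MulChar.mul_apply, hpow]
    simp only [Finset.mul_sum, Finset.sum_mul]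
    refine Finset.sum_congr rfl fun ν _ => Finset.sum_congr rfl fun φ _ => ?_
    ring
  · simp only [if_neg hn, mul_zero, Finset.sum_const_zero]

/-- With s fixed, both sides are continuous in w wherever the coefficients are analytic and neither
second variable equals 1, so the identity extends from the dense set `genericSet`. -/
theorem StarData.functional_equation [NeZero c] (h : StarData j c ψ' ψs)
    (hχ' : χ' = chiTilde j) {M N : ℕ} (hM : M = 1 ∨ (M.Prime ∧ M ≠ 2))
    (hN : N = 1 ∨ (N.Prime ∧ N ≠ 2)) (hj : j ∣ M * N) (hMN : M = N → j = M) (hk : k ≠ 0)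
    (χ : DirichletCharacter ℂ k) (ψ : DirichletCharacter ℂ 8) {s w : ℂ} (hsw : (s, w) ∈ R12)
    (hw1 : w ≠ 1) (hw2 : 1 - w ≠ 1)
    (hA : ∀ ν ∈ (M * N).divisors, AnalyticAt ℂ (coeffA M N χ' ν) w ∧
      ∀ φ, AnalyticAt ℂ (coeff j ψ' ψs ν φ) w) :
    Z M N (χ.mul ψ) (χ'.mul ψ') (s, w) = (j : ℂ) ^ (1 / 2 - w) *
      ∑ ν ∈ (M * N).divisors, coeffA M N χ' ν w * ∑ φ, coeff j ψ' ψs ν φ w *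
        Z M N ((χ.mul (chiTilde ν)).mul (ψ * φ)) (χ'.mul ψ') (s + w - 1 / 2, 1 - w) := by
  have hMN0 : M * N ≠ 0 := (odd_mul_of_or hM hN).pos.ne'
  have hcont : ∀ {q : ℕ} (hq : q ≠ 0) (χ : DirichletCharacter ℂ q) {x : ℂ × ℂ}, x ∈ R12 →
      x.2 ≠ 1 → ContinuousAt (Z M N χ (χ'.mul ψ')) x := fun hq χ x hx hx2 =>
    ((h.isContinuation_Z hχ' hMN0 hj hq χ).holomorphic.differentiableAt
      (isOpen_R12_diff.mem_nhds ⟨hx, hx2⟩)).continuousAt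
  have hj0 : (j : ℂ) ≠ 0 := Nat.cast_ne_zero.mpr h.squarefree_j.ne_zero
  have hk8 : k.lcm 8 ≠ 0 := Nat.lcm_ne_zero hk (by norm_num)
  have hleft : ContinuousAt (fun z => Z M N (χ.mul ψ) (χ'.mul ψ') (s, z)) w :=
    ContinuousAt.comp (f := fun z : ℂ => (s, z)) (hcont hk8 (χ.mul ψ) hsw hw1) (by fun_prop)
  have hright : ContinuousAt (fun z => (j : ℂ) ^ (1 / 2 - z) *
      ∑ ν ∈ (M * N).divisors, coeffA M N χ' ν z * ∑ φ, coeff j ψ' ψs ν φ z *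
        Z M N ((χ.mul (chiTilde ν)).mul (ψ * φ)) (χ'.mul ψ') (s + z - 1 / 2, 1 - z)) w := by
    refine ContinuousAt.mul (ContinuousAt.const_cpow (by fun_prop) (Or.inl hj0)) ?_
    refine tendsto_finsetSum _ fun ν hν => ?_
    refine ContinuousAt.mul (hA ν hν).1.continuousAt ?_
    refine tendsto_finsetSum _ fun φ _ => ?_
    refine ContinuousAt.mul ((hA ν hν).2 φ).continuousAt ?_
    have hν0 : ν ≠ 0 := ne_zero_of_dvd_ne_zero hMN0 (Nat.dvd_of_mem_divisors hν)
    exact ContinuousAt.comp (f := fun z : ℂ => (s + z - 1 / 2, 1 - z))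
      (hcont (Nat.lcm_ne_zero (Nat.lcm_ne_zero hk hν0) (by norm_num)) _ (R12_reflect hsw) hw2)
      (by fun_prop)
  have : (𝓝[genericSet] w).NeBot := neBot_nhdsWithin_genericSet w
  have hmem : ∀ᶠ z in 𝓝 w, (s, z) ∈ R12 :=
    (show ContinuousAt (fun z : ℂ => (s, z)) w by fun_prop).eventually
      (isOpen_R12.mem_nhds hsw)
  refine tendsto_nhds_unique (l := 𝓝[genericSet] w)
    (hleft.tendsto.mono_left nhdsWithin_le_nhds)
    (Tendsto.congr' ?_ (hright.tendsto.mono_left nhdsWithin_le_nhds))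
  filter_upwards [self_mem_nhdsWithin, hmem.filter_mono nhdsWithin_le_nhds] with z hz hz2
  exact (h.functional_equation_of_mem_genericSet hχ' hM hN hj hMN hk χ ψ hz2 hz).symm

end

end DoubleDirichlet

theorem mainTheorem6 :
    ∃ C : ℝ → ℝ,
      ∀ (M N : ℕ), (M = 1 ∨ (M.Prime ∧ M ≠ 2)) → (N = 1 ∨ (N.Prime ∧ N ≠ 2)) →
      ∀ (j : ℕ), Squarefree j → j ∣ M * N → (M = N → j = M) →
      ∀ (χ' : DirichletCharacter ℂ j), χ'.IsPrimitive → χ' ^ 2 = 1 →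
      ∀ (ψ' : DirichletCharacter ℂ 8),
      ∃ a : ℕ → DirichletCharacter ℂ 8 → ℂ → ℂ,
        -- the coefficients are meromorphic, with poles only where allowed, and bounded
        (∀ n ∈ (M * N).divisors, ∀ ψs : DirichletCharacter ℂ 8,
          MeromorphicNFOn (a n ψs) Set.univ ∧
          (∀ w : ℂ, ¬ AnalyticAt ℂ (a n ψs) w → (∃ m : ℕ, 0 < m ∧ w = m) ∨ w.re = 1) ∧
          {w : ℂ | ¬ AnalyticAt ℂ (a n ψs) w}.Countable ∧
          (∀ δ : ℝ, 0 < δ → ∀ w : ℂ,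
            (∀ p : ℂ, ¬ AnalyticAt ℂ (a n ψs) p → δ ≤ ‖w - p‖) →
            ‖a n ψs w‖ ≤ C δ * (16 * Real.pi) ^ |w.re| * (1 + ‖w‖) ^ (1 / 2 - w.re))) ∧
        ∀ (k : ℕ), Squarefree k → k ∣ M * N → (M = N → k = M) →
        ∀ (χ : DirichletCharacter ℂ k), χ.IsPrimitive →
        ∀ (ψ : DirichletCharacter ℂ 8),
          -- the series involved do continue to the region in question
          DoubleDirichlet.IsContinuation M N (χ.mul ψ) (χ'.mul ψ')
            (DoubleDirichlet.Z M N (χ.mul ψ) (χ'.mul ψ')) ∧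
          (∀ n ∈ (M * N).divisors, ∀ ψs : DirichletCharacter ℂ 8,
            DoubleDirichlet.IsContinuation M N
              ((χ.mul (DoubleDirichlet.chiTilde n)).mul (ψ * ψs)) (χ'.mul ψ')
              (DoubleDirichlet.Z M N
                ((χ.mul (DoubleDirichlet.chiTilde n)).mul (ψ * ψs)) (χ'.mul ψ'))) ∧
          -- the functional equation, away from the polar lines and the poles of the coefficients
          ∀ s w : ℂ, (s, w) ∈ DoubleDirichlet.R12 → w ≠ 1 → 1 - w ≠ 1 →
            (∀ n ∈ (M * N).divisors, AnalyticAt ℂ (DoubleDirichlet.coeffA M N χ' n) w ∧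
              ∀ ψs : DirichletCharacter ℂ 8, AnalyticAt ℂ (a n ψs) w) →
            DoubleDirichlet.Z M N (χ.mul ψ) (χ'.mul ψ') (s, w) =
              (j : ℂ) ^ (1 / 2 - w) *
                ∑ n ∈ (M * N).divisors, DoubleDirichlet.coeffA M N χ' n w *
                  ∑ ψs : DirichletCharacter ℂ 8, a n ψs w *
                    DoubleDirichlet.Z M N
                      ((χ.mul (DoubleDirichlet.chiTilde n)).mul (ψ * ψs)) (χ'.mul ψ')
                      (s + w - 1 / 2, 1 - w) := by
  obtain ⟨C, hC⟩ := DoubleDirichlet.coeff_properties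
  refine ⟨C, fun M N hM hN j hj hjd hMN χ' hχ' hsq ψ' => ?_⟩
  obtain ⟨c, hc, ψs, hc8, hc2, hsd, hodd, hrec⟩ := DoubleDirichlet.exists_selfDual_mod_eight ψ'
  have hMNo := DoubleDirichlet.odd_mul_of_or hM hN
  have h : DoubleDirichlet.StarData j c ψ' ψs :=
    ⟨Odd.of_dvd_nat hMNo hjd, hj, hc8, hc2, hsd, hodd, hrec⟩
  have hχj := DoubleDirichlet.eq_chiTilde_of_isPrimitive hj χ' hχ' hsq
  refine ⟨DoubleDirichlet.coeff j ψ' ψs, fun n _ φ => hC j c ψ' ψs n φ hc8,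
    fun k hk _ _ χ _ ψ => ⟨?_, fun n hn φ => ?_, fun s w hsw hw1 hw2 hA => ?_⟩⟩
  · exact h.isContinuation_Z hχj hMNo.pos.ne' hjd (Nat.lcm_ne_zero hk.ne_zero (by norm_num)) _
  · have hn0 := ne_zero_of_dvd_ne_zero hMNo.pos.ne' (Nat.dvd_of_mem_divisors hn)
    exact h.isContinuation_Z hχj hMNo.pos.ne' hjd
      (Nat.lcm_ne_zero (Nat.lcm_ne_zero hk.ne_zero hn0) (by norm_num)) _
  · exact h.functional_equation hχj hM hN hjd hMN hk.ne_zero χ ψ hsw hw1 hw2 hA
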